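/- Let $q$ be an odd prime power, let $V$ be a vector space of dimension $n\geqslant 7$ over $\mathbb{F}_q$ with a non-degenerate quadratic form $Q$ with polar form $B$, let $\Omega(V)$ be the commutator subgroup of the orthogonal group $\mathrm{O}(V,Q)$, and let $G=\mathrm{P}\Omega(V)=\mathrm{P}\Omega_n^{\varepsilon}(q)$ be its quotient by the scalars contained in it (all types $\varepsilon$ are allowed). A long root $\mathrm{SL}_2(q)$-subgroup of $G$ is the image in $G$ of a subgroup $\langle X_{a,b},X_{c,d}\rangle$ of $\Omega(V)$, where $(a,c)$ and $(b,d)$ are mutually orthogonal hyperbolic pairs of $V$ and $X_{u,v}$ denotes the long root subgroup of all maps $x\mapsto x+t\,(B(x,u)v-B(x,v)u)$, $t\in\mathbb{F}_q$. A classical involution of $G$ is an element of order $2$ lying in a long root $\mathrm{SL}_2(q)$-subgroup. For an involution $i\in G$ and $g\in G$ put $i^g=g^{-1}ig$; let $\zeta_0^i(g)$ be the unique involution in $\langle ii^g\rangle$ if $ii^g$ has even order, and $\zeta_0^i(g)=1$ otherwise. Let $K$ be a long root $\mathrm{SL}_2(q)$-subgroup of $G$ and let $i$ be the (unique) involution in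 $K$. Then, for a uniformly distributed random element $g\in G$, the probability that $\zeta_0^i(g)$ is a classical involution and $\zeta_0^i(g)\in N_G(K)$ is at least $$\left(\frac{1}{2^{16}}-\frac{1}{q^{11}}\right)\left(1-\frac{2}{q}\right).$$ -/

import Mathlib

namespace OrthogonalBlackBox

section Groups

variable {F V : Type*} [Field F] [AddCommGroup V] [Module F V]

/-- The orthogonal group `O(V, Q)`: all invertible linear maps of `V` preserving `Q`. -/
def orthogonalGroup (Q : QuadraticForm F V) : Subgroup (V ≃ₗ[F] V) where
  carrier := {g | ∀ x, Q (g x) = Q x}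
  one_mem' := fun _ => rfl
  mul_mem' := fun {g h} hg hh x => by
    change Q (g (h x)) = Q x
    rw [hg, hh]
  inv_mem' := fun {g} hg x => by
    have h := hg (g⁻¹ x)
    rwa [show g (g⁻¹ x) = x from g.apply_symm_apply x, eq_comm] at h

/-- `Ω(V, Q)`, the commutator subgroup of `O(V, Q)`. -/
def Omega (Q : QuadraticForm F V) : Subgroup (V ≃ₗ[F] V) :=
  ⁅orthogonalGroup Q, orthogonalGroup Q⁆

/-- The scalar transformations contained in `Ω(V, Q)`. -/
def scalars (Q : QuadraticForm F V) : Subgroup (Omega Q) where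
  carrier := {g | ∃ c : F, ∀ x, (g : V ≃ₗ[F] V) x = c • x}
  one_mem' := ⟨1, fun x => (one_smul F x).symm⟩
  mul_mem' := by
    rintro g h ⟨c, hc⟩ ⟨d, hd⟩
    refine ⟨c * d, fun x => ?_⟩
    change (g : V ≃ₗ[F] V) ((h : V ≃ₗ[F] V) x) = _
    rw [hd, hc, mul_smul]
  inv_mem' := by
    rintro g ⟨c, hc⟩
    refine ⟨c⁻¹, fun x => ?_⟩
    change (g : V ≃ₗ[F] V).symm x = _
    rw [LinearEquiv.symm_apply_eq, map_smul, hc, smul_smul]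
    rcases eq_or_ne c 0 with rfl | h
    · rw [(g : V ≃ₗ[F] V).injective ((hc x).trans ((zero_smul F x).trans (map_zero _).symm)),
        smul_zero]
    · rw [inv_mul_cancel₀ h, one_smul]

instance scalars_normal (Q : QuadraticForm F V) : (scalars Q).Normal where
  conj_mem := by
    rintro g ⟨c, hc⟩ h
    refine ⟨c, fun x => ?_⟩
    change (h : V ≃ₗ[F] V) ((g : V ≃ₗ[F] V) ((h : V ≃ₗ[F] V).symm x)) = _
    rw [hc, map_smul, LinearEquiv.apply_symm_apply]

/-- The projective group `PΩ(V, Q)`, that is, `Ω(V, Q)` modulo scalars. -/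
abbrev POmega (Q : QuadraticForm F V) : Type _ := Omega Q ⧸ scalars Q

/-- `(a, c)` and `(b, d)` are two mutually orthogonal hyperbolic pairs of `(V, Q)`. They extend to
a hyperbolic basis of a maximal split subspace, so that `⟨a, b⟩` and `⟨c, d⟩` are the totally
singular lines that belong to a long root `r` and to its negative `-r`. -/
structure IsHyperbolicQuadruple (Q : QuadraticForm F V) (a b c d : V) : Prop where
  singular_a : Q a = 0
  singular_b : Q b = 0
  singular_c : Q c = 0
  singular_d : Q d = 0
  polar_ab : QuadraticMap.polar Q a b = 0
  polar_cd : QuadraticMap.polar Q c d = 0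
  polar_ad : QuadraticMap.polar Q a d = 0
  polar_bc : QuadraticMap.polar Q b c = 0
  polar_ac : QuadraticMap.polar Q a c = 1
  polar_bd : QuadraticMap.polar Q b d = 1

/-- The long root subgroup of `Ω(V, Q)` belonging to the totally singular line `⟨a, b⟩`: it
consists of the Siegel transformations `x ↦ x + t (B(x, a) b - B(x, b) a)`, `t ∈ F`, where `B` is
the polar form of `Q`. -/
def longRootSubgroup (Q : QuadraticForm F V) (a b : V) : Subgroup (Omega Q) :=
  Subgroup.closure {g | ∃ t : F, ∀ x, (g : V ≃ₗ[F] V) x =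
    x + t • (QuadraticMap.polar Q x a • b - QuadraticMap.polar Q x b • a)}

/-- `K` is a long root `SL₂(q)`-subgroup of `PΩ(V, Q)`: the subgroup generated by two opposite
long root subgroups. -/
def IsLongRootSL2 (Q : QuadraticForm F V) (K : Subgroup (POmega Q)) : Prop :=
  ∃ a b c d : V, IsHyperbolicQuadruple Q a b c d ∧
    K = (longRootSubgroup Q a b ⊔ longRootSubgroup Q c d).map (QuotientGroup.mk' (scalars Q))

/-- A classical involution of `PΩ(V, Q)`: an involution lying in some long root
`SL₂(q)`-subgroup. -/
def IsClassicalInvolution (Q : QuadraticForm F V) (t : POmega Q) : Prop :=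
  orderOf t = 2 ∧ ∃ K : Subgroup (POmega Q), IsLongRootSL2 Q K ∧ t ∈ K

end Groups

section Zeta

variable {G : Type*} [Group G]

/-- For `x` of even order, the involution that is a power of `x` (the last non-identity term of
`x ^ m, x ^ (2 * m), x ^ (4 * m), …`, where `m` is the odd part of an exponent). -/
noncomputable def involutionOf (x : G) : G := x ^ (orderOf x / 2)

open Classical in
/-- The map `ζ₀ⁱ`: with `i ^ g = g⁻¹ i g`, the involution in `⟨i i ^ g⟩` if `i i ^ g` has even order,
and `1` otherwise. -/
noncomputable def zeta0 (i g : G) : G :=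
  if Even (orderOf (i * (g⁻¹ * i * g))) then involutionOf (i * (g⁻¹ * i * g)) else 1

end Zeta

end OrthogonalBlackBox

namespace OrthogonalBlackBox

/-! ### Frobenius powers of roots of reciprocal quadratics and quartics -/

section FrobeniusPowers

variable {F R : Type*} [Field F] [Finite F] [CommRing R] [Algebra F R]

/-! Let U = ⟨a, b, c, d⟩ be the hyperbolic 4-space of K. The involution `i` lifts to the isometry
that is -1 on U and 1 on its orthogonal complement, so its conjugate by g lifts to -1 on W = g⁻¹U.
Since Ω(V) is transitive on hyperbolic quadruples (`exists_Omega_quadruple`), the quadruple g⁻¹(a,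
b, c, d) is uniformly distributed, and it suffices to count the quadruples whose span W lies in a
good position to U.

Good position is expressed by `IsFrame`. The planes ⟨x₁, x₂⟩ of U and ⟨w₁, w₂⟩ of W lie in one
hyperbolic 4-space H = ⟨x₁, x₂, y₁, y₂⟩, where y₁ and y₂ are orthogonal to U. The remaining parts of
U and W have bases u₃, u₄ and w₃, w₄ orthogonal to H, with {u₃, w₃} orthogonal to {u₄, w₄}. Writing
both isometries as products of four reflections, their product becomes a product of three commuting
factors: one acting on H, and two products of two reflections each.

Put N = q(q² - 1)/2. The two small factors have trivial N-th power (`refl_mul_refl_pow`). The factor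
on H has N-th power -1 on H: for its eigenvalues x the number (x + 1)²/(4x) is a root of X² - sX +
p, and because p, 1 - s + p and the discriminant are non-squares, x to the power (q² - 1)/2 is -1
(`pow_eq_neg_one_of_quartic`). Hence ζ₀ is the image of -1 on H (`mul_pow_eq`), which is a classical
involution. It is also the product of the reflections in x₁, x₂, y₁, y₂. Those in y₁ and y₂
centralize the SL₂, while each of those in x₁ and x₂ interchanges the two SL₂-factors belonging to U
(`refl_conj_mem`), so the product normalizes K (`zeta0_of_frame`).

For the count, the parameters (s, p) come from at least ((q - 1)/2)² pairs (`le_ncard_params`), and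
the vectors of a frame are chosen successively with the lower bound (q - 1)qᵈ for a prescribed
non-zero norm in a non-degenerate space of dimension d + 2 (`le_ncard_quadric`). Projecting to U and
back to W is a self-adjoint map of W from which the frame can be recovered up to 64 choices
(`ncard_frames_fiber_le`). Each W carries at least 2(q - 1)²q⁴ quadruples (`le_ncard_hypQuads`),
against at most 4q^(4n+18) in V of dimension n + 7 (`ncard_hypQuads_top_le`); `ratio_bound` compares
these numbers. -/

theorem algebraMap_pow_natCard (c : F) :
    (algebraMap F R c) ^ Nat.card F = algebraMap F R c := by
  have := Fintype.ofFinite F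
  rw [Nat.card_eq_fintype_card, ← map_pow, FiniteField.pow_card]

theorem add_pow_natCard (x y : R) :
    (x + y) ^ Nat.card F = x ^ Nat.card F + y ^ Nat.card F := by
  have := Fintype.ofFinite F
  simpa [Nat.card_eq_fintype_card] using map_add (FiniteField.frobeniusAlgHom F R) x y

theorem sub_pow_natCard (x y : R) :
    (x - y) ^ Nat.card F = x ^ Nat.card F - y ^ Nat.card F := by
  have := Fintype.ofFinite F
  simpa [Nat.card_eq_fintype_card] using map_sub (FiniteField.frobeniusAlgHom F R) x y

theorem pow_eq_zero_or_one_or_neg_one {k : ℕ} (hk : Nat.card F = 2 * k + 1) (D : F) :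
    D = 0 ∨ D ^ k = 1 ∨ D ^ k = -1 := by
  have h := algebraMap_pow_natCard (R := F) D
  simp only [Algebra.algebraMap_self, RingHom.id_apply] at h
  rw [hk] at h
  by_cases hD : D = 0
  · exact Or.inl hD
  · right
    have : (D ^ k) * (D ^ k) = 1 := by
      apply mul_right_cancel₀ hD
      rw [one_mul]
      exact Eq.trans (by ring) h
    exact mul_self_eq_one_iff.mp this

theorem four_pow_eq_one {k : ℕ} (hk : Nat.card F = 2 * k + 1) (h2 : (2 : F) ≠ 0) :
    (4 : F) ^ k = 1 := by
  have h := algebraMap_pow_natCard (R := F) (2 : F)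
  simp only [Algebra.algebraMap_self, RingHom.id_apply] at h
  rw [hk, pow_succ, pow_mul] at h
  have h4 : (4 : F) = 2 ^ 2 := by norm_num
  rw [h4]
  exact mul_right_cancel₀ h2 (by rw [h, one_mul])

end FrobeniusPowers

theorem isUnit_two_of_ne {F R : Type*} [Field F] [CommRing R] [Algebra F R] (h2 : (2 : F) ≠ 0) : IsUnit (2 : R) := by
  have := (IsUnit.mk0 _ h2).map (algebraMap F R)
  rwa [map_ofNat] at this

section FrobeniusPowers

variable {F R : Type*} [Field F] [Finite F] [CommRing R] [Algebra F R]

/-- A root of a reciprocal quadratic polynomial over `F` has order dividing `q (q² - 1) / 2`. -/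
theorem pow_eq_one_of_quadratic {k : ℕ} (hk0 : 0 < k) (hk : Nat.card F = 2 * k + 1)
    (h2 : (2 : F) ≠ 0) (t : F) (x : R) (hx : x ^ 2 - algebraMap F R t * x + 1 = 0) :
    x ^ ((2 * k + 1) * (2 * k * (k + 1))) = 1 := by
  set τ := algebraMap F R t with hτ
  -- The other root, which is also the inverse of `x`. The ring `R` may have zero divisors, being
  -- later the quotient by a possibly reducible polynomial, so all cancellations below are by units.
  set y := τ - x with hy
  have hxy : x * y = 1 := by rw [hy]; linear_combination -hx
  have hu2 : IsUnit (2 : R) := isUnit_two_of_ne (F := F) h2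
  have hsum : x + y = τ := by rw [hy]; ring
  have hD : (x - y) ^ 2 = algebraMap F R (t ^ 2 - 4) := by
    rw [map_sub, map_pow, ← hτ, ← hsum]
    simp only [map_ofNat]
    linear_combination (-4) * hxy
  -- With D = t² - 4, Frobenius multiplies `x - y` by D ^ k, which is 0, 1 or -1. The three cases
  -- lead to x^(2q) = 1, x^(q-1) = 1 and x^(q+1) = 1.
  have hq : (x - y) ^ Nat.card F = algebraMap F R ((t ^ 2 - 4) ^ k) * (x - y) := by
    rw [hk, pow_succ, pow_mul, hD, map_pow]
  have hs : (x + y) ^ Nat.card F = x + y := by rw [hsum, hτ, algebraMap_pow_natCard]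
  have h2x : 2 * x ^ Nat.card F = (x + y) + algebraMap F R ((t ^ 2 - 4) ^ k) * (x - y) := by
    have e1 := add_pow_natCard (F := F) x y
    have e2 := sub_pow_natCard (F := F) x y
    linear_combination hs + hq - e1 - e2
  rw [hk] at h2x
  have hxu : IsUnit x := IsUnit.of_mul_eq_one _ hxy
  rcases pow_eq_zero_or_one_or_neg_one hk (t ^ 2 - 4) with h | h | h
  · have ht : (t - 2) * (t + 2) = 0 := by linear_combination h
    rw [h, zero_pow hk0.ne', map_zero, zero_mul, add_zero, hsum] at h2x
    have hsq : (x ^ (2 * k + 1)) ^ 2 = 1 := by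
      apply (hu2.pow 2).mul_left_cancel
      rw [← mul_pow, h2x, hτ, ← map_pow]
      have : t ^ 2 = 4 := by linear_combination h
      rw [this, map_ofNat]; norm_num
    rw [pow_mul, show 2 * k * (k + 1) = 2 * (k * (k + 1)) by ring, pow_mul, hsq, one_pow]
  · rw [h, map_one, one_mul] at h2x
    have h1 : x ^ (2 * k + 1) = x := hu2.mul_left_cancel (by rw [h2x]; ring)
    have h3 : x ^ (2 * k) = 1 := hxu.mul_right_cancel (by rw [← pow_succ, h1, one_mul])
    rw [show (2 * k + 1) * (2 * k * (k + 1)) = 2 * k * ((2 * k + 1) * (k + 1)) by ring, pow_mul, h3,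
      one_pow]
  · rw [h, map_neg, map_one] at h2x
    have h1 : x ^ (2 * k + 1) = y := hu2.mul_left_cancel (by rw [h2x]; ring)
    have h3 : x ^ (2 * (k + 1)) = 1 := by
      rw [show 2 * (k + 1) = (2 * k + 1) + 1 by ring, pow_succ, h1, mul_comm, hxy]
    rw [show (2 * k + 1) * (2 * k * (k + 1)) = 2 * (k + 1) * ((2 * k + 1) * k) by ring, pow_mul, h3,
      one_pow]

/-- If `(x + 1)² / (4 x)` is a root of `X² - s X + p`, where `p`, `1 - s + p` and the discriminant
are non-squares of `F`, then `x ^ ((q² - 1) / 2) = -1`. -/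
theorem pow_eq_neg_one_of_quartic {k : ℕ} (hk : Nat.card F = 2 * k + 1)
    (h2 : (2 : F) ≠ 0) (s p : F) (hp : p ^ k = -1) (hp1 : (1 - s + p) ^ k = -1)
    (hd : (s ^ 2 - 4 * p) ^ k = -1) (x : R)
    (hx : (x + 1) ^ 4 - algebraMap F R (4 * s) * (x * (x + 1) ^ 2)
      + algebraMap F R (16 * p) * x ^ 2 = 0) :
    x ^ (2 * k * (k + 1)) = -1 := by
  have hu2 : IsUnit (2 : R) := isUnit_two_of_ne (F := F) h2
  set σ := algebraMap F R s with hσ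
  set π := algebraMap F R p with hπ
  rw [map_mul, map_mul, ← hσ, ← hπ, map_ofNat, map_ofNat] at hx
  -- The inverse of `x`, read off from the quartic, whose constant term is 1.
  set y := -(x ^ 3 + 4 * x ^ 2 + 6 * x + 4 - 4 * σ * (x + 1) ^ 2 + 16 * π * x) with hy
  have hxy : x * y = 1 := by rw [hy]; linear_combination -hx
  -- `Z` = (x + 1)²/x is four times a root of X² - sX + p.
  set Z := x + y + 2 with hZ
  have hxZ : x * Z = (x + 1) ^ 2 := by rw [hZ]; linear_combination hxy
  have hyu : IsUnit y := IsUnit.of_mul_eq_one x (by rw [mul_comm, hxy])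
  have hxu : IsUnit x := IsUnit.of_mul_eq_one _ hxy
  have hZ2 : Z ^ 2 - 4 * σ * Z + 16 * π = 0 := by
    apply (hxu.pow 2).mul_left_cancel
    rw [mul_zero]
    linear_combination hx + (x * Z + (x + 1) ^ 2 - 4 * σ * x) * hxZ
  have h4k : (4 : F) ^ k = 1 := four_pow_eq_one hk h2
  have h16k : (16 : F) ^ k = 1 := by
    rw [show (16 : F) = 4 * 4 by norm_num, mul_pow, h4k, one_mul]
  have hZs : (Z - 2 * σ) ^ Nat.card F = -(Z - 2 * σ) := by
    have : (Z - 2 * σ) ^ 2 = algebraMap F R (4 * (s ^ 2 - 4 * p)) := by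
      rw [map_mul, map_sub, map_mul, map_pow, ← hσ, ← hπ, map_ofNat]
      linear_combination hZ2
    rw [hk, pow_succ, pow_mul, this, ← map_pow, mul_pow, h4k, hd]
    simp
  have hconst : ∀ c : F, (algebraMap F R c) ^ Nat.card F = algebraMap F R c :=
    algebraMap_pow_natCard
  have hσ2 : (2 * σ) ^ Nat.card F = 2 * σ := by
    have := hconst (2 * s); rwa [map_mul, map_ofNat] at this
  -- As the discriminant is a non-square, Frobenius takes `Z` to the other root. So Z^(q+1) is the
  -- product 16p of both roots, and p ^ k = -1 gives the sign in `hZN`.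
  have hZq : Z ^ Nat.card F = 4 * σ - Z := by
    rw [sub_pow_natCard, hσ2] at hZs
    linear_combination hZs
  have hZq1 : Z ^ (2 * (k + 1)) = algebraMap F R (16 * p) := by
    rw [show 2 * (k + 1) = (2 * k + 1) + 1 by ring, pow_succ, ← hk, hZq, map_mul, map_ofNat, ← hπ]
    linear_combination -hZ2
  have hZN : Z ^ (2 * k * (k + 1)) = -1 := by
    rw [show 2 * k * (k + 1) = 2 * (k + 1) * k by ring, pow_mul, hZq1, ← map_pow, mul_pow, h16k, hp]
    simp
  have h4q : (4 : R) ^ Nat.card F = 4 := by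
    have := hconst 4; rwa [map_ofNat] at this
  -- The norm of `Z - 4` is the value at 4 of the quadratic satisfied by `Z`.
  have hZ4q1 : (Z - 4) ^ (2 * (k + 1)) = algebraMap F R (16 * (1 - s + p)) := by
    rw [show 2 * (k + 1) = (2 * k + 1) + 1 by ring, pow_succ, ← hk, sub_pow_natCard, h4q, hZq,
      map_mul, map_add, map_sub, map_ofNat, map_one, ← hπ, ← hσ]
    linear_combination -hZ2
  have hZ4N : (Z - 4) ^ (2 * k * (k + 1)) = -1 := by
    rw [show 2 * k * (k + 1) = 2 * (k + 1) * k by ring, pow_mul, hZ4q1, ← map_pow, mul_pow, h16k,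
      hp1]
    simp
  have hqq : Nat.card F * Nat.card F = 2 * (2 * k * (k + 1)) + 1 := by rw [hk]; ring
  -- Since (x - y)² = Z(Z - 4), the two signs -1 cancel. Thus `x - y`, and with it `x`, is fixed by
  -- the q²-power map.
  have hdiff : (x - y) ^ (Nat.card F * Nat.card F) = x - y := by
    have : (x - y) ^ 2 = Z * (Z - 4) := by rw [hZ]; linear_combination (-4) * hxy
    rw [hqq, pow_succ, pow_mul, this, mul_pow, hZN, hZ4N]; ring
  have h2q : (2 : R) ^ Nat.card F = 2 := by
    have := hconst 2; rwa [map_ofNat] at this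
  have hσ4 : (4 * σ) ^ Nat.card F = 4 * σ := by
    have := hconst (4 * s); rwa [map_mul, map_ofNat] at this
  have hsum : (x + y) ^ (Nat.card F * Nat.card F) = x + y := by
    have : x + y = Z - 2 := by rw [hZ]; ring
    rw [this, pow_mul, sub_pow_natCard, h2q, hZq, sub_pow_natCard, h2q, sub_pow_natCard, hσ4, hZq]
    ring
  have hxqq : x ^ (Nat.card F * Nat.card F) = x := by
    apply hu2.mul_left_cancel
    have e1 : (x + y) ^ (Nat.card F * Nat.card F)
        = x ^ (Nat.card F * Nat.card F) + y ^ (Nat.card F * Nat.card F) := by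
      rw [pow_mul, add_pow_natCard, add_pow_natCard, ← pow_mul, ← pow_mul]
    have e2 : (x - y) ^ (Nat.card F * Nat.card F)
        = x ^ (Nat.card F * Nat.card F) - y ^ (Nat.card F * Nat.card F) := by
      rw [pow_mul, sub_pow_natCard, sub_pow_natCard, ← pow_mul, ← pow_mul]
    linear_combination hsum + hdiff - e1 - e2
  have h1x : (x + 1) ^ (Nat.card F * Nat.card F) = x + 1 := by
    rw [pow_mul, add_pow_natCard, add_pow_natCard, ← pow_mul, hxqq, one_pow, one_pow]
  have hZu : IsUnit Z := by
    apply IsUnit.of_mul_eq_one (-(Z ^ (2 * k * (k + 1) - 1)))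
    have hpos : 2 * k * (k + 1) ≠ 0 := by
      intro h0
      rw [h0, pow_zero] at hZN
      have hk0 : k = 0 := by
        rcases Nat.mul_eq_zero.mp h0 with h | h <;> omega
      rw [hk0, pow_zero] at hp
      exact h2 (by linear_combination hp)
    rw [mul_neg, mul_pow_sub_one hpos, hZN, neg_neg]
  have hx1u : IsUnit (x + 1) := by
    have : IsUnit ((x + 1) ^ 2) := by rw [← hxZ]; exact hxu.mul hZu
    exact (isUnit_pow_iff two_ne_zero).mp this
  -- The power (x + 1)^(q² - 1) = (xZ)^((q² - 1)/2) is 1, and `Z` contributes -1 to it; so must `x`.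
  rw [hqq, pow_succ, pow_mul, ← hxZ, mul_pow, hZN] at h1x
  have := hx1u.mul_right_cancel (h1x.trans (one_mul _).symm)
  linear_combination -this

end FrobeniusPowers

/-! ### Polynomial divisibilities to be evaluated at isometries -/

section Divisibility

open Polynomial

variable {F : Type*} [Field F] [Finite F]

/-- The computation with a root is carried out in `AdjoinRoot`; as a divisibility it can be
evaluated at an endomorphism of V, whose eigenvalues need not lie in F. -/
theorem quadratic_dvd_X_pow_sub_one {k : ℕ} (hk0 : 0 < k) (hk : Nat.card F = 2 * k + 1)
    (h2 : (2 : F) ≠ 0) (t : F) :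
    (X ^ 2 - C t * X + 1 : F[X]) ∣ X ^ ((2 * k + 1) * (2 * k * (k + 1))) - 1 := by
  rw [← AdjoinRoot.mk_eq_zero, map_sub, map_pow, map_one, sub_eq_zero]
  refine pow_eq_one_of_quadratic hk0 hk h2 t _ ?_
  exact AdjoinRoot.mk_self (f := (X ^ 2 - C t * X + 1 : F[X]))

/-- The two factors are coprime unless t = 2. In that case the cubic is (X - 1)³, and the exponent
contains the factor q ≥ 3, so that the right side is a q-th power of a multiple of X - 1. This is
the unipotent case, and the reason for the factor q in N. -/
theorem cubic_dvd_X_pow_sub_one {k : ℕ} (hk0 : 0 < k) (hk : Nat.card F = 2 * k + 1)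
    (h2 : (2 : F) ≠ 0) (t : F) :
    ((X - 1) * (X ^ 2 - C t * X + 1) : F[X]) ∣ X ^ ((2 * k + 1) * (2 * k * (k + 1))) - 1 := by
  by_cases ht : t = 2
  · have h1 : ((X - 1) * (X ^ 2 - C t * X + 1) : F[X]) = (X - 1) ^ 3 := by
      rw [ht]; simp only [map_ofNat]; ring
    have h3 : (X ^ ((2 * k + 1) * (2 * k * (k + 1))) - 1 : F[X])
        = (X ^ (2 * k * (k + 1)) - 1) ^ (2 * k + 1) := by
      rw [← hk, sub_pow_natCard, one_pow, ← pow_mul, mul_comm]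
    rw [h1, h3]
    exact (pow_dvd_pow _ (by omega)).trans (pow_dvd_pow_of_dvd (sub_one_dvd_pow_sub_one _ _) _)
  · apply IsCoprime.mul_dvd _ (sub_one_dvd_pow_sub_one _ _)
      (quadratic_dvd_X_pow_sub_one hk0 hk h2 t)
    have h0 : (2 - t) ≠ 0 := sub_ne_zero.mpr (Ne.symm ht)
    refine ⟨-C (2 - t)⁻¹ * (X + 1 - C t), C (2 - t)⁻¹, ?_⟩
    have : C (2 - t)⁻¹ * (2 - C t) = (1 : F[X]) := by
      rw [← map_ofNat C 2, ← map_sub, ← map_mul, inv_mul_cancel₀ h0, map_one]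
    linear_combination this

theorem quartic_dvd_X_pow_add_one {k : ℕ} (hk : Nat.card F = 2 * k + 1)
    (h2 : (2 : F) ≠ 0) (s p : F) (hp : p ^ k = -1) (hp1 : (1 - s + p) ^ k = -1)
    (hd : (s ^ 2 - 4 * p) ^ k = -1) :
    ((X + 1) ^ 4 - C (4 * s) * (X * (X + 1) ^ 2) + C (16 * p) * X ^ 2 : F[X]) ∣
      X ^ (2 * k * (k + 1)) + 1 := by
  rw [← AdjoinRoot.mk_eq_zero, map_add, map_pow, map_one, ← eq_neg_iff_add_eq_zero]
  refine pow_eq_neg_one_of_quartic hk h2 s p hp hp1 hd _ ?_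
  exact AdjoinRoot.mk_self
    (f := ((X + 1) ^ 4 - C (4 * s) * (X * (X + 1) ^ 2) + C (16 * p) * X ^ 2 : F[X]))

end Divisibility

end OrthogonalBlackBox

/-! ### Reflections -/

namespace OrthogonalBlackBox

open QuadraticMap (polar polar_comm)

section Reflections

variable {F V : Type*} [Field F] [AddCommGroup V] [Module F V] (Q : QuadraticForm F V)

theorem polar_self_eq (x : V) : polar Q x x = 2 * Q x := by
  rw [QuadraticMap.polar_self, nsmul_eq_mul, Nat.cast_ofNat]

theorem map_add_eq (x y : V) : Q (x + y) = Q x + Q y + polar Q x y := by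
  exact QuadraticMap.map_add Q x y

theorem map_sub_eq (x y : V) : Q (x - y) = Q x + Q y - polar Q x y := by
  rw [sub_eq_add_neg, map_add_eq, QuadraticMap.map_neg, QuadraticMap.polar_neg_right, sub_eq_add_neg]

theorem map_smul_eq (c : F) (x : V) : Q (c • x) = c ^ 2 * Q x := by
  rw [QuadraticMap.map_smul, smul_eq_mul, sq]

/-- The reflection in the vector `u`; it is the identity if `u` is singular. -/
def refl (u : V) : V ≃ₗ[F] V :=
  LinearEquiv.ofInvolutive
    ({ toFun := fun v => v - ((Q u)⁻¹ * polar Q v u) • u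
       map_add' := fun v w => by rw [QuadraticMap.polar_add_left]; module
       map_smul' := fun c v => by
        rw [QuadraticMap.polar_smul_left, RingHom.id_apply, smul_eq_mul]; module } : V →ₗ[F] V)
    (fun v => by
      simp only [LinearMap.coe_mk, AddHom.coe_mk, QuadraticMap.polar_sub_left,
        QuadraticMap.polar_smul_left, polar_self_eq, smul_eq_mul]
      by_cases h : Q u = 0
      · simp [h]
      · match_scalars <;> field_simp
        ring)

theorem refl_apply (u v : V) : refl Q u v = v - ((Q u)⁻¹ * polar Q v u) • u := rfl

theorem refl_mul_self (u : V) : refl Q u * refl Q u = 1 := by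
  ext v
  exact (refl Q u).symm_apply_apply v

theorem refl_inv (u : V) : (refl Q u)⁻¹ = refl Q u :=
  inv_eq_of_mul_eq_one_left (refl_mul_self Q u)

theorem refl_apply_of_polar_eq_zero {u v : V} (h : polar Q v u = 0) : refl Q u v = v := by
  rw [refl_apply, h, mul_zero, zero_smul, sub_zero]

theorem refl_apply_self {u : V} (h : Q u ≠ 0) : refl Q u u = -u := by
  rw [refl_apply, polar_self_eq]
  match_scalars
  field_simp
  ring

theorem refl_mem (u : V) : refl Q u ∈ orthogonalGroup Q := by
  intro v
  rw [refl_apply, map_sub_eq, map_smul_eq, QuadraticMap.polar_smul_right, smul_eq_mul]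
  by_cases h : Q u = 0
  · simp [h]
  · field_simp
    ring

variable {Q}

theorem polar_map {g : V ≃ₗ[F] V} (hg : g ∈ orthogonalGroup Q) (x y : V) :
    polar Q (g x) (g y) = polar Q x y := by
  have h : ∀ x, Q (g x) = Q x := hg
  simp only [polar, ← map_add, h]

theorem conj_refl {g : V ≃ₗ[F] V} (hg : g ∈ orthogonalGroup Q) (u : V) :
    g * refl Q u * g⁻¹ = refl Q (g u) := by
  rw [mul_inv_eq_iff_eq_mul]
  ext v
  change g (refl Q u v) = refl Q (g u) (g v)
  rw [refl_apply, refl_apply, polar_map hg, map_sub, map_smul]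
  congr 3
  rw [show Q (g u) = Q u from hg u]

theorem refl_comm {u w : V} (h : polar Q u w = 0) : Commute (refl Q u) (refl Q w) := by
  have h1 := conj_refl (refl_mem Q u) w
  rw [refl_apply_of_polar_eq_zero Q (by rwa [polar_comm])] at h1
  exact mul_inv_eq_iff_eq_mul.mp h1

theorem pow_toLinearMap_apply (g : V ≃ₗ[F] V) (n : ℕ) (v : V) :
    (g ^ n) v = ((g.toLinearMap : Module.End F V) ^ n) v := by
  induction n generalizing v with
  | zero => rfl
  | succ n ih => rw [pow_succ, pow_succ]; exact ih (g v)

open Polynomial in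
/-- The product of two reflections has order dividing `q (q² - 1) / 2`. -/
theorem refl_mul_refl_pow [Finite F] {k : ℕ} (hk0 : 0 < k) (hk : Nat.card F = 2 * k + 1)
    (h2 : (2 : F) ≠ 0) {u w : V} (hu : Q u ≠ 0) (hw : Q w ≠ 0) :
    (refl Q u * refl Q w) ^ ((2 * k + 1) * (2 * k * (k + 1))) = 1 := by
  set g := refl Q u * refl Q w with hg
  set β := polar Q u w with hβ
  have hβ' : polar Q w u = β := polar_comm _ _ _
  -- For independent `u`, `w` this is the trace of `g` on their span, where `g` has determinant 1.
  set t := β ^ 2 * (Q u)⁻¹ * (Q w)⁻¹ - 2 with ht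
  have hgv : ∀ v, g v = v - ((Q w)⁻¹ * polar Q v w) • w
      - ((Q u)⁻¹ * (polar Q v u - (Q w)⁻¹ * polar Q v w * β)) • u := by
    intro v
    change refl Q u (refl Q w v) = _
    rw [refl_apply, refl_apply, QuadraticMap.polar_sub_left, QuadraticMap.polar_smul_left, hβ',
      smul_eq_mul]
  have hgu : g u = (t + 1) • u - ((Q w)⁻¹ * β) • w := by
    rw [hgv, polar_self_eq, ht, ← hβ]
    match_scalars <;> field_simp <;> ring
  have hgw : g w = -w + ((Q u)⁻¹ * β) • u := by
    rw [hgv, polar_self_eq, hβ']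
    match_scalars <;> field_simp <;> ring
  have hqu : g (g u) - t • g u + u = 0 := by
    rw [hgu, map_sub, map_smul, map_smul, hgu, hgw]
    match_scalars <;> rw [ht] <;> field_simp <;> ring
  have hqw : g (g w) - t • g w + w = 0 := by
    rw [hgw, map_add, map_smul, map_neg, hgu, hgw]
    match_scalars <;> rw [ht] <;> field_simp <;> ring
  have hq : ∀ a b : F, g (g (a • u + b • w)) - t • g (a • u + b • w) + (a • u + b • w) = 0 := by
    intro a b
    simp only [map_add, map_smul]
    have e : a • (g (g u) - t • g u + u) + b • (g (g w) - t • g w + w) = 0 := by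
      rw [hqu, hqw, smul_zero, smul_zero, add_zero]
    rw [← e]; module
  ext v
  rw [pow_toLinearMap_apply]
  -- The image of `g - 1` lies in ⟨u, w⟩, and X² - tX + 1 kills that span at `g`; so the cubic kills
  -- all of V.
  obtain ⟨r, hr⟩ := cubic_dvd_X_pow_sub_one hk0 hk h2 t
  have h := congrArg (fun P => aeval (g.toLinearMap : Module.End F V) P v) hr
  beta_reduce at h
  rw [mul_comm (X - 1), mul_comm _ r, map_mul, map_mul] at h
  simp only [map_sub, map_add, map_mul, map_pow, aeval_X, map_one,
    aeval_C, Module.End.mul_apply, LinearMap.sub_apply, LinearMap.add_apply, Module.End.one_apply,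
    Module.algebraMap_end_apply, sq, LinearEquiv.coe_coe] at h
  have e : g v - v = (-((Q u)⁻¹ * (polar Q v u - (Q w)⁻¹ * polar Q v w * β))) • u
      + (-((Q w)⁻¹ * polar Q v w)) • w := by
    rw [hgv]; module
  have hz := congrArg (aeval (g.toLinearMap : Module.End F V) r)
    (hq (-((Q u)⁻¹ * (polar Q v u - (Q w)⁻¹ * polar Q v w * β))) (-((Q w)⁻¹ * polar Q v w)))
  rw [← e] at hz
  simp only [map_sub, map_add, map_smul, map_zero] at h hz
  rw [LinearEquiv.coe_one, id]
  linear_combination (norm := module) h + hz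

end Reflections

/-- The value sets of a x² and t - b y² have (q + 1)/2 elements each, so they meet. -/
theorem exists_binary_eq {F : Type*} [Field F] [Finite F] (hodd : Odd (Nat.card F)) {a b : F} (ha : a ≠ 0) (hb : b ≠ 0) (t : F) :
    ∃ x y : F, a * x ^ 2 + b * y ^ 2 = t := by
  have := Fintype.ofFinite F
  open Polynomial in
  obtain ⟨x, y, h⟩ := FiniteField.exists_root_sum_quadratic (R := F)
    (f := C a * X ^ 2 + C 0 * X + C 0) (g := C b * X ^ 2 + C 0 * X + C (-t))
    (degree_quadratic ha) (degree_quadratic hb)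
    (by rw [← Nat.card_eq_fintype_card]; exact Nat.odd_iff.mp hodd)
  refine ⟨x, y, ?_⟩
  simp at h
  linear_combination h

/-! ### Counting vectors of prescribed norm in non-degenerate subspaces -/

section Counting

variable {F V : Type*} [Field F] [AddCommGroup V] [Module F V]

/-- `S` is a union of affine lines in direction `e`, and `T` is a transversal for them. -/
theorem ncard_mul_card_of_lines [Finite V] (S T : Set V) (e : V) (hTS : T ⊆ S)
    (hS : ∀ v ∈ S, ∀ k : F, v + k • e ∈ S) (hex : ∀ v ∈ S, ∃ k : F, v + k • e ∈ T)
    (huniq : ∀ v ∈ T, ∀ k : F, v + k • e ∈ T → k = 0) : T.ncard * Nat.card F = S.ncard := by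
  rw [← Nat.card_coe_set_eq, ← Nat.card_coe_set_eq, ← Nat.card_prod]
  refine Nat.card_congr (Equiv.ofBijective
    (fun x : T × F => (⟨x.1.1 + x.2 • e, hS _ (hTS x.1.2) _⟩ : S)) ⟨?_, ?_⟩)
  · rintro ⟨⟨v, hv⟩, k⟩ ⟨⟨w, hw⟩, l⟩ h
    simp only [Subtype.mk.injEq] at h
    have hvw : w = v + (k - l) • e := by
      rw [sub_smul, ← add_sub_assoc, h, add_sub_cancel_right]
    have h0 : k - l = 0 := huniq v hv _ (hvw ▸ hw)
    rw [h0, zero_smul, add_zero] at hvw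
    rw [sub_eq_zero] at h0
    subst hvw h0
    rfl
  · rintro ⟨v, hv⟩
    obtain ⟨k, hk⟩ := hex v hv
    exact ⟨(⟨_, hk⟩, -k), by simp⟩

variable (Q : QuadraticForm F V)

/-- The vectors of `S` orthogonal to `u`. -/
def perp (S : Submodule F V) (u : V) : Submodule F V :=
  S ⊓ LinearMap.ker (Q.polarBilin.flip u)

/-- The polar form of `Q` is non-degenerate on `S`. -/
def NonSing (S : Submodule F V) : Prop :=
  ∀ x ∈ S, (∀ y ∈ S, polar Q x y = 0) → x = 0

variable {Q}

theorem mem_perp {S : Submodule F V} {u v : V} : v ∈ perp Q S u ↔ v ∈ S ∧ polar Q v u = 0 := by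
  simp [perp]

/-- Removing the component along `u` moves any `y` of `S` into the orthogonal space without changing
its product with a vector orthogonal to `u`. -/
theorem NonSing.perp {S : Submodule F V} (hS : NonSing Q S) (h2 : (2 : F) ≠ 0) {u : V} (hu : u ∈ S)
    (hQu : Q u ≠ 0) : NonSing Q (perp Q S u) := by
  intro x hx hxy
  rw [mem_perp] at hx
  refine hS x hx.1 fun y hy => ?_
  have := hxy (y - (polar Q y u / (2 * Q u)) • u) (by
    rw [mem_perp]
    refine ⟨S.sub_mem hy (S.smul_mem _ hu), ?_⟩
    rw [QuadraticMap.polar_sub_left, QuadraticMap.polar_smul_left, polar_self_eq, smul_eq_mul,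
      div_mul_cancel₀ _ (mul_ne_zero h2 hQu), sub_self])
  rwa [QuadraticMap.polar_sub_right, QuadraticMap.polar_smul_right, hx.2, smul_zero, sub_zero]
    at this

theorem ncard_polar_eq [Finite V] (S : Submodule F V) {u e : V} (he : e ∈ S)
    (heu : polar Q e u ≠ 0) (c : F) :
    {v | v ∈ S ∧ polar Q v u = c}.ncard * Nat.card F = (S : Set V).ncard := by
  refine ncard_mul_card_of_lines _ _ e (fun v hv => hv.1)
    (fun v hv k => S.add_mem hv (S.smul_mem _ he)) (fun v hv => ?_) (fun v hv k hk => ?_)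
  · refine ⟨(c - polar Q v u) / polar Q e u, S.add_mem hv (S.smul_mem _ he), ?_⟩
    rw [QuadraticMap.polar_add_left, QuadraticMap.polar_smul_left, smul_eq_mul,
      div_mul_cancel₀ _ heu]
    ring
  · have := hk.2
    rw [QuadraticMap.polar_add_left, QuadraticMap.polar_smul_left, smul_eq_mul, hv.2,
      add_eq_left] at this
    exact (mul_eq_zero.mp this).resolve_right heu

theorem ncard_perp [Finite V] [Finite F] (h2 : (2 : F) ≠ 0) {S : Submodule F V} {u : V} (hu : u ∈ S)
    (hQu : Q u ≠ 0) {d : ℕ} (hd : (S : Set V).ncard = Nat.card F ^ (d + 1)) :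
    (perp Q S u : Set V).ncard = Nat.card F ^ d := by
  have h := ncard_polar_eq (Q := Q) S hu
    (by rw [polar_self_eq]; exact mul_ne_zero h2 hQu : polar Q u u ≠ 0) 0
  have e : {v | v ∈ S ∧ polar Q v u = 0} = (perp Q S u : Set V) := by
    ext v; exact mem_perp.symm
  rw [e, hd, pow_succ] at h
  exact Nat.eq_of_mul_eq_mul_right Nat.card_pos h

/-- As `e` is singular, Q is affine along each line v + ke with slope B(v, e) ≠ 0, hence takes every
value exactly once there. The set `Z` of slopes will be {1}, for hyperbolic partners, or the
complement of {0}. -/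
theorem ncard_quadric_lines [Finite V] (S : Submodule F V) {e : V} (he : e ∈ S) (hQe : Q e = 0)
    (Z : Set F) (hZ : (0 : F) ∉ Z) (t : F) :
    {v | v ∈ S ∧ polar Q v e ∈ Z ∧ Q v = t}.ncard * Nat.card F =
      {v | v ∈ S ∧ polar Q v e ∈ Z}.ncard := by
  have hpe : polar Q e e = 0 := by rw [polar_self_eq, hQe, mul_zero]
  have hp : ∀ (v : V) (k : F), polar Q (v + k • e) e = polar Q v e := by
    intro v k
    rw [QuadraticMap.polar_add_left, QuadraticMap.polar_smul_left, hpe, smul_zero, add_zero]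
  have hq : ∀ (v : V) (k : F), Q (v + k • e) = Q v + k * polar Q v e := by
    intro v k
    rw [map_add_eq, map_smul_eq, hQe, QuadraticMap.polar_smul_right, smul_eq_mul]
    ring
  refine ncard_mul_card_of_lines _ _ e (fun v hv => ⟨hv.1, hv.2.1⟩)
    (fun v hv k => ⟨S.add_mem hv.1 (S.smul_mem _ he), by rw [hp]; exact hv.2⟩)
    (fun v hv => ?_) (fun v hv k hk => ?_)
  · have hne : polar Q v e ≠ 0 := fun h => hZ (h ▸ hv.2)
    refine ⟨(t - Q v) / polar Q v e, S.add_mem hv.1 (S.smul_mem _ he), by rw [hp]; exact hv.2, ?_⟩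
    rw [hq, div_mul_cancel₀ _ hne]
    ring
  · have hne : polar Q v e ≠ 0 := fun h => hZ (h ▸ hv.2.1)
    have := hk.2.2
    rw [hq, hv.2.2, add_eq_left] at this
    exact (mul_eq_zero.mp this).resolve_right hne

theorem NonSing.exists_polar_ne {S : Submodule F V} (hS : NonSing Q S) {e : V} (he : e ∈ S)
    (h0 : e ≠ 0) : ∃ y ∈ S, polar Q y e ≠ 0 := by
  by_contra! h
  exact h0 (hS e he fun y hy => by rw [polar_comm]; exact h y hy)

variable [Finite F] [Finite V]

theorem ncard_polar_ne {S : Submodule F V} (hS : NonSing Q S) {e : V} (he : e ∈ S)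
    (h0 : e ≠ 0) {d : ℕ} (hd : (S : Set V).ncard = Nat.card F ^ (d + 1)) :
    {v | v ∈ S ∧ polar Q v e ≠ 0}.ncard = (Nat.card F - 1) * Nat.card F ^ d := by
  obtain ⟨y, hy, hye⟩ := hS.exists_polar_ne he h0
  have h := ncard_polar_eq S hy hye 0
  have hpos : 0 < Nat.card F := Nat.card_pos
  rw [hd, pow_succ] at h
  have h1 := Nat.eq_of_mul_eq_mul_right hpos h
  have e : {v | v ∈ S ∧ polar Q v e ≠ 0} = (S : Set V) \ {v | v ∈ S ∧ polar Q v e = 0} := by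
    ext v; simp +contextual
  rw [e, Set.ncard_sdiff (fun v hv => hv.1), hd, h1, pow_succ, Nat.sub_mul, one_mul, mul_comm]

theorem le_ncard_quadric_of_singular {S : Submodule F V} (hS : NonSing Q S) {e : V} (he : e ∈ S)
    (h0 : e ≠ 0) (hQe : Q e = 0) {d : ℕ} (hd : (S : Set V).ncard = Nat.card F ^ (d + 2)) (t : F) :
    (Nat.card F - 1) * Nat.card F ^ d = {v | v ∈ S ∧ polar Q v e ≠ 0 ∧ Q v = t}.ncard := by
  have h := ncard_quadric_lines (Q := Q) S he hQe {0}ᶜ (by simp) t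
  simp only [Set.mem_compl_iff, Set.mem_singleton_iff] at h
  change {v | v ∈ S ∧ polar Q v e ≠ 0 ∧ Q v = t}.ncard * _ = {v | v ∈ S ∧ polar Q v e ≠ 0}.ncard at h
  rw [ncard_polar_ne hS he h0 hd, pow_succ, ← mul_assoc] at h
  exact (Nat.eq_of_mul_eq_mul_right Nat.card_pos h).symm

theorem ncard_hyperbolic_partner {S : Submodule F V} (hS : NonSing Q S) {e : V} (he : e ∈ S)
    (h0 : e ≠ 0) (hQe : Q e = 0) {d : ℕ} (hd : (S : Set V).ncard = Nat.card F ^ (d + 2)) :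
    {v | v ∈ S ∧ polar Q v e = 1 ∧ Q v = 0}.ncard = Nat.card F ^ d := by
  have h := ncard_quadric_lines (Q := Q) S he hQe {1} (by simp) 0
  simp only [Set.mem_singleton_iff] at h
  obtain ⟨y, hy, hye⟩ := hS.exists_polar_ne he h0
  have h1 := ncard_polar_eq S hy hye 1
  rw [← h, hd, pow_add, sq, ← mul_assoc] at h1
  exact Nat.eq_of_mul_eq_mul_right Nat.card_pos (Nat.eq_of_mul_eq_mul_right Nat.card_pos h1)

/-- Fix one singular vector `e`. The lines in direction `e` bound the singular vectors not
orthogonal to `e` by qᵈ, and the hyperplane orthogonal to `e` adds at most another qᵈ. -/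
theorem ncard_singular_le {S : Submodule F V} (hS : NonSing Q S) {d : ℕ}
    (hd : (S : Set V).ncard = Nat.card F ^ (d + 1)) :
    {v | v ∈ S ∧ v ≠ 0 ∧ Q v = 0}.ncard ≤ 2 * Nat.card F ^ d := by
  rcases Set.eq_empty_or_nonempty {v | v ∈ S ∧ v ≠ 0 ∧ Q v = 0} with h | ⟨e, he, h0, hQe⟩
  · rw [h, Set.ncard_empty]; exact Nat.zero_le _
  · have h := ncard_quadric_lines (Q := Q) S he hQe {0}ᶜ (by simp) 0
    have hle : {v | v ∈ S ∧ polar Q v e ∈ ({0}ᶜ : Set F)}.ncard ≤ (S : Set V).ncard :=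
      Set.ncard_le_ncard (fun v hv => hv.1)
    rw [← h, hd, pow_succ] at hle
    have h1 := Nat.le_of_mul_le_mul_right hle Nat.card_pos
    obtain ⟨y, hy, hye⟩ := hS.exists_polar_ne he h0
    have h3 := ncard_polar_eq S hy hye 0
    rw [hd, pow_succ] at h3
    have h4 := Nat.eq_of_mul_eq_mul_right Nat.card_pos h3
    rw [two_mul]
    refine le_trans (le_trans (Set.ncard_le_ncard (fun v hv => ?_)) (Set.ncard_union_le
      {v | v ∈ S ∧ polar Q v e ∈ ({0}ᶜ : Set F) ∧ Q v = 0} {v | v ∈ S ∧ polar Q v e = 0}))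
      (Nat.add_le_add h1 h4.le)
    by_cases hp : polar Q v e = 0
    · exact Or.inr ⟨hv.1, hp⟩
    · exact Or.inl ⟨hv.1, hp, hv.2.2⟩

theorem exists_ne_zero_of_ncard {S : Submodule F V} {d : ℕ}
    (hd : (S : Set V).ncard = Nat.card F ^ (d + 1)) : ∃ v ∈ S, v ≠ 0 := by
  by_contra! h
  have : (S : Set V) ⊆ {0} := fun v hv => h v hv
  have h1 := Set.ncard_le_ncard this
  rw [hd, Set.ncard_singleton] at h1
  have h2 : 1 < Nat.card F := Finite.one_lt_card
  exact absurd h1 (not_le.mpr (Nat.one_lt_pow (Nat.succ_ne_zero d) h2))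

/-- A non-degenerate space of dimension `d + 2` has at least `(q - 1) q ^ d` vectors of a given
non-zero norm. -/
theorem le_ncard_quadric (hodd : Odd (Nat.card F)) (h2 : (2 : F) ≠ 0) {S : Submodule F V}
    (hS : NonSing Q S) {d : ℕ} (hd : (S : Set V).ncard = Nat.card F ^ (d + 2)) {t : F}
    (ht : t ≠ 0) : (Nat.card F - 1) * Nat.card F ^ d ≤ {v | v ∈ S ∧ Q v = t}.ncard := by
  by_cases hex : ∃ e ∈ S, e ≠ 0 ∧ Q e = 0
  · obtain ⟨e, he, h0, hQe⟩ := hex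
    rw [le_ncard_quadric_of_singular hS he h0 hQe hd t]
    exact Set.ncard_le_ncard fun v hv => ⟨hv.1, hv.2.2⟩
  · push Not at hex
    obtain ⟨u, hu, hu0⟩ := exists_ne_zero_of_ncard hd
    have hQu := hex u hu hu0
    have hd1 := ncard_perp h2 hu hQu hd
    obtain ⟨w, hw, hw0⟩ := exists_ne_zero_of_ncard hd1
    have hwS := (mem_perp.mp hw).1
    have hQw := hex w hwS hw0
    have hwu := (mem_perp.mp hw).2
    have hval : ∀ x y : F, Q (x • u + y • w) = Q u * x ^ 2 + Q w * y ^ 2 := by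
      intro x y
      rw [map_add_eq, map_smul_eq, map_smul_eq, QuadraticMap.polar_smul_left,
        QuadraticMap.polar_smul_right, polar_comm, hwu, smul_zero, smul_zero]
      ring
    -- The space is anisotropic here. This is possible only for d = 0; the other case is refuted by
    -- producing a singular vector.
    obtain rfl | ⟨d, rfl⟩ : d = 0 ∨ ∃ d', d = d' + 1 := by
      cases d with
      | zero => exact Or.inl rfl
      | succ d => exact Or.inr ⟨d, rfl⟩
    · obtain ⟨x, y, hxy⟩ := exists_binary_eq hodd hQu hQw t
      set v := x • u + y • w with hv
      have hvS : v ∈ S := S.add_mem (S.smul_mem _ hu) (S.smul_mem _ hwS)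
      have hQv : Q v = t := by rw [hval, hxy]
      have hd2 := ncard_perp h2 hvS (hQv ▸ ht) hd
      obtain ⟨z, hz, hz0⟩ := exists_ne_zero_of_ncard hd2
      have hzS := (mem_perp.mp hz).1
      have hzv := (mem_perp.mp hz).2
      set r := Q z with hr
      have hval2 : ∀ a b : F, Q (a • v + b • z) = t * a ^ 2 + r * b ^ 2 := by
        intro a b
        rw [map_add_eq, map_smul_eq, map_smul_eq, QuadraticMap.polar_smul_left,
          QuadraticMap.polar_smul_right, polar_comm, hzv, smul_zero, smul_zero, hQv, ← hr]
        ring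
      have hr0 : r ≠ 0 := hex z hzS hz0
      have hne : ∀ s : F, r + s ^ 2 * t ≠ 0 := by
        intro s h0
        refine hex (s • v + (1 : F) • z) (S.add_mem (S.smul_mem _ hvS) (S.smul_mem _ hzS)) ?_
          (by rw [hval2]; linear_combination h0)
        intro h
        have := congrArg (fun x => polar Q x z) h
        simp only [QuadraticMap.polar_add_left, QuadraticMap.polar_smul_left, polar_self_eq,
          QuadraticMap.polar_zero_left, polar_comm Q v z, hzv, smul_eq_mul, mul_zero, zero_add,
          one_mul] at this
        exact mul_ne_zero h2 hr0 this
      -- Rational parametrization of the conic Q = t by the lines through the point -v, with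
      -- direction r v - t s z. The denominators are norms of non-zero vectors and so do not vanish.
      -- This yields q points, one more than required.
      have hinj : Function.Injective (fun s : F =>
          ((r - s ^ 2 * t) / (r + s ^ 2 * t)) • v + (-(2 * t * s) / (r + s ^ 2 * t)) • z) := by
        intro s s' h
        have hv' := congrArg (fun x => polar Q x v) h
        have hz' := congrArg (fun x => polar Q x z) h
        simp only [QuadraticMap.polar_add_left, QuadraticMap.polar_smul_left, polar_self_eq,
          polar_comm Q v z, hzv, smul_eq_mul, mul_zero, zero_add, add_zero, hQv, ← hr] at hv' hz'
        have e1 := mul_right_cancel₀ (mul_ne_zero h2 ht) hv'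
        have e2 := mul_right_cancel₀ (mul_ne_zero h2 hr0) hz'
        rw [div_eq_div_iff (hne s) (hne s')] at e1 e2
        have e3 : (2 * r * t) * (s ^ 2 - s' ^ 2) = 0 := by linear_combination -e1
        have e4 : s ^ 2 = s' ^ 2 := by
          have := (mul_eq_zero.mp e3).resolve_left (mul_ne_zero (mul_ne_zero h2 hr0) ht)
          linear_combination this
        rw [← e4] at e2
        have := mul_right_cancel₀ (hne s) e2
        have := mul_left_cancel₀ (mul_ne_zero h2 ht) (neg_injective this)
        exact this
      rw [pow_zero, mul_one]
      refine le_trans (Nat.sub_le _ _) ?_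
      rw [← Nat.card_coe_set_eq]
      refine Nat.card_le_card_of_injective
        (fun s : F => (⟨((r - s ^ 2 * t) / (r + s ^ 2 * t)) • v
          + (-(2 * t * s) / (r + s ^ 2 * t)) • z,
          S.add_mem (S.smul_mem _ hvS) (S.smul_mem _ hzS), ?_⟩ : {v | v ∈ S ∧ Q v = t}))
        (fun s s' h => hinj (congrArg Subtype.val h))
      rw [hval2]
      have hs := hne s
      rw [div_pow, div_pow, ← mul_div_assoc, ← mul_div_assoc, ← add_div,
        div_eq_iff (pow_ne_zero 2 hs)]
      ring
    · exfalso
      have hQwp : w ∈ perp Q S u := hw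
      have hd2 := ncard_perp h2 hw hQw hd1
      obtain ⟨z, hz, hz0⟩ := exists_ne_zero_of_ncard hd2
      have hzp := (mem_perp.mp hz).1
      have hzw := (mem_perp.mp hz).2
      have hzS := (mem_perp.mp hzp).1
      have hzu := (mem_perp.mp hzp).2
      -- The plane ⟨u, w⟩ represents the negative of the norm of `z`, so adding `z` gives a singular
      -- vector.
      obtain ⟨x, y, hxy⟩ := exists_binary_eq hodd hQu hQw (-Q z)
      have hpz : polar Q (x • u + y • w) z = 0 := by
        rw [QuadraticMap.polar_add_left, QuadraticMap.polar_smul_left, QuadraticMap.polar_smul_left,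
          polar_comm Q u, polar_comm Q w, hzu, hzw, smul_zero, smul_zero, add_zero]
      refine hex (x • u + y • w + z) (S.add_mem (S.add_mem (S.smul_mem _ hu) (S.smul_mem _ hwS)) hzS)
        ?_ ?_
      · intro h
        have := congrArg (fun x => polar Q x z) h
        simp only [QuadraticMap.polar_add_left Q _ z z, hpz, polar_self_eq,
          QuadraticMap.polar_zero_left, zero_add] at this
        exact mul_ne_zero h2 (hex z hzS hz0) this
      · rw [map_add_eq, hval, hxy, hpz]
        ring

end Counting

end OrthogonalBlackBox

namespace OrthogonalBlackBox

open scoped commutatorElement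

open QuadraticMap (polar polar_comm)

/-! ### Siegel transformations and the two SL₂-factors of a hyperbolic 4-space -/

section Siegel

variable {F V : Type*} [Field F] [AddCommGroup V] [Module F V] {Q : QuadraticForm F V}

namespace IsHyperbolicQuadruple

variable {a b c d : V}

theorem swap (h : IsHyperbolicQuadruple Q a b c d) : IsHyperbolicQuadruple Q c d a b :=
  ⟨h.3, h.4, h.1, h.2, h.6, h.5, by rw [polar_comm]; exact h.8, by rw [polar_comm]; exact h.7,
    by rw [polar_comm]; exact h.9, by rw [polar_comm]; exact h.10⟩

/-- Exchanging b and d passes from one ruling of totally singular lines of the 4-space to the other,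
and so from one SL₂-factor of its Ω to the other. -/
theorem twist (h : IsHyperbolicQuadruple Q a b c d) : IsHyperbolicQuadruple Q a d c b :=
  ⟨h.1, h.4, h.3, h.2, h.7, by rw [polar_comm]; exact h.8, h.5, by rw [polar_comm]; exact h.6,
    h.9, by rw [polar_comm]; exact h.10⟩

theorem map (h : IsHyperbolicQuadruple Q a b c d) {g : V ≃ₗ[F] V} (hg : g ∈ orthogonalGroup Q) :
    IsHyperbolicQuadruple Q (g a) (g b) (g c) (g d) := by
  have hQ : ∀ x, Q (g x) = Q x := hg
  constructor <;> simp only [polar_map hg, hQ, h.1, h.2, h.3, h.4, h.5, h.6, h.7, h.8, h.9, h.10]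

end IsHyperbolicQuadruple

/-- `g` is the Siegel transformation `x ↦ x + t (B(x, a) b - B(x, b) a)`. -/
def IsSiegel (Q : QuadraticForm F V) (a b : V) (t : F) (g : V ≃ₗ[F] V) : Prop :=
  ∀ x, g x = x + t • (polar Q x a • b - polar Q x b • a)

theorem IsSiegel.unique {a b : V} {t : F} {g g' : V ≃ₗ[F] V} (hg : IsSiegel Q a b t g)
    (hg' : IsSiegel Q a b t g') : g = g' := by
  ext x
  exact (hg x).trans (hg' x).symm

/-- The Siegel transformation attached to a totally singular line. -/
def siegel {a b : V} (ha : Q a = 0) (hb : Q b = 0) (hab : polar Q a b = 0) (t : F) : V ≃ₗ[F] V :=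
  LinearEquiv.ofLinearMap
    (LinearMap.id + t • ((Q.polarBilin.flip a).smulRight b - (Q.polarBilin.flip b).smulRight a))
    (LinearMap.id - t • ((Q.polarBilin.flip a).smulRight b - (Q.polarBilin.flip b).smulRight a))
    (by
      ext x
      simp [QuadraticMap.polar_self, ha, hb, hab, polar_comm Q b a])
    (by
      ext x
      simp [QuadraticMap.polar_self, ha, hb, hab, polar_comm Q b a])

theorem isSiegel_siegel {a b : V} (ha : Q a = 0) (hb : Q b = 0) (hab : polar Q a b = 0) (t : F) :
    IsSiegel Q a b t (siegel ha hb hab t) := by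
  intro x
  simp [siegel]

theorem IsSiegel.conj {a b : V} {t : F} {g h : V ≃ₗ[F] V} (hg : IsSiegel Q a b t g)
    (hh : h ∈ orthogonalGroup Q) : IsSiegel Q (h a) (h b) t (h * g * h⁻¹) := by
  intro x
  obtain ⟨y, rfl⟩ := h.surjective x
  change h (g (h.symm (h y))) = _
  rw [h.symm_apply_apply, hg, polar_map hh, polar_map hh]
  simp

theorem IsSiegel.mem_orthogonalGroup {a b : V} (ha : Q a = 0) (hb : Q b = 0) (hab : polar Q a b = 0)
    {t : F} {g : V ≃ₗ[F] V} (hg : IsSiegel Q a b t g) : g ∈ orthogonalGroup Q := by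
  intro x
  rw [hg, map_add_eq, map_smul_eq, map_sub_eq, map_smul_eq, map_smul_eq]
  simp only [QuadraticMap.polar_smul_right, QuadraticMap.polar_smul_left,
    QuadraticMap.polar_sub_right, ha, hb, smul_eq_mul, polar_comm Q b a, hab]
  ring

theorem IsSiegel.mul {a b : V} (ha : Q a = 0) (hb : Q b = 0) (hab : polar Q a b = 0)
    {s t : F} {g h : V ≃ₗ[F] V} (hg : IsSiegel Q a b s g) (hh : IsSiegel Q a b t h) :
    IsSiegel Q a b (s + t) (g * h) := by
  intro x
  change g (h x) = _
  rw [hg, hh]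
  simp only [QuadraticMap.polar_add_left, QuadraticMap.polar_smul_left, polar_self_eq,
    QuadraticMap.polar_sub_left, ha, hb, smul_eq_mul, polar_comm Q b a, hab]
  module

theorem IsSiegel.of_smul {a b : V} {r s t : F} {g : V ≃ₗ[F] V}
    (hg : IsSiegel Q (r • a) (s • b) t g) : IsSiegel Q a b (r * s * t) g := by
  intro x
  rw [hg]
  simp only [QuadraticMap.polar_smul_right, smul_eq_mul]
  module

theorem IsSiegel.neg_swap {a b : V} {t : F} {g : V ≃ₗ[F] V}
    (hg : IsSiegel Q a b t g) : IsSiegel Q b a (-t) g := by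
  intro x
  rw [hg]
  module

/-- The product `h` of the reflections in a + c and a - c negates a and fixes b, so conjugation by
`h` negates the parameter. The commutator of `h` with the transformation of parameter -t/2 therefore
has parameter t/2 + t/2 = t. -/
theorem IsSiegel.mem_Omega (h2 : (2 : F) ≠ 0) {a b c d : V} (hq : IsHyperbolicQuadruple Q a b c d)
    {t : F} {g : V ≃ₗ[F] V} (hg : IsSiegel Q a b t g) : g ∈ Omega Q := by
  set h := refl Q (a + c) * refl Q (a - c) with hh
  have hmem : h ∈ orthogonalGroup Q := mul_mem (refl_mem _ _) (refl_mem _ _)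
  have hQ1 : Q (a + c) = 1 := by rw [map_add_eq, hq.1, hq.3, hq.9]; ring
  have hQ2 : Q (a - c) = -1 := by rw [map_sub_eq, hq.1, hq.3, hq.9]; ring
  have hca : polar Q c a = 1 := by rw [polar_comm]; exact hq.9
  have hba : polar Q b a = 0 := by rw [polar_comm]; exact hq.5
  have ha : h a = -a := by
    change refl Q (a + c) (refl Q (a - c) a) = _
    simp only [refl_apply, hQ1, hQ2, QuadraticMap.polar_sub_right, QuadraticMap.polar_sub_left,
      QuadraticMap.polar_smul_left, QuadraticMap.polar_add_right, polar_self_eq, hq.1, hq.3, hq.9,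
      hca, smul_eq_mul]
    match_scalars <;> norm_num
  have hb : h b = b := by
    change refl Q (a + c) (refl Q (a - c) b) = _
    rw [refl_apply_of_polar_eq_zero Q (v := b) (u := a - c), refl_apply_of_polar_eq_zero]
    · rw [QuadraticMap.polar_add_right, hba, hq.8, add_zero]
    · rw [QuadraticMap.polar_sub_right, hba, hq.8, sub_zero]
  set x := siegel hq.1 hq.2 hq.5 (-t / 2) with hx
  have hxs : IsSiegel Q a b (-t / 2) x := isSiegel_siegel _ _ _ _
  set y := siegel hq.1 hq.2 hq.5 (t / 2) with hy
  have hys : IsSiegel Q a b (t / 2) y := isSiegel_siegel _ _ _ _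
  have hxy : x⁻¹ = y := by
    rw [inv_eq_iff_mul_eq_one]
    ext v
    rw [hxs.mul hq.1 hq.2 hq.5 hys v]
    rw [show -t / 2 + t / 2 = 0 by ring]
    simp
  have hc : IsSiegel Q a b (t / 2) (h * x * h⁻¹) := by
    have := hxs.conj hmem
    rw [ha, hb, ← neg_one_smul F a, ← one_smul F b] at this
    have := this.of_smul
    rwa [show -1 * 1 * (-t / 2) = t / 2 by ring] at this
  have e : g = ⁅h, x⁆ := by
    refine hg.unique (g' := ⁅h, x⁆) ?_
    rw [commutatorElement_def, hxy]
    have := hc.mul hq.1 hq.2 hq.5 hys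
    rwa [show t / 2 + t / 2 = t by field_simp; norm_num] at this
  rw [e]
  exact Subgroup.commutator_mem_commutator hmem (hxs.mem_orthogonalGroup hq.1 hq.2 hq.5)

/-- The subgroup of `GL(V)` generated by two opposite long root subgroups. -/
def rootSL2 (Q : QuadraticForm F V) (a b c d : V) : Subgroup (V ≃ₗ[F] V) :=
  Subgroup.closure ({g | ∃ t, IsSiegel Q a b t g} ∪ {g | ∃ t, IsSiegel Q c d t g})

/-- This permits computing in GL(V). Because Siegel transformations belong to Ω(V), restricting the
generators to Ω(V) loses nothing. -/
theorem map_longRootSubgroup (h2 : (2 : F) ≠ 0) {a b c d : V}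
    (hq : IsHyperbolicQuadruple Q a b c d) :
    (longRootSubgroup Q a b ⊔ longRootSubgroup Q c d).map (Omega Q).subtype
      = rootSL2 Q a b c d := by
  have key : ∀ {a b c d : V}, IsHyperbolicQuadruple Q a b c d →
      (longRootSubgroup Q a b).map (Omega Q).subtype
        = Subgroup.closure {g | ∃ t, IsSiegel Q a b t g} := by
    intro a b c d hq
    rw [longRootSubgroup, MonoidHom.map_closure]
    congr 1
    ext g
    constructor
    · rintro ⟨x, ⟨t, ht⟩, rfl⟩
      exact ⟨t, ht⟩
    · rintro ⟨t, ht⟩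
      exact ⟨⟨g, ht.mem_Omega h2 hq⟩, ⟨t, ht⟩, rfl⟩
  rw [Subgroup.map_sup, key hq, key hq.swap, rootSL2, Subgroup.closure_union]

theorem rootSL2_swap (a b c d : V) : rootSL2 Q c d a b = rootSL2 Q a b c d := by
  rw [rootSL2, rootSL2, Set.union_comm]

theorem rootSL2_le (h2 : (2 : F) ≠ 0) {a b c d : V} (hq : IsHyperbolicQuadruple Q a b c d) :
    rootSL2 Q a b c d ≤ Omega Q := by
  rw [rootSL2, Subgroup.closure_le]
  rintro g (⟨t, ht⟩ | ⟨t, ht⟩)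
  · exact ht.mem_Omega h2 hq
  · exact ht.mem_Omega h2 hq.swap

/-- Projection to the span of a hyperbolic quadruple. -/
def proj (Q : QuadraticForm F V) (a b c d : V) : V →ₗ[F] V :=
  (Q.polarBilin.flip c).smulRight a + (Q.polarBilin.flip d).smulRight b
    + (Q.polarBilin.flip a).smulRight c + (Q.polarBilin.flip b).smulRight d

theorem proj_apply (a b c d v : V) : proj Q a b c d v =
    polar Q v c • a + polar Q v d • b + polar Q v a • c + polar Q v b • d := by
  simp [proj]

/-- `g` is `-1` on the span of `a, b, c, d` and the identity on its orthogonal complement. -/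
structure IsNeg (Q : QuadraticForm F V) (a b c d : V) (g : V ≃ₗ[F] V) : Prop where
  map_a : g a = -a
  map_b : g b = -b
  map_c : g c = -c
  map_d : g d = -d
  map_perp : ∀ v, polar Q v a = 0 → polar Q v b = 0 → polar Q v c = 0 → polar Q v d = 0 → g v = v

section Quadruple

variable {a b c d : V} (hq : IsHyperbolicQuadruple Q a b c d)
include hq

theorem polar_proj_sub (v : V) : polar Q (v - proj Q a b c d v) a = 0 ∧
    polar Q (v - proj Q a b c d v) b = 0 ∧ polar Q (v - proj Q a b c d v) c = 0 ∧
    polar Q (v - proj Q a b c d v) d = 0 := by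
  have hca : polar Q c a = 1 := by rw [polar_comm]; exact hq.9
  have hba : polar Q b a = 0 := by rw [polar_comm]; exact hq.5
  have hdb : polar Q d b = 1 := by rw [polar_comm]; exact hq.10
  have hda : polar Q d a = 0 := by rw [polar_comm]; exact hq.7
  have hcb : polar Q c b = 0 := by rw [polar_comm]; exact hq.8
  have hdc : polar Q d c = 0 := by rw [polar_comm]; exact hq.6
  simp only [proj_apply, QuadraticMap.polar_sub_left, QuadraticMap.polar_add_left,
    QuadraticMap.polar_smul_left, polar_self_eq, hq.1, hq.2, hq.3, hq.4, hq.5, hq.6, hq.7, hq.8,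
    hq.9, hq.10, hca, hba, hdb, hda, hcb, hdc, smul_eq_mul]
  simp

theorem IsNeg.apply {g : V ≃ₗ[F] V} (hg : IsNeg Q a b c d g) (v : V) :
    g v = v - (2 : F) • proj Q a b c d v := by
  obtain ⟨h1, h2, h3, h4⟩ := polar_proj_sub hq v
  have h := hg.map_perp _ h1 h2 h3 h4
  have hp : g (proj Q a b c d v) = - proj Q a b c d v := by
    simp only [proj_apply, map_add, map_smul, hg.1, hg.2, hg.3, hg.4]
    module
  rw [map_sub, hp] at h
  linear_combination (norm := module) h

theorem IsNeg.unique {g g' : V ≃ₗ[F] V} (hg : IsNeg Q a b c d g) (hg' : IsNeg Q a b c d g') :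
    g = g' := by
  ext v
  rw [hg.apply hq, hg'.apply hq]

theorem siegel_action {t : F} {g : V ≃ₗ[F] V} (hg : IsSiegel Q a b t g) :
    g a = a ∧ g b = b ∧ g c = c + t • b ∧ g d = d - t • a := by
  have hca : polar Q c a = 1 := by rw [polar_comm]; exact hq.9
  have hba : polar Q b a = 0 := by rw [polar_comm]; exact hq.5
  have hdb : polar Q d b = 1 := by rw [polar_comm]; exact hq.10
  have hda : polar Q d a = 0 := by rw [polar_comm]; exact hq.7
  have hcb : polar Q c b = 0 := by rw [polar_comm]; exact hq.8
  refine ⟨?_, ?_, ?_, ?_⟩ <;> rw [hg] <;>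
    simp only [polar_self_eq, hq.1, hq.2, hq.5, hca, hba, hdb, hda, hcb] <;> module

/-- The 4-space is a sum of two copies of the natural SL₂-module: one and the same matrix of
determinant 1 acts with respect to (c, b) and to (d, -a). -/
theorem rootSL2_action {g : V ≃ₗ[F] V} (hg : g ∈ rootSL2 Q a b c d) :
    ∃ α β γ δ : F, α * δ - β * γ = 1 ∧ g c = α • c + β • b ∧ g b = γ • c + δ • b ∧
      g d = α • d - β • a ∧ g a = δ • a - γ • d ∧
      ∀ v, polar Q v a = 0 → polar Q v b = 0 → polar Q v c = 0 → polar Q v d = 0 → g v = v := by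
  induction hg using Subgroup.closure_induction with
  | mem g hg =>
    rcases hg with ⟨t, ht⟩ | ⟨t, ht⟩
    · obtain ⟨h1, h2, h3, h4⟩ := siegel_action hq ht
      refine ⟨1, t, 0, 1, by ring, ?_, ?_, ?_, ?_, ?_⟩
      · rw [h3]; module
      · rw [h2]; module
      · rw [h4]; module
      · rw [h1]; module
      · intro v ha hb _ _
        rw [ht, ha, hb]; simp
    · obtain ⟨h1, h2, h3, h4⟩ := siegel_action hq.swap ht
      refine ⟨1, 0, -t, 1, by ring, ?_, ?_, ?_, ?_, ?_⟩
      · rw [h1]; module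
      · rw [h4]; module
      · rw [h2]; module
      · rw [h3]; module
      · intro v _ _ hc hd
        rw [ht, hc, hd]; simp
  | one => exact ⟨1, 0, 0, 1, by ring, by simp, by simp, by simp, by simp, by simp⟩
  | mul g h _ _ ihg ihh =>
    obtain ⟨α, β, γ, δ, h0, h1, h2, h3, h4, h5⟩ := ihg
    obtain ⟨α', β', γ', δ', h0', h1', h2', h3', h4', h5'⟩ := ihh
    refine ⟨α' * α + β' * γ, α' * β + β' * δ, γ' * α + δ' * γ, γ' * β + δ' * δ, ?_, ?_, ?_, ?_, ?_,
      ?_⟩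
    · linear_combination h0 * (α' * δ' - β' * γ') + h0'
    · rw [LinearEquiv.mul_apply, h1', map_add, map_smul, map_smul, h1, h2]; module
    · rw [LinearEquiv.mul_apply, h2', map_add, map_smul, map_smul, h1, h2]; module
    · rw [LinearEquiv.mul_apply, h3', map_sub, map_smul, map_smul, h3, h4]; module
    · rw [LinearEquiv.mul_apply, h4', map_sub, map_smul, map_smul, h3, h4]; module
    · intro v e1 e2 e3 e4
      rw [LinearEquiv.mul_apply, h5' v e1 e2 e3 e4, h5 v e1 e2 e3 e4]
  | inv g _ ih =>
    obtain ⟨α, β, γ, δ, h0, h1, h2, h3, h4, h5⟩ := ih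
    have hsm : ∀ x : V, (α * δ - β * γ) • x = x := fun x => by rw [h0, one_smul]
    have key : ∀ x y : V, g y = x → g⁻¹ x = y := fun x y h => by
      rw [← h]; exact g.symm_apply_apply y
    refine ⟨δ, -β, -γ, α, by linear_combination h0, key _ _ ?_, key _ _ ?_, key _ _ ?_,
      key _ _ ?_, fun v e1 e2 e3 e4 => key _ _ (h5 v e1 e2 e3 e4)⟩
    · rw [map_add, map_smul, map_smul, h1, h2]
      linear_combination (norm := module) hsm c
    · rw [map_add, map_smul, map_smul, h1, h2]
      linear_combination (norm := module) hsm b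
    · rw [map_sub, map_smul, map_smul, h3, h4]
      linear_combination (norm := module) hsm d
    · rw [map_sub, map_smul, map_smul, h3, h4]
      linear_combination (norm := module) hsm a

/-- In odd characteristic -1 is the only involution of SL₂: trace zero would give the square -1, and
with non-zero trace the equation for the square forces a scalar matrix. -/
theorem isNeg_of_sq_eq_one (h2F : (2 : F) ≠ 0) {g : V ≃ₗ[F] V} (hg : g ∈ rootSL2 Q a b c d)
    (hsq : g * g = 1) (hne : g ≠ 1) : IsNeg Q a b c d g := by
  obtain ⟨α, β, γ, δ, h0, h1, h2, h3, h4, h5⟩ := rootSL2_action hq hg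
  have hca : polar Q c a = 1 := by rw [polar_comm]; exact hq.9
  have hba : polar Q b a = 0 := by rw [polar_comm]; exact hq.5
  have hdb : polar Q d b = 1 := by rw [polar_comm]; exact hq.10
  have hcb : polar Q c b = 0 := by rw [polar_comm]; exact hq.8
  have hc : g (g c) = c := congrArg (fun k : V ≃ₗ[F] V => k c) hsq
  have hb : g (g b) = b := congrArg (fun k : V ≃ₗ[F] V => k b) hsq
  rw [h1, map_add, map_smul, map_smul, h1, h2] at hc
  rw [h2, map_add, map_smul, map_smul, h1, h2] at hb
  have c1 := congrArg (fun x => polar Q x a) hc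
  have c2 := congrArg (fun x => polar Q x d) hc
  have b1 := congrArg (fun x => polar Q x a) hb
  have b2 := congrArg (fun x => polar Q x d) hb
  simp only [QuadraticMap.polar_add_left, QuadraticMap.polar_smul_left, hca, hba, hq.6, hq.10,
    smul_eq_mul, mul_zero, mul_one, add_zero, zero_add] at c1 c2 b1 b2
  have htr : α + δ ≠ 0 := fun h => h2F (by linear_combination α * h - c1 - h0)
  have hβ : β = 0 := by
    have e : β * (α + δ) = 0 := by linear_combination c2
    exact (mul_eq_zero.mp e).resolve_right htr
  have hγ : γ = 0 := by
    have e : γ * (α + δ) = 0 := by linear_combination b1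
    exact (mul_eq_zero.mp e).resolve_right htr
  subst hβ hγ
  have hδ : δ = α := by
    have e : (δ - α) * (α + δ) = 0 := by linear_combination b2 - c1
    exact sub_eq_zero.mp ((mul_eq_zero.mp e).resolve_right htr)
  subst hδ
  have hα : δ * δ = 1 := by linear_combination c1
  rcases mul_self_eq_one_iff.mp hα with rfl | rfl
  · exfalso
    apply hne
    ext v
    obtain ⟨e1, e2, e3, e4⟩ := polar_proj_sub hq v
    have h := h5 _ e1 e2 e3 e4
    have hp : g (proj Q a b c d v) = proj Q a b c d v := by
      simp only [proj_apply, map_add, map_smul, h1, h2, h3, h4]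
      module
    rw [map_sub, hp, sub_left_inj] at h
    exact h
  · refine ⟨?_, ?_, ?_, ?_, h5⟩
    · rw [h4]; module
    · rw [h2]; module
    · rw [h1]; module
    · rw [h3]; module

/-- The Weyl element x y x built from opposite root elements of parameter 1 maps a ↦ d ↦ -a and c ↦
b ↦ -c, so its square is -1 on the 4-space. -/
theorem exists_isNeg_mem_rootSL2 : ∃ g ∈ rootSL2 Q a b c d, IsNeg Q a b c d g := by
  set x := siegel hq.1 hq.2 hq.5 1
  set y := siegel hq.3 hq.4 hq.6 1
  have hx : IsSiegel Q a b 1 x := isSiegel_siegel _ _ _ _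
  have hy : IsSiegel Q c d 1 y := isSiegel_siegel _ _ _ _
  have hxm : x ∈ rootSL2 Q a b c d := Subgroup.subset_closure (Or.inl ⟨1, hx⟩)
  have hym : y ∈ rootSL2 Q a b c d := Subgroup.subset_closure (Or.inr ⟨1, hy⟩)
  obtain ⟨xa, xb, xc, xd⟩ := siegel_action hq hx
  obtain ⟨yc, yd, ya, yb⟩ := siegel_action hq.swap hy
  have hwm := mul_mem (mul_mem hxm hym) hxm
  have ha : (x * y * x) a = d := by
    change x (y (x a)) = d
    rw [xa, ya, map_add, map_smul, xa, xd]; module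
  have hd : (x * y * x) d = -a := by
    change x (y (x d)) = -a
    rw [xd, map_sub, map_smul, ya, yd, map_sub, map_smul, map_add, map_smul, xa, xd]; module
  have hb : (x * y * x) b = -c := by
    change x (y (x b)) = -c
    rw [xb, yb, map_sub, map_smul, xb, xc]; module
  have hc : (x * y * x) c = b := by
    change x (y (x c)) = b
    rw [xc, map_add, map_smul, yb, yc, map_add, map_smul, map_sub, map_smul, xb, xc]; module
  refine ⟨_, mul_mem hwm hwm, ?_, ?_, ?_, ?_, ?_⟩
  · rw [LinearEquiv.mul_apply, ha, hd]
  · rw [LinearEquiv.mul_apply, hb, map_neg, hc]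
  · rw [LinearEquiv.mul_apply, hc, hb]
  · rw [LinearEquiv.mul_apply, hd, map_neg, ha]
  · obtain ⟨_, _, _, _, _, _, _, _, _, h⟩ := rootSL2_action hq (mul_mem hwm hwm)
    exact h

/-- The reflection in `u` fixes the vector δa - γb of ⟨a, b⟩ and takes this line to the line of the
opposite ruling through that vector, whose other generator is δd + γc. The conjugate is the Siegel
transformation of the new line and hence lies in the other SL₂-factor. -/
theorem refl_conj_siegel_mem {u : V} (hu : Q u ≠ 0) {α β γ δ : F}
    (huv : u = α • a + β • b + γ • c + δ • d) {t : F} {g : V ≃ₗ[F] V} (hg : IsSiegel Q a b t g) :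
    refl Q u * g * (refl Q u)⁻¹ ∈ rootSL2 Q a d c b := by
  have hca : polar Q c a = 1 := by rw [polar_comm]; exact hq.9
  have hba : polar Q b a = 0 := by rw [polar_comm]; exact hq.5
  have hau : polar Q a u = γ := by
    rw [huv]
    simp only [QuadraticMap.polar_add_right, QuadraticMap.polar_smul_right, polar_self_eq, hq.1,
      hq.5, hq.7, hq.9, smul_eq_mul]
    ring
  have hbu : polar Q b u = δ := by
    rw [huv]
    simp only [QuadraticMap.polar_add_right, QuadraticMap.polar_smul_right, polar_self_eq, hq.2,
      hba, hq.8, hq.10, smul_eq_mul]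
    ring
  have hQu : Q u = α * γ + β * δ := by
    rw [huv]
    simp only [map_add_eq, map_smul_eq, QuadraticMap.polar_add_left, QuadraticMap.polar_smul_left,
      QuadraticMap.polar_smul_right, hq.1, hq.2, hq.3, hq.4, hq.5, hq.6, hq.7, hq.8, hq.9,
      hq.10, smul_eq_mul]
    ring
  have hs : IsSiegel Q (δ • a - γ • b) (δ • d + γ • c) (-(t / Q u)) (refl Q u * g * (refl Q u)⁻¹) := by
    intro x
    rw [hg.conj (refl_mem Q u) x, refl_apply, refl_apply, hau, hbu]
    have hxu : polar Q x u = α * polar Q x a + β * polar Q x b + γ * polar Q x c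
        + δ * polar Q x d := by
      rw [huv]
      simp only [QuadraticMap.polar_add_right, QuadraticMap.polar_smul_right, smul_eq_mul]
    simp only [QuadraticMap.polar_sub_right, QuadraticMap.polar_smul_right,
      QuadraticMap.polar_add_right, hxu, smul_eq_mul]
    rw [hQu] at hu ⊢
    rw [huv]
    match_scalars <;> field_simp <;> ring
  by_cases hδ : δ = 0
  · subst hδ
    rw [zero_smul, zero_smul, zero_sub, zero_add, ← neg_smul] at hs
    exact Subgroup.subset_closure (Or.inr ⟨_, hs.of_smul.neg_swap⟩)
  -- The parameter is chosen so that this element of the other factor maps the line ⟨a, d⟩ to the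
  -- one found in `hs`. For δ = 0 that line was already ⟨b, c⟩.
  · set y := siegel hq.3 hq.2 (by rw [polar_comm]; exact hq.8 : polar Q c b = 0) (-(γ / δ)) with hyd
    have hy : IsSiegel Q c b (-(γ / δ)) y := isSiegel_siegel _ _ _ _
    have hym : y ∈ rootSL2 Q a d c b := Subgroup.subset_closure (Or.inr ⟨_, hy⟩)
    have hyO : y ∈ orthogonalGroup Q := hy.mem_orthogonalGroup hq.3 hq.2
      (by rw [polar_comm]; exact hq.8)
    obtain ⟨_, _, ya, yd⟩ := siegel_action hq.twist.swap hy
    have e1 : δ • a - γ • b = y (δ • a) := by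
      rw [map_smul, ya]; match_scalars <;> field_simp
    have e2 : δ • d + γ • c = y (δ • d) := by
      rw [map_smul, yd]; match_scalars <;> field_simp
    rw [e1, e2] at hs
    have hconj := hs.conj (inv_mem hyO)
    have hinv : ∀ v, y⁻¹ (y v) = v := fun v => y.symm_apply_apply v
    rw [hinv, hinv] at hconj
    have hm : y⁻¹ * (refl Q u * g * (refl Q u)⁻¹) * y⁻¹⁻¹ ∈ rootSL2 Q a d c b :=
      Subgroup.subset_closure (Or.inl ⟨_, hconj.of_smul⟩)
    have := mul_mem (mul_mem hym hm) (inv_mem hym)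
    convert this using 1
    group

/-- Reflections of the 4-space interchange its two rulings, hence its two SL₂-factors. A product of
two of them therefore normalizes each factor, which is what the theorem needs. -/
theorem refl_conj_mem {u : V} (hu : Q u ≠ 0) (huv : proj Q a b c d u = u) {g : V ≃ₗ[F] V}
    (hg : g ∈ rootSL2 Q a b c d) : refl Q u * g * (refl Q u)⁻¹ ∈ rootSL2 Q a d c b := by
  rw [proj_apply] at huv
  induction hg using Subgroup.closure_induction with
  | mem g hg =>
    rcases hg with ⟨t, ht⟩ | ⟨t, ht⟩
    · exact refl_conj_siegel_mem hq hu huv.symm ht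
    · have := refl_conj_siegel_mem hq.swap hu (α := polar Q u a) (β := polar Q u b)
        (γ := polar Q u c) (δ := polar Q u d) (by nth_rewrite 1 [← huv]; abel) ht
      rwa [rootSL2_swap] at this
  | one => simp
  | mul g h _ _ ihg ihh =>
    have := mul_mem ihg ihh
    convert this using 1
    group
  | inv g _ ih =>
    have := inv_mem ih
    convert this using 1
    group

end Quadruple

end Siegel

end OrthogonalBlackBox

namespace OrthogonalBlackBox

open QuadraticMap (polar polar_comm)
open scoped commutatorElement

/-! ### Witt's theorem by reflections and transitivity of Ω(V) -/

section Witt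

variable {F V : Type*} [Field F] [AddCommGroup V] [Module F V] {Q : QuadraticForm F V}

/-- The group generated by the reflections in the vectors of `S`. -/
def reflGroup (Q : QuadraticForm F V) (S : Submodule F V) : Subgroup (V ≃ₗ[F] V) :=
  Subgroup.closure (refl Q '' S)

theorem refl_mem_reflGroup {S : Submodule F V} {u : V} (hu : u ∈ S) : refl Q u ∈ reflGroup Q S :=
  Subgroup.subset_closure ⟨u, hu, rfl⟩

theorem reflGroup_mono {S T : Submodule F V} (h : S ≤ T) : reflGroup Q S ≤ reflGroup Q T :=
  Subgroup.closure_mono (Set.image_mono h)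

theorem reflGroup_le (S : Submodule F V) : reflGroup Q S ≤ orthogonalGroup Q := by
  rw [reflGroup, Subgroup.closure_le]
  rintro _ ⟨u, -, rfl⟩
  exact refl_mem Q u

theorem reflGroup_map_mem {S : Submodule F V} {g : V ≃ₗ[F] V} (hg : g ∈ reflGroup Q S) :
    ∀ v, g v ∈ S ↔ v ∈ S := by
  induction hg using Subgroup.closure_induction with
  | mem g hg =>
    obtain ⟨u, hu, rfl⟩ := hg
    intro v
    rw [refl_apply]
    exact S.sub_mem_iff_left (S.smul_mem _ hu)
  | one => exact fun v => Iff.rfl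
  | mul g h _ _ ihg ihh => exact fun v => (ihg (h v)).trans (ihh v)
  | inv g _ ih =>
    intro v
    rw [← ih (g⁻¹ v)]
    rw [show g (g⁻¹ v) = v from g.apply_symm_apply v]

theorem reflGroup_fix {S : Submodule F V} {w : V} (hw : ∀ u ∈ S, polar Q u w = 0)
    {g : V ≃ₗ[F] V} (hg : g ∈ reflGroup Q S) : g w = w := by
  induction hg using Subgroup.closure_induction with
  | mem g hg =>
    obtain ⟨u, hu, rfl⟩ := hg
    exact refl_apply_of_polar_eq_zero Q (by rw [polar_comm]; exact hw u hu)
  | one => rfl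
  | mul g h _ _ ihg ihh => rw [LinearEquiv.mul_apply, ihh, ihg]
  | inv g _ ih =>
    nth_rewrite 1 [← ih]
    exact g.symm_apply_apply w

/-- If v - w is non-singular, its reflection maps `v` to `w`. Otherwise v + w has norm 4Q(w) by the
parallelogram law; its reflection maps `v` to -w, and the reflection in `w` repairs the sign. -/
theorem exists_reflGroup_apply_eq (h2 : (2 : F) ≠ 0) {S : Submodule F V} {v w : V} (hv : v ∈ S)
    (hw : w ∈ S) (h : Q v = Q w) (h0 : Q w ≠ 0) : ∃ g ∈ reflGroup Q S, g v = w := by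
  by_cases hd : Q (v - w) = 0
  · have hs : Q (v + w) = 4 * Q w := by
      rw [map_sub_eq] at hd
      rw [map_add_eq]
      linear_combination -hd + 2 * h
    have h4 : (4 : F) ≠ 0 := by
      rw [show (4 : F) = 2 * 2 by norm_num]; exact mul_ne_zero h2 h2
    refine ⟨refl Q w * refl Q (v + w), mul_mem (refl_mem_reflGroup hw)
      (refl_mem_reflGroup (S.add_mem hv hw)), ?_⟩
    have e : refl Q (v + w) v = -w := by
      have hp : polar Q v (v + w) = Q (v + w) := by
        rw [QuadraticMap.polar_add_right, polar_self_eq, map_add_eq]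
        linear_combination h
      rw [refl_apply, hp, inv_mul_cancel₀ (by rw [hs]; exact mul_ne_zero h4 h0)]
      module
    rw [LinearEquiv.mul_apply, e, map_neg, refl_apply_self Q h0, neg_neg]
  · refine ⟨refl Q (v - w), refl_mem_reflGroup (S.sub_mem hv hw), ?_⟩
    have hp : polar Q v (v - w) = Q (v - w) := by
      rw [QuadraticMap.polar_sub_right, polar_self_eq, map_sub_eq]
      linear_combination h
    rw [refl_apply, hp, inv_mul_cancel₀ hd]
    module

/-- The vectors of `S` orthogonal to `a` and `c`. -/
def pairPerp (Q : QuadraticForm F V) (S : Submodule F V) (a c : V) : Submodule F V :=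
  perp Q (perp Q S (a + c)) (a - c)

/-- The definition uses a + c and a - c because they are orthogonal of norms 1 and -1 for a
hyperbolic pair, so that the results on orthogonal spaces of non-singular vectors apply twice; here
2 ≠ 0 recovers a and c. -/
theorem mem_pairPerp (h2 : (2 : F) ≠ 0) {S : Submodule F V} {a c v : V} :
    v ∈ pairPerp Q S a c ↔ v ∈ S ∧ polar Q v a = 0 ∧ polar Q v c = 0 := by
  rw [pairPerp, mem_perp, mem_perp, QuadraticMap.polar_sub_right, QuadraticMap.polar_add_right]
  constructor
  · rintro ⟨⟨h, h1⟩, h3⟩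
    refine ⟨h, mul_left_cancel₀ h2 ?_, mul_left_cancel₀ h2 ?_⟩
    · linear_combination h1 + h3
    · linear_combination h1 - h3
  · rintro ⟨h, h1, h3⟩
    rw [h1, h3]
    simp [h]

section Pair

variable {a c : V} (ha : Q a = 0) (hc : Q c = 0) (hac : polar Q a c = 1)
include ha hc hac

theorem pair_norm_add : Q (a + c) = 1 := by rw [map_add_eq, ha, hc, hac]; ring

theorem pair_norm_sub : Q (a - c) = -1 := by rw [map_sub_eq, ha, hc, hac]; ring

theorem pair_polar_add_sub : polar Q (a - c) (a + c) = 0 := by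
  simp only [QuadraticMap.polar_sub_left, QuadraticMap.polar_add_right, polar_self_eq, ha, hc, hac,
    polar_comm Q c a]
  ring

theorem sub_mem_perp_add {S : Submodule F V} (haS : a ∈ S) (hcS : c ∈ S) :
    a - c ∈ perp Q S (a + c) :=
  mem_perp.mpr ⟨S.sub_mem haS hcS, pair_polar_add_sub ha hc hac⟩

theorem NonSing.pairPerp (h2 : (2 : F) ≠ 0) {S : Submodule F V} (hS : NonSing Q S) (haS : a ∈ S)
    (hcS : c ∈ S) : NonSing Q (pairPerp Q S a c) := by
  refine NonSing.perp (hS.perp h2 (S.add_mem haS hcS) ?_) h2 (sub_mem_perp_add ha hc hac haS hcS) ?_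
  · rw [pair_norm_add ha hc hac]; exact one_ne_zero
  · rw [pair_norm_sub ha hc hac]; exact neg_ne_zero.mpr one_ne_zero

theorem ncard_pairPerp [Finite V] (h2 : (2 : F) ≠ 0) {S : Submodule F V}
    (haS : a ∈ S) (hcS : c ∈ S) :
    (pairPerp Q S a c : Set V).ncard * Nat.card F ^ 2 = (S : Set V).ncard := by
  have h1 := ncard_polar_eq (Q := Q) S (S.add_mem haS hcS) (u := a + c)
    (by rw [polar_self_eq, pair_norm_add ha hc hac, mul_one]; exact h2) 0
  have h3 := ncard_polar_eq (Q := Q) (perp Q S (a + c)) (sub_mem_perp_add ha hc hac haS hcS)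
    (u := a - c) (by
      rw [polar_self_eq, pair_norm_sub ha hc hac]
      exact mul_ne_zero h2 (neg_ne_zero.mpr one_ne_zero)) 0
  have e1 : {v | v ∈ S ∧ polar Q v (a + c) = 0} = (perp Q S (a + c) : Set V) := by
    ext v; exact mem_perp.symm
  have e3 : {v | v ∈ perp Q S (a + c) ∧ polar Q v (a - c) = 0} = (pairPerp Q S a c : Set V) := by
    ext v; exact mem_perp.symm
  rw [e1] at h1
  rw [e3] at h3
  rw [sq, ← mul_assoc, h3, h1]

theorem ncard_pairPerp_pow [Finite V] [Finite F] (h2 : (2 : F) ≠ 0) {S : Submodule F V}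
    (haS : a ∈ S) (hcS : c ∈ S) {d : ℕ} (hd : (S : Set V).ncard = Nat.card F ^ (d + 2)) :
    (pairPerp Q S a c : Set V).ncard = Nat.card F ^ d := by
  have h := ncard_pairPerp ha hc hac h2 haS hcS
  rw [hd, pow_add] at h
  exact Nat.eq_of_mul_eq_mul_right (pow_pos Nat.card_pos 2) h

/-- First a + c is moved to a' + c'. Then reflections in vectors orthogonal to a' + c' move the
image of a - c to a' - c' without disturbing it. -/
theorem exists_reflGroup_pair (h2 : (2 : F) ≠ 0) {S : Submodule F V} (haS : a ∈ S) (hcS : c ∈ S)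
    {a' c' : V} (ha' : Q a' = 0) (hc' : Q c' = 0) (hac' : polar Q a' c' = 1) (haS' : a' ∈ S)
    (hcS' : c' ∈ S) : ∃ g ∈ reflGroup Q S, g a = a' ∧ g c = c' := by
  obtain ⟨g, hg, hga⟩ := exists_reflGroup_apply_eq (Q := Q) h2 (S.add_mem haS hcS)
    (S.add_mem haS' hcS') (by rw [pair_norm_add ha hc hac, pair_norm_add ha' hc' hac'])
    (by rw [pair_norm_add ha' hc' hac']; exact one_ne_zero)
  have hgO := reflGroup_le S hg
  have hgm : g (a - c) ∈ perp Q S (a' + c') := by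
    rw [mem_perp, ← hga, polar_map hgO]
    exact ⟨(reflGroup_map_mem hg _).mpr (S.sub_mem haS hcS), pair_polar_add_sub ha hc hac⟩
  obtain ⟨h, hh, hhc⟩ := exists_reflGroup_apply_eq (Q := Q) h2 hgm
    (sub_mem_perp_add ha' hc' hac' haS' hcS')
    (by rw [show Q (g (a - c)) = Q (a - c) from hgO _, pair_norm_sub ha hc hac,
      pair_norm_sub ha' hc' hac'])
    (by rw [pair_norm_sub ha' hc' hac']; exact neg_ne_zero.mpr one_ne_zero)
  have hfix : h (a' + c') = a' + c' := reflGroup_fix (fun u hu => (mem_perp.mp hu).2) hh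
  have hle : perp Q S (a' + c') ≤ S := fun v hv => (mem_perp.mp hv).1
  have k1 : (h * g) (a + c) = a' + c' := by rw [LinearEquiv.mul_apply, hga, hfix]
  have k2 : (h * g) (a - c) = a' - c' := by rw [LinearEquiv.mul_apply, hhc]
  rw [map_add] at k1
  rw [map_sub] at k2
  refine ⟨h * g, mul_mem (reflGroup_mono hle hh) hg, ?_, ?_⟩
  · apply smul_right_injective V h2
    linear_combination (norm := module) k1 + k2
  · apply smul_right_injective V h2
    linear_combination (norm := module) k1 - k2

end Pair

theorem exists_reflGroup_quadruple (h2 : (2 : F) ≠ 0) {S : Submodule F V} {a b c d a' b' c' d' : V}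
    (hq : IsHyperbolicQuadruple Q a b c d) (hq' : IsHyperbolicQuadruple Q a' b' c' d')
    (ha : a ∈ S) (hb : b ∈ S) (hc : c ∈ S) (hd : d ∈ S)
    (ha' : a' ∈ S) (hb' : b' ∈ S) (hc' : c' ∈ S) (hd' : d' ∈ S) :
    ∃ g ∈ reflGroup Q S, g a = a' ∧ g b = b' ∧ g c = c' ∧ g d = d' := by
  obtain ⟨g, hg, hga, hgc⟩ := exists_reflGroup_pair hq.1 hq.3 hq.9 h2 ha hc hq'.1 hq'.3 hq'.9
    ha' hc'
  have hgO := reflGroup_le S hg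
  have hgq := hq.map hgO
  rw [hga, hgc] at hgq
  have hba : ∀ {a b c d : V}, IsHyperbolicQuadruple Q a b c d → b ∈ S → d ∈ S →
      b ∈ pairPerp Q S a c ∧ d ∈ pairPerp Q S a c := by
    intro a b c d hq hb hd
    rw [mem_pairPerp h2, mem_pairPerp h2]
    exact ⟨⟨hb, by rw [polar_comm]; exact hq.5, hq.8⟩, hd, by rw [polar_comm]; exact hq.7,
      by rw [polar_comm]; exact hq.6⟩
  obtain ⟨hgb, hgd⟩ := hba hgq ((reflGroup_map_mem hg _).mpr hb) ((reflGroup_map_mem hg _).mpr hd)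
  obtain ⟨hb'', hd''⟩ := hba hq' hb' hd'
  obtain ⟨h, hh, hhb, hhd⟩ := exists_reflGroup_pair hgq.2 hgq.4 hgq.10 h2 hgb hgd hq'.2 hq'.4
    hq'.10 hb'' hd''
  have hle : pairPerp Q S a' c' ≤ S := fun v hv => ((mem_pairPerp h2).mp hv).1
  refine ⟨h * g, mul_mem (reflGroup_mono hle hh) hg, ?_, hhb, ?_, hhd⟩
  · rw [LinearEquiv.mul_apply, hga]
    exact reflGroup_fix (fun u hu => ((mem_pairPerp h2).mp hu).2.1) hh
  · rw [LinearEquiv.mul_apply, hgc]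
    exact reflGroup_fix (fun u hu => ((mem_pairPerp h2).mp hu).2.2) hh

theorem Omega_le : Omega Q ≤ orthogonalGroup Q := Subgroup.commutator_le_self _

theorem conj_mem_Omega {g x : V ≃ₗ[F] V} (hg : g ∈ orthogonalGroup Q) (hx : x ∈ Omega Q) :
    g * x * g⁻¹ ∈ Omega Q := by
  have := mul_mem (Subgroup.commutator_mem_commutator hg (Omega_le hx) : ⁅g, x⁆ ∈ Omega Q) hx
  rwa [commutatorElement_def, inv_mul_cancel_right] at this

/-- An isometry taking `w` to `y` conjugates one reflection into the other, so the product is a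
commutator. -/
theorem refl_mul_refl_mem_Omega (h2 : (2 : F) ≠ 0) {y w : V} (h : Q w = Q y) (h0 : Q y ≠ 0) :
    refl Q y * refl Q w ∈ Omega Q := by
  obtain ⟨g, hg, hgw⟩ := exists_reflGroup_apply_eq (S := ⊤) h2 Submodule.mem_top Submodule.mem_top
    h h0
  have hgO := reflGroup_le _ hg
  have := Subgroup.commutator_mem_commutator hgO (refl_mem Q w)
  rwa [commutatorElement_def, conj_refl hgO, hgw, refl_inv] at this

/-- The vectors of `V` orthogonal to `a, b, c, d`. -/
def quadPerp (Q : QuadraticForm F V) (a b c d : V) : Submodule F V :=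
  pairPerp Q (pairPerp Q ⊤ a c) b d

theorem mem_quadPerp (h2 : (2 : F) ≠ 0) {a b c d v : V} : v ∈ quadPerp Q a b c d ↔
    polar Q v a = 0 ∧ polar Q v b = 0 ∧ polar Q v c = 0 ∧ polar Q v d = 0 := by
  rw [quadPerp, mem_pairPerp h2, mem_pairPerp h2]
  simp only [Submodule.mem_top, true_and]
  tauto

theorem nonSing_top (hQ : Q.polarBilin.Nondegenerate) : NonSing Q (⊤ : Submodule F V) :=
  fun x _ h => hQ.1 x fun y => h y trivial

section Quadruple

variable {a b c d : V} (hq : IsHyperbolicQuadruple Q a b c d)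
include hq

theorem mem_pairPerp_of_quadruple (h2 : (2 : F) ≠ 0) {S : Submodule F V} (hb : b ∈ S) (hd : d ∈ S) :
    b ∈ pairPerp Q S a c ∧ d ∈ pairPerp Q S a c := by
  rw [mem_pairPerp h2, mem_pairPerp h2]
  exact ⟨⟨hb, by rw [polar_comm]; exact hq.5, hq.8⟩, hd, by rw [polar_comm]; exact hq.7,
      by rw [polar_comm]; exact hq.6⟩

theorem nonSing_quadPerp (h2 : (2 : F) ≠ 0) (hQ : Q.polarBilin.Nondegenerate) :
    NonSing Q (quadPerp Q a b c d) := by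
  have h := mem_pairPerp_of_quadruple hq h2 (S := ⊤) trivial trivial
  exact ((nonSing_top hQ).pairPerp hq.1 hq.3 hq.9 h2 trivial trivial).pairPerp hq.2 hq.4 hq.10 h2
    h.1 h.2

theorem ncard_quadPerp [Finite V] [Finite F] (h2 : (2 : F) ≠ 0) {m : ℕ}
    (hm : Nat.card V = Nat.card F ^ (m + 4)) :
    (quadPerp Q a b c d : Set V).ncard = Nat.card F ^ m := by
  have h := mem_pairPerp_of_quadruple hq h2 (S := ⊤) trivial trivial
  refine ncard_pairPerp_pow hq.2 hq.4 hq.10 h2 h.1 h.2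
    (ncard_pairPerp_pow (S := ⊤) hq.1 hq.3 hq.9 h2 trivial trivial ?_)
  rw [Submodule.top_coe, Set.ncard_univ, hm]

/-- Modulo Ω(V) a reflection depends only on the norm of its vector. The space orthogonal to a, b,
c, d has dimension m + 2 ≥ 2 and represents every non-zero norm, so each reflection can be corrected
by one that fixes the quadruple. -/
theorem exists_mul_mem_Omega [Finite V] [Finite F] (hodd : Odd (Nat.card F)) (h2 : (2 : F) ≠ 0)
    (hQ : Q.polarBilin.Nondegenerate) {m : ℕ} (hm : Nat.card V = Nat.card F ^ (m + 6))
    {g : V ≃ₗ[F] V} (hg : g ∈ reflGroup Q ⊤) : ∃ σ ∈ orthogonalGroup Q,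
      σ a = a ∧ σ b = b ∧ σ c = c ∧ σ d = d ∧ σ * g ∈ Omega Q := by
  induction hg using Subgroup.closure_induction with
  | mem g hg =>
    obtain ⟨w, -, rfl⟩ := hg
    by_cases hw : Q w = 0
    · refine ⟨1, one_mem _, rfl, rfl, rfl, rfl, ?_⟩
      have : refl Q w = 1 := by ext v; simp [refl_apply, hw]
      rw [this, mul_one]
      exact one_mem _
    · have hcard := le_ncard_quadric hodd h2 (nonSing_quadPerp hq h2 hQ) (d := m)
        (ncard_quadPerp hq h2 hm) hw
      have hpos : 0 < (Nat.card F - 1) * Nat.card F ^ m :=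
        Nat.mul_pos (Nat.sub_pos_of_lt Finite.one_lt_card) (pow_pos Nat.card_pos _)
      obtain ⟨y, hy, hyw⟩ := Set.nonempty_of_ncard_ne_zero (hpos.trans_le hcard).ne'
      rw [mem_quadPerp h2] at hy
      have hfix : ∀ v, polar Q y v = 0 → refl Q y v = v := fun v hv =>
        refl_apply_of_polar_eq_zero Q (by rw [polar_comm]; exact hv)
      exact ⟨refl Q y, refl_mem Q y, hfix _ hy.1, hfix _ hy.2.1, hfix _ hy.2.2.1, hfix _ hy.2.2.2,
        refl_mul_refl_mem_Omega h2 hyw.symm (hyw ▸ hw)⟩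
  | one => exact ⟨1, one_mem _, rfl, rfl, rfl, rfl, by rw [mul_one]; exact one_mem _⟩
  | mul g h hg' hh' ihg ihh =>
    obtain ⟨σ, hσ, h1, h3, h4, h5, hm1⟩ := ihg
    obtain ⟨τ, hτ, k1, k3, k4, k5, hm2⟩ := ihh
    refine ⟨σ * τ, mul_mem hσ hτ, ?_, ?_, ?_, ?_, ?_⟩
    · rw [LinearEquiv.mul_apply, k1, h1]
    · rw [LinearEquiv.mul_apply, k3, h3]
    · rw [LinearEquiv.mul_apply, k4, h4]
    · rw [LinearEquiv.mul_apply, k5, h5]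
    -- The corrections multiply because O(V)/Ω(V) is abelian.
    · have e : σ * τ * (g * h) = (σ * ⁅τ, g⁆ * σ⁻¹) * (σ * g) * (τ * h) := by
        rw [commutatorElement_def]; group
      rw [e]
      exact mul_mem (mul_mem (conj_mem_Omega hσ (Subgroup.commutator_mem_commutator hτ
        (reflGroup_le _ hg'))) hm1) hm2
  | inv g hg' ih =>
    obtain ⟨σ, hσ, h1, h3, h4, h5, hm1⟩ := ih
    have key : ∀ v, σ v = v → σ⁻¹ v = v := fun v hv => by
      nth_rewrite 1 [← hv]; exact σ.symm_apply_apply v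
    refine ⟨σ⁻¹, inv_mem hσ, key _ h1, key _ h3, key _ h4, key _ h5, ?_⟩
    have e : σ⁻¹ * g⁻¹ = (σ⁻¹ * (σ * g) * σ⁻¹⁻¹)⁻¹ := by group
    rw [e]
    exact inv_mem (conj_mem_Omega (inv_mem hσ) hm1)

/-- `Ω(V)` is transitive on hyperbolic quadruples. -/
theorem exists_Omega_quadruple [Finite V] [Finite F] (hodd : Odd (Nat.card F)) (h2 : (2 : F) ≠ 0)
    (hQ : Q.polarBilin.Nondegenerate) {m : ℕ} (hm : Nat.card V = Nat.card F ^ (m + 6))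
    {a' b' c' d' : V} (hq' : IsHyperbolicQuadruple Q a' b' c' d') :
    ∃ g ∈ Omega Q, g a = a' ∧ g b = b' ∧ g c = c' ∧ g d = d' := by
  obtain ⟨g, hg, ha, hb, hc, hd⟩ := exists_reflGroup_quadruple (S := ⊤) h2 hq hq' trivial trivial
    trivial trivial trivial trivial trivial trivial
  obtain ⟨σ, hσ, h1, h3, h4, h5, hmem⟩ := exists_mul_mem_Omega hq' hodd h2 hQ hm hg
  refine ⟨σ * g, hmem, ?_, ?_, ?_, ?_⟩ <;> rw [LinearEquiv.mul_apply]
  · rw [ha, h1]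
  · rw [hb, h3]
  · rw [hc, h4]
  · rw [hd, h5]

end Quadruple

end Witt

/-! ### Double counting over fibres -/

section Fibrations

variable {α β : Type*} [Finite β]

theorem ncard_fibration (S : Set α) (T : α → Set β) [Fintype S] :
    {p : α × β | p.1 ∈ S ∧ p.2 ∈ T p.1}.ncard = ∑ x : S, (T x).ncard := by
  rw [← Nat.card_coe_set_eq]
  have e : {p : α × β | p.1 ∈ S ∧ p.2 ∈ T p.1} ≃ (Σ x : S, T x) :=
    { toFun := fun p => ⟨⟨p.1.1, p.2.1⟩, ⟨p.1.2, p.2.2⟩⟩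
      invFun := fun x => ⟨(x.1.1, x.2.1), x.1.2, x.2.2⟩
      left_inv := fun _ => rfl
      right_inv := fun _ => rfl }
  rw [Nat.card_congr e, Nat.card_sigma]
  simp only [Nat.card_coe_set_eq]

theorem mul_le_ncard_fibration [Finite α] (S : Set α) (T : α → Set β) {k : ℕ}
    (h : ∀ x ∈ S, k ≤ (T x).ncard) :
    S.ncard * k ≤ {p : α × β | p.1 ∈ S ∧ p.2 ∈ T p.1}.ncard := by
  have := Fintype.ofFinite S
  rw [ncard_fibration]
  have := Finset.card_nsmul_le_sum Finset.univ (fun x : S => (T x).ncard) k (fun x _ => h x x.2)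
  rwa [Finset.card_univ, ← Nat.card_eq_fintype_card, Nat.card_coe_set_eq, smul_eq_mul] at this

theorem ncard_fibration_le [Finite α] (S : Set α) (T : α → Set β) {k : ℕ}
    (h : ∀ x ∈ S, (T x).ncard ≤ k) :
    {p : α × β | p.1 ∈ S ∧ p.2 ∈ T p.1}.ncard ≤ S.ncard * k := by
  have := Fintype.ofFinite S
  rw [ncard_fibration]
  have := Finset.sum_le_card_nsmul Finset.univ (fun x : S => (T x).ncard) k (fun x _ => h x x.2)
  rwa [Finset.card_univ, ← Nat.card_eq_fintype_card, Nat.card_coe_set_eq, smul_eq_mul] at this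

end Fibrations

/-! ### Numbers of hyperbolic pairs and quadruples -/

section Quadruples

variable {F V : Type*} [Field F] [AddCommGroup V] [Module F V] {Q : QuadraticForm F V}

theorem proj_mem_span (a b c d v : V) :
    proj Q a b c d v ∈ Submodule.span F {a, b, c, d} := by
  rw [proj_apply]
  have h : ∀ x ∈ ({a, b, c, d} : Set V), x ∈ Submodule.span F {a, b, c, d} :=
    fun x hx => Submodule.subset_span hx
  refine add_mem (add_mem (add_mem ?_ ?_) ?_) ?_ <;> apply Submodule.smul_mem <;> apply h <;> simp

theorem mem_quadruple_span (a b c d : V) : a ∈ Submodule.span F {a, b, c, d} ∧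
    b ∈ Submodule.span F {a, b, c, d} ∧ c ∈ Submodule.span F {a, b, c, d} ∧
    d ∈ Submodule.span F {a, b, c, d} := by
  refine ⟨?_, ?_, ?_, ?_⟩ <;> apply Submodule.subset_span <;> simp

section

variable {a b c d : V} (hq : IsHyperbolicQuadruple Q a b c d)
include hq

theorem proj_eq_self_of_mem {v : V} (hv : v ∈ Submodule.span F {a, b, c, d}) :
    proj Q a b c d v = v := by
  have hca : polar Q c a = 1 := by rw [polar_comm]; exact hq.9
  have hba : polar Q b a = 0 := by rw [polar_comm]; exact hq.5
  have hdb : polar Q d b = 1 := by rw [polar_comm]; exact hq.10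
  have hda : polar Q d a = 0 := by rw [polar_comm]; exact hq.7
  have hcb : polar Q c b = 0 := by rw [polar_comm]; exact hq.8
  have hdc : polar Q d c = 0 := by rw [polar_comm]; exact hq.6
  have h : Submodule.span F {a, b, c, d} ≤ LinearMap.eqLocus (proj Q a b c d) LinearMap.id := by
    rw [Submodule.span_le]
    rintro x (rfl | rfl | rfl | rfl) <;>
      simp only [SetLike.mem_coe, LinearMap.mem_eqLocus, LinearMap.id_apply, proj_apply,
        polar_self_eq, hq.1, hq.2, hq.3, hq.4, hq.5, hq.6, hq.7, hq.8,
        hq.9, hq.10, hca, hba, hdb, hda, hcb, hdc] <;> module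
  exact h hv

theorem eq_zero_of_polar {v : V} (hv : v ∈ Submodule.span F {a, b, c, d}) (h1 : polar Q v a = 0)
    (h2 : polar Q v b = 0) (h3 : polar Q v c = 0) (h4 : polar Q v d = 0) : v = 0 := by
  rw [← proj_eq_self_of_mem hq hv, proj_apply, h1, h2, h3, h4]
  simp

theorem nonSing_span : NonSing Q (Submodule.span F {a, b, c, d}) := by
  obtain ⟨ha, hb, hc, hd⟩ := mem_quadruple_span (F := F) a b c d
  exact fun x hx h => eq_zero_of_polar hq hx (h a ha) (h b hb) (h c hc) (h d hd)

theorem ncard_span [Finite V] (h2 : (2 : F) ≠ 0) :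
    (Submodule.span F {a, b, c, d} : Set V).ncard = Nat.card F ^ 4 := by
  obtain ⟨ha, hb, hc, hd⟩ := mem_quadruple_span (F := F) a b c d
  obtain ⟨hb', hd'⟩ := mem_pairPerp_of_quadruple hq h2 hb hd
  rw [← ncard_pairPerp hq.1 hq.3 hq.9 h2 ha hc, ← ncard_pairPerp hq.2 hq.4 hq.10 h2 hb' hd']
  have : (pairPerp Q (pairPerp Q (Submodule.span F {a, b, c, d}) a c) b d : Set V) = {0} := by
    ext v
    rw [SetLike.mem_coe, mem_pairPerp h2, mem_pairPerp h2, Set.mem_singleton_iff]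
    constructor
    · rintro ⟨⟨hv, h1, h3⟩, h4, h5⟩
      exact eq_zero_of_polar hq hv h1 h4 h3 h5
    · rintro rfl
      simp
  rw [this, Set.ncard_singleton]
  ring

end

/-- The hyperbolic pairs of `S`. -/
def hypPairs (Q : QuadraticForm F V) (S : Submodule F V) : Set (V × V) :=
  {p | p.1 ∈ S ∧ p.2 ∈ S ∧ Q p.1 = 0 ∧ Q p.2 = 0 ∧ polar Q p.1 p.2 = 1}

/-- The hyperbolic quadruples of `S`, as pairs of hyperbolic pairs. -/
def hypQuads (Q : QuadraticForm F V) (S : Submodule F V) : Set ((V × V) × (V × V)) :=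
  {p | p.1 ∈ hypPairs Q S ∧ p.2 ∈ hypPairs Q (pairPerp Q S p.1.1 p.1.2)}

theorem mem_hypQuads (h2 : (2 : F) ≠ 0) {S : Submodule F V} {a b c d : V} :
    ((a, c), (b, d)) ∈ hypQuads Q S ↔ IsHyperbolicQuadruple Q a b c d ∧
      a ∈ S ∧ b ∈ S ∧ c ∈ S ∧ d ∈ S := by
  simp only [hypQuads, hypPairs, Set.mem_ofPred_eq, mem_pairPerp h2]
  constructor
  · rintro ⟨⟨h1, h3, h4, h5, h6⟩, ⟨k1, k3, k4⟩, ⟨l1, l3, l4⟩, k5, k6, k7⟩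
    exact ⟨⟨h4, k5, h5, k6, by rw [polar_comm]; exact k3, by rw [polar_comm]; exact l4,
      by rw [polar_comm]; exact l3, k4, h6, k7⟩, h1, k1, h3, l1⟩
  · rintro ⟨h, ha, hb, hc, hd⟩
    exact ⟨⟨ha, hc, h.1, h.3, h.9⟩, ⟨hb, by rw [polar_comm]; exact h.5, h.8⟩,
      ⟨hd, by rw [polar_comm]; exact h.7, by rw [polar_comm]; exact h.6⟩, h.2, h.4, h.10⟩

theorem hypPairs_eq (S : Submodule F V) : hypPairs Q S =
    {p : V × V | p.1 ∈ {v | v ∈ S ∧ v ≠ 0 ∧ Q v = 0} ∧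
      p.2 ∈ {v | v ∈ S ∧ polar Q v p.1 = 1 ∧ Q v = 0}} := by
  ext ⟨x, y⟩
  simp only [hypPairs, Set.mem_ofPred_eq]
  constructor
  · rintro ⟨h1, h3, h4, h5, h6⟩
    refine ⟨⟨h1, ?_, h4⟩, h3, by rw [polar_comm]; exact h6, h5⟩
    rintro rfl
    simp at h6
  · rintro ⟨⟨h1, -, h3⟩, h4, h5, h6⟩
    exact ⟨h1, h4, h3, h6, by rw [polar_comm]; exact h5⟩

theorem span_eq_of_mem [Finite V] (h2 : (2 : F) ≠ 0) {a b c d a' b' c' d' : V}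
    (hq : IsHyperbolicQuadruple Q a b c d) (hq' : IsHyperbolicQuadruple Q a' b' c' d')
    (ha : a' ∈ Submodule.span F {a, b, c, d}) (hb : b' ∈ Submodule.span F {a, b, c, d})
    (hc : c' ∈ Submodule.span F {a, b, c, d}) (hd : d' ∈ Submodule.span F {a, b, c, d}) :
    Submodule.span F {a', b', c', d'} = Submodule.span F {a, b, c, d} := by
  have hle : Submodule.span F {a', b', c', d'} ≤ Submodule.span F {a, b, c, d} := by
    rw [Submodule.span_le]
    rintro x (rfl | rfl | rfl | rfl) <;> assumption
  apply SetLike.coe_injective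
  refine Set.eq_of_subset_of_ncard_le hle ?_
  rw [ncard_span hq h2, ncard_span hq' h2]

variable [Finite F] [Finite V]

theorem ncard_hypPairs_le {S : Submodule F V} (hS : NonSing Q S) {d : ℕ}
    (hd : (S : Set V).ncard = Nat.card F ^ (d + 2)) :
    (hypPairs Q S).ncard ≤ 2 * Nat.card F ^ (d + 1) * Nat.card F ^ d := by
  rw [hypPairs_eq]
  refine (ncard_fibration_le _ (fun x => {v | v ∈ S ∧ polar Q v x = 1 ∧ Q v = 0})
    (fun x hx => (ncard_hyperbolic_partner hS hx.1 hx.2.1 hx.2.2 hd).le)).trans ?_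
  exact Nat.mul_le_mul_right _ (ncard_singular_le hS hd)

/-- The singular vectors not orthogonal to `e` are counted exactly. The q - 1 non-zero multiples of
`e` are added since in a plane (d = 0) they form half of all singular vectors, and the factor 2 they
provide is needed later. -/
theorem le_ncard_hypPairs {S : Submodule F V} (hS : NonSing Q S) {d : ℕ}
    (hd : (S : Set V).ncard = Nat.card F ^ (d + 2)) {e : V} (he : e ∈ S) (h0 : e ≠ 0)
    (hQe : Q e = 0) :
    ((Nat.card F - 1) * Nat.card F ^ d + (Nat.card F - 1)) * Nat.card F ^ d
      ≤ (hypPairs Q S).ncard := by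
  rw [hypPairs_eq]
  refine le_trans (Nat.mul_le_mul_right _ ?_)
    (mul_le_ncard_fibration _ (fun x => {v | v ∈ S ∧ polar Q v x = 1 ∧ Q v = 0})
    (fun x hx => (ncard_hyperbolic_partner hS hx.1 hx.2.1 hx.2.2 hd).ge))
  have hmul : Nat.card F - 1 ≤ ((fun k : F => k • e) '' {0}ᶜ).ncard := by
    rw [Set.ncard_image_of_injective _ (smul_left_injective F h0), Set.ncard_compl,
      Set.ncard_singleton]
  rw [le_ncard_quadric_of_singular hS he h0 hQe hd 0]
  refine (Nat.add_le_add_left hmul _).trans ?_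
  have hpe : polar Q e e = 0 := by rw [polar_self_eq, hQe, mul_zero]
  rw [← Set.ncard_union_eq]
  · refine Set.ncard_le_ncard ?_
    rintro v (⟨hv, hp, hQv⟩ | ⟨k, hk, rfl⟩)
    · refine ⟨hv, ?_, hQv⟩
      rintro rfl
      simp at hp
    · exact ⟨S.smul_mem _ he, smul_ne_zero hk h0, by simp only [map_smul_eq, hQe, mul_zero]⟩
  · rw [Set.disjoint_left]
    rintro v ⟨hv, hp, hQv⟩ ⟨k, hk, rfl⟩
    apply hp
    simp only [QuadraticMap.polar_smul_left, hpe, smul_zero]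

theorem ncard_hypQuads_top_le (h2 : (2 : F) ≠ 0) (hQ : Q.polarBilin.Nondegenerate) {m : ℕ}
    (hm : Nat.card V = Nat.card F ^ (m + 4)) :
    (hypQuads Q (⊤ : Submodule F V)).ncard ≤ 4 * Nat.card F ^ (4 * m + 6) := by
  have htop : ((⊤ : Submodule F V) : Set V).ncard = Nat.card F ^ (m + 2 + 2) := by
    rw [Submodule.top_coe, Set.ncard_univ, hm]
  have hS := nonSing_top hQ
  refine (ncard_fibration_le _ (fun p : V × V => hypPairs Q (pairPerp Q ⊤ p.1 p.2))
    (k := 2 * Nat.card F ^ (m + 1) * Nat.card F ^ m) (fun p hp => ?_)).trans ?_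
  · obtain ⟨ha, hc, h1, h3, h4⟩ := hp
    exact ncard_hypPairs_le (hS.pairPerp h1 h3 h4 h2 ha hc)
      (ncard_pairPerp_pow h1 h3 h4 h2 ha hc htop)
  · refine (Nat.mul_le_mul_right _ (ncard_hypPairs_le hS htop)).trans (le_of_eq ?_)
    ring

/-- For each first pair, Witt's theorem inside the 4-space supplies a singular vector in the
orthogonal plane, giving at least 2(q - 1) second pairs. The resulting bound 2(q - 1)²(q⁴ + q²) is
rounded down. -/
theorem le_ncard_hypQuads (h2 : (2 : F) ≠ 0) {a b c d : V} (hq : IsHyperbolicQuadruple Q a b c d) :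
    2 * (Nat.card F - 1) ^ 2 * Nat.card F ^ 4 ≤
      (hypQuads Q (Submodule.span F {a, b, c, d})).ncard := by
  set S := Submodule.span F {a, b, c, d} with hSd
  obtain ⟨ha, hb, hc, hd⟩ := mem_quadruple_span (F := F) a b c d
  have hS : NonSing Q S := nonSing_span hq
  have hcard : (S : Set V).ncard = Nat.card F ^ (2 + 2) := ncard_span hq h2
  have ha0 : a ≠ 0 := by
    rintro rfl
    have := hq.9
    simp at this
  have hb0 : b ≠ 0 := by
    rintro rfl
    have := hq.10
    simp at this
  refine le_trans ?_ (mul_le_ncard_fibration (hypPairs Q S)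
    (fun p : V × V => hypPairs Q (pairPerp Q S p.1 p.2))
    (k := ((Nat.card F - 1) * Nat.card F ^ 0 + (Nat.card F - 1)) * Nat.card F ^ 0) (fun p hp => ?_))
  · refine le_trans ?_ (Nat.mul_le_mul_right _ (le_ncard_hypPairs hS hcard ha ha0 hq.1))
    calc 2 * (Nat.card F - 1) ^ 2 * Nat.card F ^ 4
        ≤ 2 * (Nat.card F - 1) ^ 2 * Nat.card F ^ 4 + 2 * (Nat.card F - 1) ^ 2 * Nat.card F ^ 2 :=
          Nat.le_add_right _ _
      _ = _ := by ring
  · obtain ⟨ha', hc', h1, h3, h4⟩ := hp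
    obtain ⟨g, hg, hga, hgc⟩ := exists_reflGroup_pair hq.1 hq.3 hq.9 h2 ha hc h1 h3 h4 ha' hc'
    have hgO := reflGroup_le S hg
    have hgq := hq.map hgO
    rw [hga, hgc] at hgq
    have hgb := mem_pairPerp_of_quadruple hgq h2 ((reflGroup_map_mem hg _).mpr hb)
      ((reflGroup_map_mem hg _).mpr hd)
    exact le_ncard_hypPairs (hS.pairPerp h1 h3 h4 h2 ha' hc')
      (ncard_pairPerp_pow h1 h3 h4 h2 ha' hc' hcard) hgb.1
      (fun h => hb0 (g.map_eq_zero_iff.mp h)) hgq.2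

end Quadruples

/-! ### Frames: two hyperbolic 4-spaces in good position -/

section Frames

variable {F V : Type*} [Field F] [AddCommGroup V] [Module F V] {Q : QuadraticForm F V}

theorem polar_eq_zero_of_mem_span {a b c d u y : V} (hu : u ∈ Submodule.span F {a, b, c, d})
    (h1 : polar Q y a = 0) (h2 : polar Q y b = 0) (h3 : polar Q y c = 0) (h4 : polar Q y d = 0) :
    polar Q y u = 0 := by
  have h : Submodule.span F {a, b, c, d} ≤ LinearMap.ker (Q.polarBilin y) := by
    rw [Submodule.span_le]
    rintro x (rfl | rfl | rfl | rfl) <;> simpa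
  simpa using h hu

theorem polar_proj_left {a b c d v u : V} (hq : IsHyperbolicQuadruple Q a b c d)
    (hu : u ∈ Submodule.span F {a, b, c, d}) : polar Q (proj Q a b c d v) u = polar Q v u := by
  obtain ⟨h1, h2, h3, h4⟩ := polar_proj_sub hq v
  have := polar_eq_zero_of_mem_span hu h1 h2 h3 h4
  rw [QuadraticMap.polar_sub_left, sub_eq_zero] at this
  exact this.symm

theorem polar_span_quadPerp (h2 : (2 : F) ≠ 0) {a b c d x y : V}
    (hx : x ∈ Submodule.span F {a, b, c, d}) (hy : y ∈ quadPerp Q a b c d) : polar Q x y = 0 := by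
  rw [mem_quadPerp h2] at hy
  rw [polar_comm]
  exact polar_eq_zero_of_mem_span hx hy.1 hy.2.1 hy.2.2.1 hy.2.2.2

theorem proj_quadPerp (h2 : (2 : F) ≠ 0) {a b c d y : V} (hy : y ∈ quadPerp Q a b c d) :
    proj Q a b c d y = 0 := by
  obtain ⟨h1, h3, h4, h5⟩ := (mem_quadPerp h2).mp hy
  rw [proj_apply, h1, h3, h4, h5]
  module

/-- If Q vanished on `S`, then so would its polar form. -/
theorem NonSing.exists_norm_ne {S : Submodule F V} (hS : NonSing Q S)
    (h0 : ∃ v ∈ S, v ≠ 0) : ∃ v ∈ S, Q v ≠ 0 := by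
  obtain ⟨v, hv, hv0⟩ := h0
  by_contra! h
  refine hv0 (hS v hv fun y hy => ?_)
  have := h (v + y) (S.add_mem hv hy)
  rwa [map_add_eq, h v hv, h y hy, zero_add, zero_add] at this

/-- Two non-singular lines of opposite norms twice give a hyperbolic quadruple. -/
theorem isHyperbolicQuadruple_of_orthogonal (h2 : (2 : F) ≠ 0) {v₁ v₂ v₃ v₄ : V}
    (h12 : polar Q v₁ v₂ = 0) (h13 : polar Q v₁ v₃ = 0) (h14 : polar Q v₁ v₄ = 0)
    (h23 : polar Q v₂ v₃ = 0) (h24 : polar Q v₂ v₄ = 0) (h34 : polar Q v₃ v₄ = 0)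
    (h1 : Q v₁ ≠ 0) (h2' : Q v₂ ≠ 0) (h3 : Q v₃ = -Q v₁) (h4 : Q v₄ = -Q v₂) :
    IsHyperbolicQuadruple Q (v₁ + v₃) (v₂ + v₄) ((4 * Q v₁)⁻¹ • (v₁ - v₃))
      ((4 * Q v₂)⁻¹ • (v₂ - v₄)) := by
  have h4F : (4 : F) ≠ 0 := by
    rw [show (4 : F) = 2 * 2 by norm_num]; exact mul_ne_zero h2 h2
  constructor <;>
    simp only [map_add_eq, map_sub_eq, map_smul_eq, QuadraticMap.polar_add_left,
      QuadraticMap.polar_add_right, QuadraticMap.polar_sub_right, QuadraticMap.polar_sub_left,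
      QuadraticMap.polar_smul_left, QuadraticMap.polar_smul_right, polar_self_eq, h12, h13, h14,
      h23, h24, h34, polar_comm Q v₂ v₁, polar_comm Q v₃ v₁, polar_comm Q v₄ v₁,
      polar_comm Q v₃ v₂, polar_comm Q v₄ v₂, polar_comm Q v₄ v₃, h3, h4, smul_eq_mul] <;>
    field_simp <;> ring

theorem span_orthogonal_eq (h2 : (2 : F) ≠ 0) {v₁ v₂ v₃ v₄ : V} {r s : F} (hr : r ≠ 0)
    (hs : s ≠ 0) :
    Submodule.span F {v₁, v₂, v₃, v₄} = Submodule.span F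
      {v₁ + v₃, v₂ + v₄, r⁻¹ • (v₁ - v₃), s⁻¹ • (v₂ - v₄)} := by
  apply le_antisymm
  · rw [Submodule.span_le]
    obtain ⟨ha, hb, hc, hd⟩ := mem_quadruple_span (F := F) (v₁ + v₃) (v₂ + v₄) (r⁻¹ • (v₁ - v₃))
      (s⁻¹ • (v₂ - v₄))
    set S := Submodule.span F {v₁ + v₃, v₂ + v₄, r⁻¹ • (v₁ - v₃), s⁻¹ • (v₂ - v₄)}
    rintro x (rfl | rfl | rfl | rfl)
    · refine Set.mem_of_eq_of_mem ?_ (S.add_mem (S.smul_mem 2⁻¹ ha) (S.smul_mem (2⁻¹ * r) hc))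
      match_scalars <;> field_simp <;> norm_num
    · refine Set.mem_of_eq_of_mem ?_ (S.add_mem (S.smul_mem 2⁻¹ hb) (S.smul_mem (2⁻¹ * s) hd))
      match_scalars <;> field_simp <;> norm_num
    · refine Set.mem_of_eq_of_mem ?_ (S.sub_mem (S.smul_mem 2⁻¹ ha) (S.smul_mem (2⁻¹ * r) hc))
      match_scalars <;> field_simp <;> norm_num
    · refine Set.mem_of_eq_of_mem ?_ (S.sub_mem (S.smul_mem 2⁻¹ hb) (S.smul_mem (2⁻¹ * s) hd))
      match_scalars <;> field_simp <;> norm_num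
  · rw [Submodule.span_le]
    obtain ⟨ha, hb, hc, hd⟩ := mem_quadruple_span (F := F) v₁ v₂ v₃ v₄
    rintro x (rfl | rfl | rfl | rfl)
    · exact add_mem ha hc
    · exact add_mem hb hd
    · exact Submodule.smul_mem _ _ (sub_mem ha hc)
    · exact Submodule.smul_mem _ _ (sub_mem hb hd)

/-- Four pairwise orthogonal non-singular vectors span the span of a hyperbolic quadruple. -/
theorem exists_combination_of_orthogonal [Finite F] [Finite V] (h2 : (2 : F) ≠ 0) {a b c d : V}
    (hq : IsHyperbolicQuadruple Q a b c d) {e₁ e₂ e₃ e₄ : V}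
    (m1 : e₁ ∈ Submodule.span F {a, b, c, d}) (m2 : e₂ ∈ Submodule.span F {a, b, c, d})
    (m3 : e₃ ∈ Submodule.span F {a, b, c, d}) (m4 : e₄ ∈ Submodule.span F {a, b, c, d})
    (h12 : polar Q e₁ e₂ = 0) (h13 : polar Q e₁ e₃ = 0) (h14 : polar Q e₁ e₄ = 0)
    (h23 : polar Q e₂ e₃ = 0) (h24 : polar Q e₂ e₄ = 0) (h34 : polar Q e₃ e₄ = 0)
    (n1 : Q e₁ ≠ 0) (n2 : Q e₂ ≠ 0) (n3 : Q e₃ ≠ 0) (n4 : Q e₄ ≠ 0) {v : V}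
    (hv : v ∈ Submodule.span F {a, b, c, d}) :
    ∃ k₁ k₂ k₃ k₄ : F, v = k₁ • e₁ + k₂ • e₂ + k₃ • e₃ + k₄ • e₄ := by
  set S := Submodule.span F {a, b, c, d} with hSd
  have hS : NonSing Q S := nonSing_span hq
  have hcard : (S : Set V).ncard = Nat.card F ^ (3 + 1) := ncard_span hq h2
  have p2 : e₂ ∈ perp Q S e₁ := mem_perp.mpr ⟨m2, by rw [polar_comm]; exact h12⟩
  have p3 : e₃ ∈ perp Q (perp Q S e₁) e₂ :=
    mem_perp.mpr ⟨mem_perp.mpr ⟨m3, by rw [polar_comm]; exact h13⟩, by rw [polar_comm]; exact h23⟩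
  have p4 : e₄ ∈ perp Q (perp Q (perp Q S e₁) e₂) e₃ :=
    mem_perp.mpr ⟨mem_perp.mpr ⟨mem_perp.mpr ⟨m4, by rw [polar_comm]; exact h14⟩,
      by rw [polar_comm]; exact h24⟩, by rw [polar_comm]; exact h34⟩
  have c1 := ncard_perp h2 m1 n1 hcard
  have c2 := ncard_perp h2 p2 n2 c1
  have c3 := ncard_perp h2 p3 n3 c2
  have c4 := ncard_perp h2 p4 n4 (d := 0) c3
  rw [pow_zero, Set.ncard_eq_one] at c4
  obtain ⟨z, hz⟩ := c4
  have hzero : ∀ x ∈ perp Q (perp Q (perp Q (perp Q S e₁) e₂) e₃) e₄, x = 0 := by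
    intro x hx
    have h1 : x ∈ ({z} : Set V) := hz ▸ hx
    have h3 : (0 : V) ∈ ({z} : Set V) := hz ▸ Submodule.zero_mem _
    rw [Set.mem_singleton_iff] at h1 h3
    rw [h1, h3]
  refine ⟨polar Q v e₁ / (2 * Q e₁), polar Q v e₂ / (2 * Q e₂), polar Q v e₃ / (2 * Q e₃),
    polar Q v e₄ / (2 * Q e₄), ?_⟩
  rw [← sub_eq_zero]
  apply hzero
  simp only [mem_perp]
  refine ⟨⟨⟨⟨?_, ?_⟩, ?_⟩, ?_⟩, ?_⟩
  · exact S.sub_mem hv (S.add_mem (S.add_mem (S.add_mem (S.smul_mem _ m1) (S.smul_mem _ m2))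
      (S.smul_mem _ m3)) (S.smul_mem _ m4))
  all_goals
    simp only [QuadraticMap.polar_sub_left, QuadraticMap.polar_add_left,
      QuadraticMap.polar_smul_left, polar_self_eq, h12, h13, h14, h23, h24, h34,
      polar_comm Q e₂ e₁, polar_comm Q e₃ e₁, polar_comm Q e₄ e₁,
      polar_comm Q e₃ e₂, polar_comm Q e₄ e₂, polar_comm Q e₄ e₃, smul_eq_mul]
    field_simp
    ring

/-- Each reflection negates one vector of an orthogonal basis of the 4-space, fixes the other three,
and fixes the orthogonal complement. The freedom in the basis is what allows the lifts of `i` and of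
its conjugate to be adapted to each other. -/
theorem isNeg_of_orthogonal [Finite F] [Finite V] (h2 : (2 : F) ≠ 0) {a b c d : V}
    (hq : IsHyperbolicQuadruple Q a b c d) {e₁ e₂ e₃ e₄ : V}
    (m1 : e₁ ∈ Submodule.span F {a, b, c, d}) (m2 : e₂ ∈ Submodule.span F {a, b, c, d})
    (m3 : e₃ ∈ Submodule.span F {a, b, c, d}) (m4 : e₄ ∈ Submodule.span F {a, b, c, d})
    (h12 : polar Q e₁ e₂ = 0) (h13 : polar Q e₁ e₃ = 0) (h14 : polar Q e₁ e₄ = 0)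
    (h23 : polar Q e₂ e₃ = 0) (h24 : polar Q e₂ e₄ = 0) (h34 : polar Q e₃ e₄ = 0)
    (n1 : Q e₁ ≠ 0) (n2 : Q e₂ ≠ 0) (n3 : Q e₃ ≠ 0) (n4 : Q e₄ ≠ 0) :
    IsNeg Q a b c d (refl Q e₁ * refl Q e₂ * refl Q e₃ * refl Q e₄) := by
  have hneg : ∀ v ∈ Submodule.span F {a, b, c, d},
      (refl Q e₁ * refl Q e₂ * refl Q e₃ * refl Q e₄) v = -v := by
    intro v hv
    obtain ⟨k₁, k₂, k₃, k₄, rfl⟩ := exists_combination_of_orthogonal h2 hq m1 m2 m3 m4 h12 h13 h14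
      h23 h24 h34 n1 n2 n3 n4 hv
    have f1 := refl_apply_of_polar_eq_zero Q h12
    have f2 := refl_apply_of_polar_eq_zero Q h13
    have f3 := refl_apply_of_polar_eq_zero Q h14
    have f4 := refl_apply_of_polar_eq_zero Q h23
    have f5 := refl_apply_of_polar_eq_zero Q h24
    have f6 := refl_apply_of_polar_eq_zero Q h34
    have g1 := refl_apply_of_polar_eq_zero Q ((polar_comm Q e₂ e₁).trans h12)
    have g2 := refl_apply_of_polar_eq_zero Q ((polar_comm Q e₃ e₁).trans h13)
    have g3 := refl_apply_of_polar_eq_zero Q ((polar_comm Q e₄ e₁).trans h14)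
    have g4 := refl_apply_of_polar_eq_zero Q ((polar_comm Q e₃ e₂).trans h23)
    have g5 := refl_apply_of_polar_eq_zero Q ((polar_comm Q e₄ e₂).trans h24)
    have g6 := refl_apply_of_polar_eq_zero Q ((polar_comm Q e₄ e₃).trans h34)
    simp only [LinearEquiv.mul_apply, map_add, map_smul, map_neg, f1, f2, f3, f4, f5, f6, g1, g2,
      g3, g4, g5, g6, refl_apply_self Q n1, refl_apply_self Q n2, refl_apply_self Q n3,
      refl_apply_self Q n4]
    module
  obtain ⟨ha, hb, hc, hd⟩ := mem_quadruple_span (F := F) a b c d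
  refine ⟨hneg _ ha, hneg _ hb, hneg _ hc, hneg _ hd, fun v h1 h3 h4 h5 => ?_⟩
  have hf : ∀ e ∈ Submodule.span F {a, b, c, d}, refl Q e v = v := fun e he =>
    refl_apply_of_polar_eq_zero Q (polar_eq_zero_of_mem_span he h1 h3 h4 h5)
  rw [LinearEquiv.mul_apply, LinearEquiv.mul_apply, LinearEquiv.mul_apply, hf _ m4, hf _ m3,
    hf _ m2, hf _ m1]

open Polynomial in
-- The hypotheses say that (g + 1)² acts on the pair u, v as 4g times a matrix of trace s and
-- determinant p. Cayley–Hamilton for that matrix, multiplied by 16g², is the quartic.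
theorem quartic_aeval_eq_zero (g : Module.End F V) (s p : F) {u v : V}
    (hu : g (g u) + (2 : F) • g u + u = (4 : F) • (g v - g u))
    (hv : g (g v) + (2 : F) • g v + v = (4 : F) • ((s + 1) • g v - (1 + s + p) • g u)) :
    aeval g ((X + 1) ^ 4 - C (4 * s) * (X * (X + 1) ^ 2) + C (16 * p) * X ^ 2 : F[X]) u = 0 ∧
    aeval g ((X + 1) ^ 4 - C (4 * s) * (X * (X + 1) ^ 2) + C (16 * p) * X ^ 2 : F[X]) v = 0 := by
  have hu' : g (g u) = (4 : F) • g v - (6 : F) • g u - u := by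
    linear_combination (norm := module) hu
  have hv' : g (g v) = (4 * s + 2) • g v - (4 * (1 + s + p)) • g u - v := by
    linear_combination (norm := module) hv
  have e : ∀ x : V, aeval g ((X + 1) ^ 4 - C (4 * s) * (X * (X + 1) ^ 2) + C (16 * p) * X ^ 2 : F[X]) x
      = g (g (g (g x))) + (4 - 4 * s) • g (g (g x)) + (6 - 8 * s + 16 * p) • g (g x)
        + (4 - 4 * s) • g x + x := by
    intro x
    have : ((X + 1) ^ 4 - C (4 * s) * (X * (X + 1) ^ 2) + C (16 * p) * X ^ 2 : F[X])
        = X * X * X * X + C (4 - 4 * s) * (X * X * X) + C (6 - 8 * s + 16 * p) * (X * X)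
          + C (4 - 4 * s) * X + 1 := by
      simp only [map_sub, map_add, map_mul, map_ofNat]
      ring
    rw [this]
    simp only [map_add, map_mul, aeval_X, aeval_C, map_one, LinearMap.add_apply,
      Module.End.mul_apply, Module.algebraMap_end_apply, Module.End.one_apply]
    module
  constructor
  · rw [e]
    simp only [hu', hv', map_sub, map_smul]
    module
  · rw [e]
    simp only [hu', hv', map_sub, map_smul]
    module

end Frames

section Frames

variable {F V : Type*} [Field F] [AddCommGroup V] [Module F V] {Q : QuadraticForm F V}

/-- Data describing a second hyperbolic 4-space `W` in general position to `U = ⟨a, b, c, d⟩`: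
`W` is spanned by `x₁ + y₁`, `(f x₁ + x₂) + (f / 2 y₁ + y₂)`, `w₃` and `w₄`, with `f = 1 + s + p`.
The product of the projections to `U` and to `W` acts on the first two vectors with characteristic
polynomial `X² - s X + p`, and diagonally on the last two. -/
structure IsFrame (Q : QuadraticForm F V) (a b c d : V) (s p : F) (x₁ x₂ y₁ y₂ w₃ w₄ : V) :
    Prop where
  mem_x₁ : x₁ ∈ Submodule.span F {a, b, c, d}
  mem_x₂ : x₂ ∈ Submodule.span F {a, b, c, d}
  mem_y₁ : y₁ ∈ quadPerp Q a b c d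
  mem_y₂ : y₂ ∈ quadPerp Q a b c d
  polar_x : polar Q x₁ x₂ = 0
  polar_y : polar Q y₁ y₂ = 0
  norm_x₁ : Q x₁ = -1
  norm_x₂ : Q x₂ = (1 + s + p) * p
  norm_y₁ : Q y₁ = 2
  norm_y₂ : Q y₂ = -((1 + s + p) / 2) * (1 - s + p)
  polar_w₃x₁ : polar Q w₃ x₁ = 0
  polar_w₃x₂ : polar Q w₃ x₂ = 0
  polar_w₃y₁ : polar Q w₃ y₁ = 0
  polar_w₃y₂ : polar Q w₃ y₂ = 0
  polar_w₄x₁ : polar Q w₄ x₁ = 0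
  polar_w₄x₂ : polar Q w₄ x₂ = 0
  polar_w₄y₁ : polar Q w₄ y₁ = 0
  polar_w₄y₂ : polar Q w₄ y₂ = 0
  norm_w₃ : Q w₃ = -1
  norm_w₄ : Q w₄ = 1 + s + p
  polar_w₃w₄ : polar Q w₃ w₄ = 0
  polar_proj : polar Q (proj Q a b c d w₃) w₄ = 0
  norm_proj : Q (proj Q a b c d w₃) ≠ 0 ∨ Q (proj Q a b c d w₄) ≠ 0

/-- The first basis vector of the second 4-space of a frame. -/
def frameFst (x₁ y₁ : V) : V := x₁ + y₁

/-- The second basis vector of the second 4-space of a frame. -/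
def frameSnd (s p : F) (x₁ x₂ y₁ y₂ : V) : V :=
  ((1 + s + p) • x₁ + x₂) + (((1 + s + p) / 2) • y₁ + y₂)

/-- The second 4-space of a frame. -/
def frameSpace (s p : F) (x₁ x₂ y₁ y₂ w₃ w₄ : V) : Submodule F V :=
  Submodule.span F {frameFst x₁ y₁, frameSnd s p x₁ x₂ y₁ y₂, w₃, w₄}

/-- `p`, `1 - s + p` and `s² - 4 p` are non-squares of the field with `2 k + 1` elements. -/
structure IsTriple (k : ℕ) (s p : F) : Prop where
  const : p ^ k = -1
  eval_one : (1 - s + p) ^ k = -1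
  disc : (s ^ 2 - 4 * p) ^ k = -1

section

variable [Finite F] {k : ℕ} {s p : F}

theorem pow_two_mul_eq_one (hk : Nat.card F = 2 * k + 1) {x : F} (hx : x ≠ 0) :
    x ^ (2 * k) = 1 := by
  have := algebraMap_pow_natCard (R := F) x
  simp only [Algebra.algebraMap_self, RingHom.id_apply] at this
  rw [hk, pow_succ] at this
  exact mul_right_cancel₀ hx (by rw [this, one_mul])

theorem ne_sq_of_pow (hk : Nat.card F = 2 * k + 1) (h2 : (2 : F) ≠ 0) {x y : F}
    (hx : x ^ k = -1) : x ≠ y ^ 2 := by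
  rintro rfl
  have h11 : (1 : F) ≠ -1 := fun h => h2 (by linear_combination h)
  rcases eq_or_ne y 0 with rfl | hy
  · rcases Nat.eq_zero_or_pos k with rfl | hk0
    · rw [pow_zero] at hx; exact h11 hx
    · rw [zero_pow two_ne_zero, zero_pow hk0.ne'] at hx
      exact one_ne_zero (α := F) (by linear_combination hx)
  · rw [← pow_mul, pow_two_mul_eq_one hk hy] at hx
    exact h11 hx

theorem IsTriple.eval_ne_zero (hk : Nat.card F = 2 * k + 1) (h2 : (2 : F) ≠ 0)
    (h : IsTriple k s p) (t : F) : t ^ 2 - s * t + p ≠ 0 := by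
  intro h0
  exact ne_sq_of_pow hk h2 h.disc (y := 2 * t - s) (by linear_combination -4 * h0)

theorem IsTriple.f_ne_zero (hk : Nat.card F = 2 * k + 1) (h2 : (2 : F) ≠ 0)
    (h : IsTriple k s p) : 1 + s + p ≠ 0 := fun h0 =>
  h.eval_ne_zero hk h2 (-1) (by linear_combination h0)

theorem IsTriple.p_ne_zero (hk : Nat.card F = 2 * k + 1) (h2 : (2 : F) ≠ 0)
    (h : IsTriple k s p) : p ≠ 0 := fun h0 =>
  h.eval_ne_zero hk h2 0 (by linear_combination h0)

theorem IsTriple.eval_one_ne_zero (hk : Nat.card F = 2 * k + 1) (h2 : (2 : F) ≠ 0)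
    (h : IsTriple k s p) : 1 - s + p ≠ 0 := fun h0 =>
  h.eval_ne_zero hk h2 1 (by linear_combination h0)

theorem exists_sq_of_pow (hk : Nat.card F = 2 * k + 1) (h2 : (2 : F) ≠ 0) {x : F}
    (h0 : x ≠ 0) (hx : x ^ k = 1) : ∃ y, x = y ^ 2 := by
  have := Fintype.ofFinite F
  have hchar : ringChar F ≠ 2 := fun h => by
    have := CharP.cast_eq_zero_iff F (ringChar F) 2
    exact h2 (by simpa using this.mpr (h ▸ dvd_rfl))
  have hk2 : Fintype.card F / 2 = k := by
    rw [← Nat.card_eq_fintype_card, hk]; omega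
  obtain ⟨y, hy⟩ := (FiniteField.isSquare_iff hchar h0).mpr (hk2 ▸ hx)
  exact ⟨y, by rw [hy, sq]⟩

end

namespace IsFrame

variable {a b c d : V} {s p : F} {x₁ x₂ y₁ y₂ w₃ w₄ : V}

section

variable (h : IsFrame Q a b c d s p x₁ x₂ y₁ y₂ w₃ w₄)
include h

theorem polar_xy (h2 : (2 : F) ≠ 0) : polar Q x₁ y₁ = 0 ∧ polar Q x₁ y₂ = 0 ∧ polar Q x₂ y₁ = 0 ∧
    polar Q x₂ y₂ = 0 := by
  exact ⟨polar_span_quadPerp h2 h.mem_x₁ h.mem_y₁, polar_span_quadPerp h2 h.mem_x₁ h.mem_y₂,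
    polar_span_quadPerp h2 h.mem_x₂ h.mem_y₁, polar_span_quadPerp h2 h.mem_x₂ h.mem_y₂⟩

theorem norm_fst (h2 : (2 : F) ≠ 0) : Q (frameFst x₁ y₁) = 1 := by
  rw [frameFst, map_add_eq, h.norm_x₁, h.norm_y₁, (h.polar_xy h2).1]
  ring

theorem norm_snd (h2 : (2 : F) ≠ 0) : Q (frameSnd s p x₁ x₂ y₁ y₂) = -(1 + s + p) := by
  obtain ⟨e1, e2, e3, e4⟩ := h.polar_xy h2
  simp only [frameSnd, map_add_eq, map_smul_eq, QuadraticMap.polar_add_left,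
    QuadraticMap.polar_add_right, QuadraticMap.polar_smul_left, QuadraticMap.polar_smul_right,
    h.norm_x₁, h.norm_x₂, h.norm_y₁, h.norm_y₂, h.polar_x, h.polar_y, e1, e2, e3, e4, smul_eq_mul]
  field_simp
  ring

theorem polar_fst_snd (h2 : (2 : F) ≠ 0) :
    polar Q (frameFst x₁ y₁) (frameSnd s p x₁ x₂ y₁ y₂) = 0 := by
  obtain ⟨e1, e2, e3, e4⟩ := h.polar_xy h2
  simp only [frameFst, frameSnd, polar_self_eq, QuadraticMap.polar_add_left,
    QuadraticMap.polar_add_right, QuadraticMap.polar_smul_right,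
    h.norm_x₁, h.norm_y₁, h.polar_x, h.polar_y, e1, e2, e3, polar_comm Q y₁ x₁,
    polar_comm Q y₁ x₂, smul_eq_mul]
  field_simp
  ring

theorem polar_w₃_fst : polar Q w₃ (frameFst x₁ y₁) = 0 := by
  simp only [frameFst, QuadraticMap.polar_add_right, h.polar_w₃x₁, h.polar_w₃y₁, add_zero]

theorem polar_w₄_fst : polar Q w₄ (frameFst x₁ y₁) = 0 := by
  simp only [frameFst, QuadraticMap.polar_add_right, h.polar_w₄x₁, h.polar_w₄y₁, add_zero]

theorem polar_w₃_snd : polar Q w₃ (frameSnd s p x₁ x₂ y₁ y₂) = 0 := by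
  simp only [frameSnd, QuadraticMap.polar_add_right, QuadraticMap.polar_smul_right, h.polar_w₃x₁,
    h.polar_w₃y₁, h.polar_w₃x₂, h.polar_w₃y₂, add_zero, smul_zero]

theorem polar_w₄_snd : polar Q w₄ (frameSnd s p x₁ x₂ y₁ y₂) = 0 := by
  simp only [frameSnd, QuadraticMap.polar_add_right, QuadraticMap.polar_smul_right, h.polar_w₄x₁,
    h.polar_w₄y₁, h.polar_w₄x₂, h.polar_w₄y₂, add_zero, smul_zero]

/-- The second 4-space of a frame is hyperbolic. -/
theorem exists_quadruple (h2 : (2 : F) ≠ 0) (hf : 1 + s + p ≠ 0) :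
    ∃ a' b' c' d', IsHyperbolicQuadruple Q a' b' c' d' ∧
      frameSpace s p x₁ x₂ y₁ y₂ w₃ w₄ = Submodule.span F {a', b', c', d'} := by
  have n1 := h.norm_fst h2
  have n2 := h.norm_snd h2
  have h4 : (4 : F) ≠ 0 := by
    rw [show (4 : F) = 2 * 2 by norm_num]; exact mul_ne_zero h2 h2
  have e1 : Q (frameFst x₁ y₁) ≠ 0 := by rw [n1]; exact one_ne_zero
  have e2 : Q (frameSnd s p x₁ x₂ y₁ y₂) ≠ 0 := by rw [n2]; exact neg_ne_zero.mpr hf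
  refine ⟨_, _, _, _, isHyperbolicQuadruple_of_orthogonal h2 (h.polar_fst_snd h2)
    ((polar_comm _ _ _).trans h.polar_w₃_fst) ((polar_comm _ _ _).trans h.polar_w₄_fst)
    ((polar_comm _ _ _).trans h.polar_w₃_snd) ((polar_comm _ _ _).trans h.polar_w₄_snd)
    h.polar_w₃w₄ e1 e2 (by rw [n1, h.norm_w₃]) (by rw [n2, h.norm_w₄, neg_neg]), ?_⟩
  exact span_orthogonal_eq h2 (mul_ne_zero h4 e1) (mul_ne_zero h4 e2)

/-- The sum of the two planes of a frame is hyperbolic. -/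
theorem exists_quadruple_xy [Finite F] {k : ℕ} (hk : Nat.card F = 2 * k + 1) (h2 : (2 : F) ≠ 0)
    (ht : IsTriple k s p) : ∃ a' b' c' d', IsHyperbolicQuadruple Q a' b' c' d' ∧
      x₁ ∈ Submodule.span F {a', b', c', d'} ∧ x₂ ∈ Submodule.span F {a', b', c', d'} ∧
      y₁ ∈ Submodule.span F {a', b', c', d'} ∧ y₂ ∈ Submodule.span F {a', b', c', d'} := by
  obtain ⟨e1, e2, e3, e4⟩ := h.polar_xy h2
  have hf := ht.f_ne_zero hk h2
  have hp := ht.p_ne_zero hk h2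
  have hp1 := ht.eval_one_ne_zero hk h2
  have h4 : (4 : F) ≠ 0 := by
    rw [show (4 : F) = 2 * 2 by norm_num]; exact mul_ne_zero h2 h2
  -- The product of the non-squares p and 1 - s + p is a square; this makes the discriminant of the
  -- span of x₁, x₂, y₁, y₂ a square.
  obtain ⟨r, hr⟩ := exists_sq_of_pow hk h2 (mul_ne_zero hp hp1)
    (by rw [mul_pow, ht.const, ht.eval_one]; ring)
  have hr0 : r ≠ 0 := by
    rintro rfl
    exact mul_ne_zero hp hp1 (by rw [hr]; ring)
  have hm : Q x₂ ≠ 0 := by rw [h.norm_x₂]; exact mul_ne_zero hf hp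
  have hn : Q y₂ ≠ 0 := by
    rw [h.norm_y₂]; exact mul_ne_zero (neg_ne_zero.mpr (div_ne_zero hf h2)) hp1
  obtain ⟨α, β, hαβ⟩ := exists_binary_eq (by rw [hk]; exact odd_two_mul_add_one k) hm hn 1
  -- The vectors `v₃`, `v₄` form a new orthogonal basis of ⟨x₂, y₂⟩ with norms opposite to those of
  -- x₁ and y₁. The norm of `v₄` is κ²Q(x₂)Q(y₂), and this κ makes it -2.
  set κ := 2 / ((1 + s + p) * r) with hκ
  have hκ0 : κ ≠ 0 := div_ne_zero h2 (mul_ne_zero hf hr0)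
  set v₃ := α • x₂ + β • y₂ with hv₃
  set v₄ := (κ * β * Q y₂) • x₂ - (κ * α * Q x₂) • y₂ with hv₄
  have q3 : Q v₃ = 1 := by
    rw [hv₃, map_add_eq, map_smul_eq, map_smul_eq, QuadraticMap.polar_smul_left,
      QuadraticMap.polar_smul_right, e4, smul_zero, smul_zero, ← hαβ]
    ring
  have q4 : Q v₄ = -2 := by
    have e : Q v₄ = κ ^ 2 * (Q x₂ * Q y₂) := by
      rw [hv₄, map_sub_eq, map_smul_eq, map_smul_eq, QuadraticMap.polar_smul_left,
        QuadraticMap.polar_smul_right, e4, smul_zero, smul_zero]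
      linear_combination κ ^ 2 * Q x₂ * Q y₂ * hαβ
    rw [e, h.norm_x₂, h.norm_y₂, hκ]
    field_simp
    linear_combination (-1 : F) * hr
  have p34 : polar Q v₃ v₄ = 0 := by
    simp only [hv₃, hv₄, QuadraticMap.polar_add_left, QuadraticMap.polar_smul_left,
      QuadraticMap.polar_sub_right, QuadraticMap.polar_smul_right, polar_self_eq, e4,
      polar_comm Q y₂ x₂, smul_eq_mul]
    ring
  have perp : ∀ {z : V}, polar Q z x₂ = 0 → polar Q z y₂ = 0 → polar Q z v₃ = 0 ∧ polar Q z v₄ = 0 := by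
    intro z hz hz'
    simp only [hv₃, hv₄, QuadraticMap.polar_add_right, QuadraticMap.polar_sub_right,
      QuadraticMap.polar_smul_right, hz, hz', smul_zero, add_zero, sub_zero, and_self]
  obtain ⟨p13, p14⟩ := perp h.polar_x e2
  obtain ⟨p23, p24⟩ := perp (z := y₁) ((polar_comm _ _ _).trans e3) h.polar_y
  have n1 : Q x₁ ≠ 0 := by rw [h.norm_x₁]; exact neg_ne_zero.mpr one_ne_zero
  have n2 : Q y₁ ≠ 0 := by rw [h.norm_y₁]; exact h2
  refine ⟨_, _, _, _, isHyperbolicQuadruple_of_orthogonal h2 e1 p13 p14 p23 p24 p34 n1 n2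
    (by rw [q3, h.norm_x₁, neg_neg]) (by rw [q4, h.norm_y₁]), ?_⟩
  rw [← span_orthogonal_eq h2 (mul_ne_zero h4 n1) (mul_ne_zero h4 n2)]
  obtain ⟨m1, m2, m3, m4⟩ := mem_quadruple_span (F := F) x₁ y₁ v₃ v₄
  refine ⟨m1, ?_, m2, ?_⟩
  · refine Set.mem_of_eq_of_mem ?_ (add_mem (Submodule.smul_mem _ (α * Q x₂) m3)
      (Submodule.smul_mem _ (β / κ) m4))
    have : (1 : F) • x₂ = (Q x₂ * α ^ 2 + Q y₂ * β ^ 2) • x₂ := by rw [hαβ]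
    rw [one_smul] at this
    rw [hv₃, hv₄]
    nth_rewrite 1 [this]
    match_scalars <;> field_simp
    ring
  · refine Set.mem_of_eq_of_mem ?_ (sub_mem (Submodule.smul_mem _ (β * Q y₂) m3)
      (Submodule.smul_mem _ (α / κ) m4))
    have : (1 : F) • y₂ = (Q x₂ * α ^ 2 + Q y₂ * β ^ 2) • y₂ := by rw [hαβ]
    rw [one_smul] at this
    rw [hv₃, hv₄]
    nth_rewrite 1 [this]
    match_scalars <;> field_simp <;> ring

end

end IsFrame

end Frames

section Frames

variable {F V : Type*} [Field F] [AddCommGroup V] [Module F V] {Q : QuadraticForm F V}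

namespace IsFrame

variable {a b c d : V} {s p : F} {x₁ x₂ y₁ y₂ w₃ w₄ : V}
  (h : IsFrame Q a b c d s p x₁ x₂ y₁ y₂ w₃ w₄) [Finite F]
include h

/-- The plane of U orthogonal to x₁, x₂ contains the projections of w₃ and w₄, which are mutually
orthogonal. Whichever projection is non-singular serves as u₃ or u₄, and its orthogonal vector in
the plane as the other. Hence the disjunction in `norm_proj`: one non-singular projection is enough.
-/
theorem exists_orthogonal [Finite V] (hq : IsHyperbolicQuadruple Q a b c d) {k : ℕ}
    (hk : Nat.card F = 2 * k + 1) (h2 : (2 : F) ≠ 0) (ht : IsTriple k s p) :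
    ∃ u₃ u₄, u₃ ∈ Submodule.span F {a, b, c, d} ∧ u₄ ∈ Submodule.span F {a, b, c, d} ∧
      Q u₃ ≠ 0 ∧ Q u₄ ≠ 0 ∧ polar Q u₃ x₁ = 0 ∧ polar Q u₃ x₂ = 0 ∧ polar Q u₄ x₁ = 0 ∧
      polar Q u₄ x₂ = 0 ∧ polar Q u₃ u₄ = 0 ∧ polar Q u₃ w₄ = 0 ∧ polar Q u₄ w₃ = 0 := by
  set S := Submodule.span F {a, b, c, d} with hSd
  have hS : NonSing Q S := nonSing_span hq
  have hcard : (S : Set V).ncard = Nat.card F ^ (3 + 1) := ncard_span hq h2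
  have n1 : Q x₁ ≠ 0 := by rw [h.norm_x₁]; exact neg_ne_zero.mpr one_ne_zero
  have n2 : Q x₂ ≠ 0 := by
    rw [h.norm_x₂]; exact mul_ne_zero (ht.f_ne_zero hk h2) (ht.p_ne_zero hk h2)
  have m2 : x₂ ∈ perp Q S x₁ := mem_perp.mpr ⟨h.mem_x₂, by rw [polar_comm]; exact h.polar_x⟩
  set T := perp Q (perp Q S x₁) x₂ with hT
  have hTS : NonSing Q T := (hS.perp h2 h.mem_x₁ n1).perp h2 m2 n2
  have hTc := ncard_perp h2 m2 n2 (ncard_perp h2 h.mem_x₁ n1 hcard)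
  have key : ∀ {w : V}, polar Q w x₁ = 0 → polar Q w x₂ = 0 → Q (proj Q a b c d w) ≠ 0 →
      proj Q a b c d w ∈ T ∧ ∃ u ∈ T, Q u ≠ 0 ∧ polar Q u (proj Q a b c d w) = 0 := by
    intro w hw1 hw2 hw
    have hm : proj Q a b c d w ∈ T := by
      rw [hT, mem_perp, mem_perp, polar_proj_left hq h.mem_x₁, polar_proj_left hq h.mem_x₂]
      exact ⟨⟨proj_mem_span _ _ _ _ _, hw1⟩, hw2⟩
    obtain ⟨u, hu, hu0⟩ := (hTS.perp h2 hm hw).exists_norm_ne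
      (exists_ne_zero_of_ncard (d := 0) (ncard_perp h2 hm hw hTc))
    exact ⟨hm, u, (mem_perp.mp hu).1, hu0, (mem_perp.mp hu).2⟩
  have unp : ∀ {u : V}, u ∈ T → u ∈ S ∧ polar Q u x₁ = 0 ∧ polar Q u x₂ = 0 := by
    intro u hu
    rw [hT, mem_perp, mem_perp] at hu
    exact ⟨hu.1.1, hu.1.2, hu.2⟩
  have hps : ∀ {u w : V}, u ∈ T → polar Q u (proj Q a b c d w) = 0 → polar Q u w = 0 := by
    intro u w hu hw
    rw [polar_comm, ← polar_proj_left hq (unp hu).1, polar_comm]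
    exact hw
  rcases h.norm_proj with hw | hw
  · obtain ⟨hm, u, hu, hu0, hup⟩ := key h.polar_w₃x₁ h.polar_w₃x₂ hw
    exact ⟨_, u, (unp hm).1, (unp hu).1, hw, hu0, (unp hm).2.1, (unp hm).2.2, (unp hu).2.1,
      (unp hu).2.2, (polar_comm _ _ _).trans hup, h.polar_proj, hps hu hup⟩
  · obtain ⟨hm, u, hu, hu0, hup⟩ := key h.polar_w₄x₁ h.polar_w₄x₂ hw
    refine ⟨u, _, (unp hu).1, (unp hm).1, hu0, hw, (unp hu).2.1, (unp hu).2.2, (unp hm).2.1,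
      (unp hm).2.2, hup, hps hu hup, ?_⟩
    refine hps hm ?_
    rw [polar_proj_left hq (proj_mem_span _ _ _ _ _), polar_comm]
    exact h.polar_proj

/-- The product of the reflections in `x₁`, `x₂` and in the first two vectors of the second 4-space,
raised to the power `(q² - 1) / 2`, is `-1` on the span of `x₁, x₂, y₁, y₂`. -/
theorem pow_apply {k : ℕ} (hk : Nat.card F = 2 * k + 1) (h2 : (2 : F) ≠ 0) (ht : IsTriple k s p)
    {v : V} (hv : v ∈ Submodule.span F {x₁, x₂, y₁, y₂}) :
    ((refl Q x₁ * refl Q x₂ * (refl Q (frameFst x₁ y₁) * refl Q (frameSnd s p x₁ x₂ y₁ y₂)))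
      ^ (2 * k * (k + 1))) v = -v := by
  obtain ⟨e1, e2, e3, e4⟩ := h.polar_xy h2
  have hf := ht.f_ne_zero hk h2
  have n1 : Q x₁ ≠ 0 := by rw [h.norm_x₁]; exact neg_ne_zero.mpr one_ne_zero
  have n2 : Q x₂ ≠ 0 := by
    rw [h.norm_x₂]; exact mul_ne_zero hf (ht.p_ne_zero hk h2)
  set g := refl Q x₁ * refl Q x₂ * (refl Q (frameFst x₁ y₁) * refl Q (frameSnd s p x₁ x₂ y₁ y₂))
    with hg
  -- In the basis x₁, x₂', y₁, y₂' the two vectors of W are x₁ + y₁ and x₂' + y₂', and the entries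
  -- of `g` become polynomials in s and p.
  set x₂' := (1 + s + p) • x₁ + x₂ with hx₂'
  set y₂' := ((1 + s + p) / 2) • y₁ + y₂ with hy₂'
  have hsnd : frameSnd s p x₁ x₂ y₁ y₂ = x₂' + y₂' := rfl
  have hI : ∀ α β γ δ : F, (refl Q x₁ * refl Q x₂) (α • x₁ + β • x₂' + γ • y₁ + δ • y₂')
      = -(α • x₁) - β • x₂' + γ • y₁ + δ • y₂' := by
    intro α β γ δ
    rw [LinearEquiv.mul_apply, hx₂', hy₂']
    simp only [map_add, map_smul, refl_apply_self Q n1, refl_apply_self Q n2, map_neg,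
      refl_apply_of_polar_eq_zero Q h.polar_x,
      refl_apply_of_polar_eq_zero Q ((polar_comm Q x₂ x₁).trans h.polar_x),
      refl_apply_of_polar_eq_zero Q ((polar_comm Q y₁ x₁).trans e1),
      refl_apply_of_polar_eq_zero Q ((polar_comm Q y₂ x₁).trans e2),
      refl_apply_of_polar_eq_zero Q ((polar_comm Q y₁ x₂).trans e3),
      refl_apply_of_polar_eq_zero Q ((polar_comm Q y₂ x₂).trans e4)]
    module
  have hJ : ∀ v : V, g v = (refl Q x₁ * refl Q x₂)
      (v - polar Q v (frameFst x₁ y₁) • frameFst x₁ y₁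
        + ((1 + s + p)⁻¹ * polar Q v (frameSnd s p x₁ x₂ y₁ y₂)) • frameSnd s p x₁ x₂ y₁ y₂) := by
    intro v
    rw [hg, LinearEquiv.mul_apply]
    congr 1
    rw [LinearEquiv.mul_apply, refl_apply, refl_apply, h.norm_fst h2, h.norm_snd h2,
      QuadraticMap.polar_sub_left, QuadraticMap.polar_smul_left,
      polar_comm Q (frameSnd s p x₁ x₂ y₁ y₂), h.polar_fst_snd h2]
    rw [smul_zero, sub_zero, inv_one, inv_neg]
    module
  have gx₁ : g x₁ = (-3 : F) • x₁ + (2 : F) • x₂' + (2 : F) • y₁ - (2 : F) • y₂' := by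
    have h1 : polar Q x₁ (frameFst x₁ y₁) = -2 := by
      simp only [frameFst, QuadraticMap.polar_add_right, polar_self_eq, e1, h.norm_x₁]; ring
    have h3 : polar Q x₁ (frameSnd s p x₁ x₂ y₁ y₂) = -2 * (1 + s + p) := by
      simp only [frameSnd, QuadraticMap.polar_add_right, QuadraticMap.polar_smul_right,
        polar_self_eq, e1, e2, h.polar_x, h.norm_x₁, smul_eq_mul]; ring
    rw [hJ, h1, h3, hsnd, frameFst]
    have := hI 3 (-2) 2 (-2)
    convert this using 2
    · match_scalars <;> field_simp <;> ring
    · module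
  have gx₂ : g x₂' = (1 + 2 * s) • x₂' - (2 * (1 + s + p)) • x₁ + (2 * (1 + s + p)) • y₁
      - (2 * (1 + s)) • y₂' := by
    have h1 : polar Q x₂' (frameFst x₁ y₁) = -2 * (1 + s + p) := by
      simp only [hx₂', frameFst, QuadraticMap.polar_add_right, QuadraticMap.polar_add_left,
        QuadraticMap.polar_smul_left, polar_self_eq, e1, e3, h.norm_x₁, polar_comm Q x₂ x₁,
        h.polar_x, smul_eq_mul]; ring
    have h3 : polar Q x₂' (frameSnd s p x₁ x₂ y₁ y₂) = -2 * (1 + s) * (1 + s + p) := by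
      simp only [hx₂', frameSnd, QuadraticMap.polar_add_right, QuadraticMap.polar_smul_right,
        QuadraticMap.polar_add_left, QuadraticMap.polar_smul_left, e1, e2, e3, e4, smul_eq_mul]
      simp only [polar_comm Q x₂ x₁, polar_self_eq, h.polar_x, h.norm_x₁, h.norm_x₂]
      ring
    rw [hJ, h1, h3, hsnd, frameFst]
    have := hI (2 * (1 + s + p)) (1 - 2 * (1 + s)) (2 * (1 + s + p)) (-2 * (1 + s))
    convert this using 2
    · match_scalars <;> field_simp <;> ring
    · module
  have gy₁ : g y₁ = (-3 : F) • y₁ + (4 : F) • x₁ - (2 : F) • x₂' + (2 : F) • y₂' := by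
    have h1 : polar Q y₁ (frameFst x₁ y₁) = 4 := by
      simp only [frameFst, QuadraticMap.polar_add_right, polar_self_eq, polar_comm Q y₁ x₁, e1,
        h.norm_y₁]; ring
    have h3 : polar Q y₁ (frameSnd s p x₁ x₂ y₁ y₂) = 2 * (1 + s + p) := by
      simp only [frameSnd, QuadraticMap.polar_add_right, QuadraticMap.polar_smul_right,
        polar_self_eq, polar_comm Q y₁ x₁, polar_comm Q y₁ x₂, e1, e3, h.polar_y, h.norm_y₁,
        smul_eq_mul]
      field_simp
      ring
    rw [hJ, h1, h3, hsnd, frameFst]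
    have := hI (-4) 2 (-3) 2
    convert this using 2
    · match_scalars <;> field_simp <;> ring
    · module
  have gy₂ : g y₂' = (1 + 2 * s) • y₂' + (2 * (1 + s + p)) • x₁ - (2 * s) • x₂'
      - (2 * (1 + s + p)) • y₁ := by
    have h1 : polar Q y₂' (frameFst x₁ y₁) = 2 * (1 + s + p) := by
      simp only [hy₂', frameFst, QuadraticMap.polar_add_right, QuadraticMap.polar_add_left,
        QuadraticMap.polar_smul_left, polar_self_eq, polar_comm Q y₁ x₁, polar_comm Q y₂ x₁,
        polar_comm Q y₂ y₁, e1, e2, h.norm_y₁, h.polar_y, smul_eq_mul]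
      field_simp
      ring
    have h3 : polar Q y₂' (frameSnd s p x₁ x₂ y₁ y₂) = 2 * s * (1 + s + p) := by
      simp only [hy₂', frameSnd, QuadraticMap.polar_add_right, QuadraticMap.polar_smul_right,
        QuadraticMap.polar_add_left, QuadraticMap.polar_smul_left, polar_comm Q y₁ x₁,
        polar_comm Q y₁ x₂, polar_comm Q y₂ x₁, polar_comm Q y₂ x₂, e1, e2, e3, e4, smul_eq_mul]
      simp only [polar_comm Q y₂ y₁, polar_self_eq, h.polar_y, h.norm_y₁, h.norm_y₂]
      field_simp
      ring
    rw [hJ, h1, h3, hsnd, frameFst]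
    have := hI (-2 * (1 + s + p)) (2 * s) (-2 * (1 + s + p)) (1 + 2 * s)
    convert this using 2
    · match_scalars <;> field_simp <;> ring
    · module
  open Polynomial in
  obtain ⟨r, hr⟩ := quartic_dvd_X_pow_add_one hk h2 s p ht.const ht.eval_one ht.disc
  -- The pairs x₁, x₂' and y₁, y₂' satisfy the same relations, so one quartic kills the whole span.
  obtain ⟨qx₁, qx₂⟩ := quartic_aeval_eq_zero (g.toLinearMap : Module.End F V) s p (u := x₁) (v := x₂')
    (by simp only [LinearEquiv.coe_coe, gx₁, gx₂, gy₁, gy₂, map_add, map_sub, map_smul]; module)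
    (by simp only [LinearEquiv.coe_coe, gx₁, gx₂, gy₁, gy₂, map_add, map_sub, map_smul]; module)
  obtain ⟨qy₁, qy₂⟩ := quartic_aeval_eq_zero (g.toLinearMap : Module.End F V) s p (u := y₁) (v := y₂')
    (by simp only [LinearEquiv.coe_coe, gx₁, gx₂, gy₁, gy₂, map_add, map_sub, map_smul]; module)
    (by simp only [LinearEquiv.coe_coe, gx₁, gx₂, gy₁, gy₂, map_add, map_sub, map_smul]; module)
  open Polynomial in
  have hle : Submodule.span F {x₁, x₂, y₁, y₂} ≤ LinearMap.ker (aeval (g.toLinearMap : Module.End F V)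
      ((X + 1) ^ 4 - C (4 * s) * (X * (X + 1) ^ 2) + C (16 * p) * X ^ 2 : F[X])) := by
    rw [Submodule.span_le]
    rintro x (rfl | rfl | rfl | rfl)
    · exact qx₁
    · rw [hx₂', map_add, map_smul, qx₁, smul_zero, zero_add] at qx₂
      exact qx₂
    · exact qy₁
    · rw [hy₂', map_add, map_smul, qy₁, smul_zero, zero_add] at qy₂
      exact qy₂
  have hz := LinearMap.mem_ker.mp (hle hv)
  rw [pow_toLinearMap_apply]
  open Polynomial in
  have h3 := congrArg (fun P => aeval (g.toLinearMap : Module.End F V) P v) hr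
  beta_reduce at h3
  rw [mul_comm _ r, map_mul, Module.End.mul_apply, hz, map_zero] at h3
  simp only [map_add, map_pow, Polynomial.aeval_X, map_one, LinearMap.add_apply,
    Module.End.one_apply] at h3
  exact eq_neg_of_add_eq_zero_left h3

/-- If `i` and `j` are `-1` on the two 4-spaces of a frame, then a power of `i j` is `-1` on the
hyperbolic space spanned by `x₁, x₂, y₁, y₂`. -/
theorem mul_pow_eq [Finite V] (hq : IsHyperbolicQuadruple Q a b c d) {k : ℕ} (hk0 : 0 < k)
    (hk : Nat.card F = 2 * k + 1) (h2 : (2 : F) ≠ 0) (ht : IsTriple k s p) {i j : V ≃ₗ[F] V}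
    (hi : IsNeg Q a b c d i) {a' b' c' d' : V} (hq' : IsHyperbolicQuadruple Q a' b' c' d')
    (hW : frameSpace s p x₁ x₂ y₁ y₂ w₃ w₄ = Submodule.span F {a', b', c', d'})
    (hj : IsNeg Q a' b' c' d' j) :
    ∃ a₀ b₀ c₀ d₀, IsHyperbolicQuadruple Q a₀ b₀ c₀ d₀ ∧
      IsNeg Q a₀ b₀ c₀ d₀ ((i * j) ^ ((2 * k + 1) * (2 * k * (k + 1)))) ∧
      (i * j) ^ ((2 * k + 1) * (2 * k * (k + 1)))
        = refl Q x₁ * refl Q x₂ * refl Q y₁ * refl Q y₂ := by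
  obtain ⟨e1, e2, e3, e4⟩ := h.polar_xy h2
  have hf := ht.f_ne_zero hk h2
  have n1 : Q x₁ ≠ 0 := by rw [h.norm_x₁]; exact neg_ne_zero.mpr one_ne_zero
  have n2 : Q x₂ ≠ 0 := by
    rw [h.norm_x₂]; exact mul_ne_zero hf (ht.p_ne_zero hk h2)
  have n3 : Q y₁ ≠ 0 := by rw [h.norm_y₁]; exact h2
  have n4 : Q y₂ ≠ 0 := by
    rw [h.norm_y₂]
    exact mul_ne_zero (neg_ne_zero.mpr (div_ne_zero hf h2)) (ht.eval_one_ne_zero hk h2)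
  set w₁ := frameFst x₁ y₁ with hw₁
  set w₂ := frameSnd s p x₁ x₂ y₁ y₂ with hw₂
  have l1 : Q w₁ ≠ 0 := by rw [hw₁, h.norm_fst h2]; exact one_ne_zero
  have l2 : Q w₂ ≠ 0 := by rw [hw₂, h.norm_snd h2]; exact neg_ne_zero.mpr hf
  have l3 : Q w₃ ≠ 0 := by rw [h.norm_w₃]; exact neg_ne_zero.mpr one_ne_zero
  have l4 : Q w₄ ≠ 0 := by rw [h.norm_w₄]; exact hf
  obtain ⟨u₃, u₄, mu3, mu4, k3, k4, u31, u32, u41, u42, u34, u3w, u4w⟩ :=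
    h.exists_orthogonal hq hk h2 ht
  have hi' : i = refl Q x₁ * refl Q x₂ * refl Q u₃ * refl Q u₄ :=
    hi.unique hq (isNeg_of_orthogonal h2 hq h.mem_x₁ h.mem_x₂ mu3 mu4 h.polar_x
      ((polar_comm _ _ _).trans u31) ((polar_comm _ _ _).trans u41) ((polar_comm _ _ _).trans u32)
      ((polar_comm _ _ _).trans u42) u34 n1 n2 k3 k4)
  obtain ⟨mw1, mw2, mw3, mw4⟩ := mem_quadruple_span (F := F) w₁ w₂ w₃ w₄
  have hWs : Submodule.span F {w₁, w₂, w₃, w₄} = Submodule.span F {a', b', c', d'} := hW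
  rw [hWs] at mw1 mw2 mw3 mw4
  have hj' : j = refl Q w₁ * refl Q w₂ * refl Q w₃ * refl Q w₄ :=
    hj.unique hq' (isNeg_of_orthogonal h2 hq' mw1 mw2 mw3 mw4 (h.polar_fst_snd h2)
      ((polar_comm _ _ _).trans h.polar_w₃_fst) ((polar_comm _ _ _).trans h.polar_w₄_fst)
      ((polar_comm _ _ _).trans h.polar_w₃_snd) ((polar_comm _ _ _).trans h.polar_w₄_snd)
      h.polar_w₃w₄ l1 l2 l3 l4)
  have hU : ∀ {u : V}, u ∈ Submodule.span F {a, b, c, d} → polar Q u x₁ = 0 → polar Q u x₂ = 0 →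
      polar Q u w₁ = 0 ∧ polar Q u w₂ = 0 := by
    intro u hu h1 h3
    have hy1 := polar_span_quadPerp h2 hu h.mem_y₁
    have hy2 := polar_span_quadPerp h2 hu h.mem_y₂
    simp only [hw₁, hw₂, frameFst, frameSnd, QuadraticMap.polar_add_right,
      QuadraticMap.polar_smul_right, h1, h3, hy1, hy2, smul_zero, add_zero, and_self]
  obtain ⟨u3w1, u3w2⟩ := hU mu3 u31 u32
  obtain ⟨u4w1, u4w2⟩ := hU mu4 u41 u42
  set g := refl Q x₁ * refl Q x₂ * (refl Q w₁ * refl Q w₂) with hg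
  have cg : ∀ {u : V}, polar Q u x₁ = 0 → polar Q u x₂ = 0 → polar Q u w₁ = 0 → polar Q u w₂ = 0 →
      Commute g (refl Q u) := by
    intro u h1 h3 h4 h5
    exact (((refl_comm h1).symm.mul_left (refl_comm h3).symm).mul_left
      ((refl_comm h4).symm.mul_left (refl_comm h5).symm))
  have c3 : Commute g (refl Q u₃ * refl Q w₃) := (cg u31 u32 u3w1 u3w2).mul_right
    (cg h.polar_w₃x₁ h.polar_w₃x₂ h.polar_w₃_fst h.polar_w₃_snd)
  have c4 : Commute g (refl Q u₄ * refl Q w₄) := (cg u41 u42 u4w1 u4w2).mul_right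
    (cg h.polar_w₄x₁ h.polar_w₄x₂ h.polar_w₄_fst h.polar_w₄_snd)
  have c34 : Commute (refl Q u₃ * refl Q w₃) (refl Q u₄ * refl Q w₄) :=
    ((refl_comm u34).mul_right (refl_comm u3w)).mul_left
      ((refl_comm ((polar_comm _ _ _).trans u4w)).mul_right (refl_comm h.polar_w₃w₄))
  -- Only u₃ with w₃ and u₄ with w₄ may fail to be orthogonal, so the reflections can be regrouped
  -- into three commuting factors.
  have hij : i * j = g * (refl Q u₃ * refl Q w₃) * (refl Q u₄ * refl Q w₄) := by
    rw [hi', hj', hg]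
    have t1 : refl Q u₄ * refl Q w₁ = refl Q w₁ * refl Q u₄ := refl_comm u4w1
    have t2 : refl Q u₄ * refl Q w₂ = refl Q w₂ * refl Q u₄ := refl_comm u4w2
    have t3 : refl Q u₄ * refl Q w₃ = refl Q w₃ * refl Q u₄ := refl_comm u4w
    have t4 : refl Q u₃ * refl Q w₁ = refl Q w₁ * refl Q u₃ := refl_comm u3w1
    have t5 : refl Q u₃ * refl Q w₂ = refl Q w₂ * refl Q u₃ := refl_comm u3w2
    calc refl Q x₁ * refl Q x₂ * refl Q u₃ * refl Q u₄ *
          (refl Q w₁ * refl Q w₂ * refl Q w₃ * refl Q w₄)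
        = refl Q x₁ * refl Q x₂ * refl Q u₃ * (refl Q u₄ * refl Q w₁) * refl Q w₂ * refl Q w₃ *
          refl Q w₄ := by group
      _ = refl Q x₁ * refl Q x₂ * (refl Q u₃ * refl Q w₁) * (refl Q u₄ * refl Q w₂) * refl Q w₃ *
          refl Q w₄ := by rw [t1]; group
      _ = refl Q x₁ * refl Q x₂ * refl Q w₁ * (refl Q u₃ * refl Q w₂) * (refl Q u₄ * refl Q w₃) *
          refl Q w₄ := by rw [t2, t4]; group
      _ = _ := by rw [t3, t5]; group
  set N := (2 * k + 1) * (2 * k * (k + 1)) with hN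
  have hpow : (i * j) ^ N = g ^ N := by
    rw [hij, (c4.mul_left c34).mul_pow, c3.mul_pow, hN, refl_mul_refl_pow hk0 hk h2 k3 l3,
      refl_mul_refl_pow hk0 hk h2 k4 l4, mul_one, mul_one]
  obtain ⟨a₀, b₀, c₀, d₀, hq₀, mx1, mx2, my1, my2⟩ := h.exists_quadruple_xy hk h2 ht
  have hz := isNeg_of_orthogonal h2 hq₀ mx1 mx2 my1 my2 h.polar_x e1 e2 e3 e4 h.polar_y n1 n2 n3 n4
  have hgz : IsNeg Q a₀ b₀ c₀ d₀ (g ^ N) := by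
    have hneg : ∀ v ∈ Submodule.span F {a₀, b₀, c₀, d₀}, (g ^ N) v = -v := by
      intro v hv
      obtain ⟨k₁, k₂, k₃, k₄, hcomb⟩ := exists_combination_of_orthogonal h2 hq₀ mx1 mx2 my1 my2
        h.polar_x e1 e2 e3 e4 h.polar_y n1 n2 n3 n4 hv
      have hv' : v ∈ Submodule.span F {x₁, x₂, y₁, y₂} := by
        obtain ⟨m1, m2, m3, m4⟩ := mem_quadruple_span (F := F) x₁ x₂ y₁ y₂
        rw [hcomb]
        exact add_mem (add_mem (add_mem (Submodule.smul_mem _ _ m1) (Submodule.smul_mem _ _ m2))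
          (Submodule.smul_mem _ _ m3)) (Submodule.smul_mem _ _ m4)
      have hb : (g ^ (2 * k * (k + 1))) v = -v := h.pow_apply hk h2 ht hv'
      -- The power (q² - 1)/2 is already -1 on this space, and the further factor q of N is odd.
      rw [hN, mul_comm, pow_mul]
      generalize g ^ (2 * k * (k + 1)) = y at hb
      have hsq : ∀ n : ℕ, (y ^ (2 * n)) v = v := by
        intro n
        induction n with
        | zero => rfl
        | succ n ih =>
          rw [show 2 * (n + 1) = 2 * n + 1 + 1 by ring, pow_succ, pow_succ, LinearEquiv.mul_apply,
            LinearEquiv.mul_apply, hb, map_neg, hb, neg_neg, ih]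
      rw [pow_succ, LinearEquiv.mul_apply, hb, map_neg, hsq]
    obtain ⟨ha, hb, hc, hd⟩ := mem_quadruple_span (F := F) a₀ b₀ c₀ d₀
    refine ⟨hneg _ ha, hneg _ hb, hneg _ hc, hneg _ hd, fun v h1 h3 h4 h5 => ?_⟩
    have hf : ∀ e ∈ Submodule.span F {a₀, b₀, c₀, d₀}, refl Q e v = v := fun e he =>
      refl_apply_of_polar_eq_zero Q (polar_eq_zero_of_mem_span he h1 h3 h4 h5)
    have mw1 : w₁ ∈ Submodule.span F {a₀, b₀, c₀, d₀} := add_mem mx1 my1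
    have mw2 : w₂ ∈ Submodule.span F {a₀, b₀, c₀, d₀} :=
      add_mem (add_mem (Submodule.smul_mem _ _ mx1) mx2)
        (add_mem (Submodule.smul_mem _ _ my1) my2)
    have hgv : g v = v := by
      rw [hg, LinearEquiv.mul_apply, LinearEquiv.mul_apply, LinearEquiv.mul_apply, hf _ mw2,
        hf _ mw1, hf _ mx2, hf _ mx1]
    clear_value N
    clear hpow hN hneg
    induction N with
    | zero => rfl
    | succ n ih => rw [pow_succ, LinearEquiv.mul_apply, hgv, ih]
  rw [hpow]
  exact ⟨a₀, b₀, c₀, d₀, hq₀, hgz, hgz.unique hq₀ hz⟩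

end IsFrame

end Frames

/-! ### Enough admissible pairs of trace and norm -/

section Parameters

variable {F : Type*} [Field F] {k : ℕ}

/-- The pairs that parametrize the triples of `IsTriple`. -/
def params (k : ℕ) (ε : F) : Set (F × F) :=
  {r | (1 - ε * r.1 ^ 2) ^ k = 1 ∧ (1 - ε * r.2 ^ 2) ^ k = -1}

/-- The trace attached to a parameter pair. -/
def paramTrace (ε : F) (r : F × F) : F := 1 + ε * r.1 * r.2

/-- The norm attached to a parameter pair. -/
def paramNorm (ε : F) (r : F × F) : F := ε * ((r.1 + r.2) / 2) ^ 2

/-- Trace and norm determine AB and (A + B)², hence the pair A, B up to order and a common sign. The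
order is fixed because 1 - εA² and 1 - εB² have different quadratic characters. -/
theorem params_eq_or_eq_neg (h2 : (2 : F) ≠ 0) {ε : F} (hε : ε ≠ 0) {r r' : F × F}
    (hr : r ∈ params k ε) (hr' : r' ∈ params k ε) (hs : paramTrace ε r = paramTrace ε r')
    (hp : paramNorm ε r = paramNorm ε r') : r = r' ∨ r = -r' := by
  obtain ⟨A, B⟩ := r
  obtain ⟨C, D⟩ := r'
  obtain ⟨hA, -⟩ := hr
  obtain ⟨-, hD⟩ := hr'
  simp only [paramTrace, paramNorm] at hs hp hA hD
  have hne : A ^ 2 ≠ D ^ 2 := by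
    intro h
    rw [h, hD] at hA
    exact h2 (by linear_combination -hA)
  have h1 : A * B = C * D := mul_left_cancel₀ hε (by linear_combination hs)
  have h3 : (A + B) ^ 2 = (C + D) ^ 2 := by
    field_simp at hp
    exact hp
  rcases sq_eq_sq_iff_eq_or_eq_neg.mp h3 with h | h
  · left
    have : (A - C) * (A - D) = 0 := by linear_combination A * h - h1
    rcases mul_eq_zero.mp this with h4 | h4
    · have h5 : A = C := by linear_combination h4
      exact Prod.ext h5 (by simp only; linear_combination h - h5)
    · exact absurd (by linear_combination (A + D) * h4) hne
  · right
    have : (A + C) * (A + D) = 0 := by linear_combination A * h - h1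
    rcases mul_eq_zero.mp this with h4 | h4
    · exact Prod.ext (by simp only [Prod.fst_neg]; linear_combination h4)
        (by simp only [Prod.snd_neg]; linear_combination h - h4)
    · exact absurd (by linear_combination (A - D) * h4) hne

variable [Finite F]

/-- The parametrization is made so that p and 1 - s + p are ε times the squares of (A + B)/2 and (A
- B)/2, while the discriminant factors as (1 - εA²)(1 - εB²), a square times a non-square. -/
theorem isTriple_of_mem_params (hk : Nat.card F = 2 * k + 1) (h2 : (2 : F) ≠ 0) {ε : F}
    (hε : ε ^ k = -1) {r : F × F} (hr : r ∈ params k ε) :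
    IsTriple k (paramTrace ε r) (paramNorm ε r) := by
  obtain ⟨A, B⟩ := r
  obtain ⟨hA, hB⟩ := hr
  simp only at hA hB
  have hne : A ^ 2 ≠ B ^ 2 := by
    intro h
    rw [h, hB] at hA
    exact h2 (by linear_combination -hA)
  have hp : A + B ≠ 0 := fun h => hne (by linear_combination (A - B) * h)
  have hm : A - B ≠ 0 := fun h => hne (by linear_combination (A + B) * h)
  have e1 : 1 - paramTrace ε (A, B) + paramNorm ε (A, B) = ε * ((A - B) / 2) ^ 2 := by
    simp only [paramTrace, paramNorm]; field_simp; ring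
  have e2 : paramTrace ε (A, B) ^ 2 - 4 * paramNorm ε (A, B)
      = (1 - ε * A ^ 2) * (1 - ε * B ^ 2) := by
    simp only [paramTrace, paramNorm]; field_simp; ring
  refine ⟨?_, ?_, ?_⟩
  · rw [paramNorm, mul_pow, ← pow_mul, hε, pow_two_mul_eq_one hk (div_ne_zero hp h2), mul_one]
  · rw [e1, mul_pow, ← pow_mul, hε, pow_two_mul_eq_one hk (div_ne_zero hm h2), mul_one]
  · rw [e2, mul_pow, hA, hB, one_mul]

theorem le_ncard_conic (hodd : Odd (Nat.card F)) (h2 : (2 : F) ≠ 0) {α β γ : F} (hα : α ≠ 0)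
    (hβ : β ≠ 0) (hγ : γ ≠ 0) :
    Nat.card F - 1 ≤ {v : F × F | α * v.1 ^ 2 + β * v.2 ^ 2 = γ}.ncard := by
  set Q : QuadraticForm F (F × F) :=
    QuadraticMap.prod (α • QuadraticMap.sq) (β • QuadraticMap.sq) with hQ
  have hv : ∀ v : F × F, Q v = α * v.1 ^ 2 + β * v.2 ^ 2 := by
    intro v
    simp only [hQ, QuadraticMap.prod_apply, smul_apply, QuadraticMap.sq_apply,
      smul_eq_mul]
    ring
  have hS : NonSing Q (⊤ : Submodule F (F × F)) := by
    rintro ⟨x, y⟩ - h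
    have hx := h (1, 0) trivial
    have hy := h (0, 1) trivial
    simp only [polar, hv, Prod.fst_add, Prod.snd_add] at hx hy
    have hx' : α * 2 * x = 0 := by linear_combination hx
    have hy' : β * 2 * y = 0 := by linear_combination hy
    rw [Prod.mk_eq_zero]
    exact ⟨(mul_eq_zero.mp hx').resolve_left (mul_ne_zero hα h2),
      (mul_eq_zero.mp hy').resolve_left (mul_ne_zero hβ h2)⟩
  have hc : ((⊤ : Submodule F (F × F)) : Set (F × F)).ncard = Nat.card F ^ (0 + 2) := by
    rw [Submodule.top_coe, Set.ncard_univ, Nat.card_prod]; ring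
  have := le_ncard_quadric hodd h2 hS hc hγ
  rw [pow_zero, mul_one] at this
  refine this.trans (Set.ncard_le_ncard ?_)
  rintro v ⟨-, h⟩
  rwa [hv] at h

theorem ncard_sq_eq_le (x : F) : {y : F | y ^ 2 = x}.ncard ≤ 2 := by
  rcases Set.eq_empty_or_nonempty {y : F | y ^ 2 = x} with h | ⟨z, hz⟩
  · rw [h, Set.ncard_empty]; exact Nat.zero_le _
  · refine (Set.ncard_le_ncard (t := {z, -z}) ?_).trans
      ((Set.ncard_insert_le z {-z}).trans (by rw [Set.ncard_singleton]))
    intro y hy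
    exact sq_eq_sq_iff_eq_or_eq_neg.mp (Eq.trans hy (Eq.symm hz))

/-- The conic εA² + αx² = 1 has at least q - 1 = 2k points, and each A occurs for at most two x. No
point has x = 0, since ε would then be a square. -/
theorem le_ncard_param (hk : Nat.card F = 2 * k + 1) (h2 : (2 : F) ≠ 0) {ε α : F} (hε : ε ^ k = -1)
    (hα : α ≠ 0) : k ≤ {A : F | (1 - ε * A ^ 2) ^ k = α ^ k}.ncard := by
  have hε0 : ε ≠ 0 := by
    rintro rfl
    exact ne_sq_of_pow hk h2 hε (y := 0) (by ring)
  have h1 := le_ncard_conic (α := ε) (β := α) (γ := 1) (hk ▸ odd_two_mul_add_one k) h2 hε0 hα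
    one_ne_zero
  have h3 : {v : F × F | ε * v.1 ^ 2 + α * v.2 ^ 2 = 1} ⊆
      {v : F × F | v.1 ∈ {A : F | (1 - ε * A ^ 2) ^ k = α ^ k} ∧
        v.2 ∈ (fun A => {x : F | x ^ 2 = (1 - ε * A ^ 2) / α}) v.1} := by
    rintro ⟨A, x⟩ h
    have h : ε * A ^ 2 + α * x ^ 2 = 1 := h
    have hx : x ≠ 0 := by
      rintro rfl
      have hA : A ≠ 0 := by
        rintro rfl
        exact one_ne_zero (α := F) (by linear_combination -h)
      refine ne_sq_of_pow hk h2 hε (y := A⁻¹) ?_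
      field_simp
      linear_combination h
    have e : 1 - ε * A ^ 2 = α * x ^ 2 := by linear_combination -h
    refine ⟨?_, ?_⟩
    · change (1 - ε * A ^ 2) ^ k = α ^ k
      rw [e, mul_pow, ← pow_mul, pow_two_mul_eq_one hk hx, mul_one]
    · change x ^ 2 = (1 - ε * A ^ 2) / α
      rw [e]; field_simp
  have h4 := ncard_fibration_le {A : F | (1 - ε * A ^ 2) ^ k = α ^ k}
    (fun A => {x : F | x ^ 2 = (1 - ε * A ^ 2) / α}) (k := 2) fun A _ => ncard_sq_eq_le _
  have := h1.trans ((Set.ncard_le_ncard h3).trans h4)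
  omega

theorem le_ncard_params (hk : Nat.card F = 2 * k + 1) (h2 : (2 : F) ≠ 0) {ε : F}
    (hε : ε ^ k = -1) : k * k ≤ (params k ε).ncard := by
  have hε0 : ε ≠ 0 := by
    rintro rfl
    exact ne_sq_of_pow hk h2 hε (y := 0) (by ring)
  have h1 := le_ncard_param hk h2 hε one_ne_zero
  have h3 := le_ncard_param hk h2 hε hε0
  rw [one_pow] at h1
  rw [hε] at h3
  have : params k ε = {A : F | (1 - ε * A ^ 2) ^ k = 1} ×ˢ {A : F | (1 - ε * A ^ 2) ^ k = -1} := rfl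
  rw [this, Set.ncard_prod]
  exact Nat.mul_le_mul h1 h3

theorem exists_pow_eq_neg_one (hk : Nat.card F = 2 * k + 1) (h2 : (2 : F) ≠ 0) :
    ∃ ε : F, ε ^ k = -1 := by
  have := Fintype.ofFinite F
  have hchar : ringChar F ≠ 2 := fun h => by
    have := CharP.cast_eq_zero_iff F (ringChar F) 2
    exact h2 (by simpa using this.mpr (h ▸ dvd_rfl))
  obtain ⟨ε, hε⟩ := FiniteField.exists_nonsquare hchar
  have hk2 : Fintype.card F / 2 = k := by
    rw [← Nat.card_eq_fintype_card, hk]; omega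
  have hε0 : ε ≠ 0 := by
    rintro rfl
    exact hε (IsSquare.zero)
  refine ⟨ε, ?_⟩
  have h := FiniteField.pow_dichotomy hchar hε0
  rw [hk2] at h
  exact h.resolve_left fun h1 => hε ((FiniteField.isSquare_iff hchar hε0).mpr (hk2 ▸ h1))

end Parameters

/-! ### Recovering a frame from its second 4-space -/

section Fiber

variable {F V : Type*} [Field F] [AddCommGroup V] [Module F V] {Q : QuadraticForm F V}

/-- The discriminant of a hyperbolic 4-space is a square. -/
theorem exists_norm_prod_eq_sq (h2 : (2 : F) ≠ 0) {a b c d : V} (hq : IsHyperbolicQuadruple Q a b c d)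
    {e₁ e₂ e₃ e₄ : V}
    (m1 : e₁ ∈ Submodule.span F {a, b, c, d}) (m2 : e₂ ∈ Submodule.span F {a, b, c, d})
    (m3 : e₃ ∈ Submodule.span F {a, b, c, d}) (m4 : e₄ ∈ Submodule.span F {a, b, c, d})
    (h12 : polar Q e₁ e₂ = 0) (h13 : polar Q e₁ e₃ = 0) (h14 : polar Q e₁ e₄ = 0)
    (h23 : polar Q e₂ e₃ = 0) (h24 : polar Q e₂ e₄ = 0) (h34 : polar Q e₃ e₄ = 0) :
    ∃ y : F, Q e₁ * Q e₂ * Q e₃ * Q e₄ = y ^ 2 := by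
  -- The coordinates of the eᵢ in the basis a, b, c, d. The Gram matrix is `M` times the transpose
  -- of `M` with columns permuted by `σ`, an even permutation; so its determinant 16 ∏ Q(eᵢ) equals
  -- (det M)².
  set M : Matrix (Fin 4) (Fin 4) F :=
    .of fun i j => polar Q (![e₁, e₂, e₃, e₄] i) (![c, d, a, b] j) with hM
  set σ : Equiv.Perm (Fin 4) := Equiv.swap 0 2 * Equiv.swap 1 3 with hσ
  have key : ∀ {v w : V}, v ∈ Submodule.span F {a, b, c, d} → polar Q v w =
      polar Q v c * polar Q w a + polar Q v d * polar Q w b + polar Q v a * polar Q w c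
        + polar Q v b * polar Q w d := by
    intro v w hv
    conv_lhs => rw [← proj_eq_self_of_mem hq hv, proj_apply]
    simp only [QuadraticMap.polar_add_left, QuadraticMap.polar_smul_left, smul_eq_mul]
    rw [polar_comm Q a w, polar_comm Q b w, polar_comm Q c w, polar_comm Q d w]
  have hG : M * (M.submatrix id σ).transpose
      = Matrix.diagonal ![2 * Q e₁, 2 * Q e₂, 2 * Q e₃, 2 * Q e₄] := by
    have h21 := (polar_comm Q e₂ e₁).trans h12
    have h31 := (polar_comm Q e₃ e₁).trans h13
    have h41 := (polar_comm Q e₄ e₁).trans h14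
    have h32 := (polar_comm Q e₃ e₂).trans h23
    have h42 := (polar_comm Q e₄ e₂).trans h24
    have h43 := (polar_comm Q e₄ e₃).trans h34
    have n1 := polar_self_eq Q e₁
    have n2 := polar_self_eq Q e₂
    have n3 := polar_self_eq Q e₃
    have n4 := polar_self_eq Q e₄
    have s0 : σ 0 = 2 := by decide
    have s1 : σ 1 = 3 := by decide
    have s2 : σ 2 = 0 := by decide
    have s3 : σ 3 = 1 := by decide
    rw [key m1] at h12 h13 h14 n1
    rw [key m2] at h21 h23 h24 n2
    rw [key m3] at h31 h32 h34 n3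
    rw [key m4] at h41 h42 h43 n4
    ext i j
    fin_cases i <;> fin_cases j <;>
      simp [Matrix.mul_apply, Fin.sum_univ_four, hM, s0, s1, s2, s3, Matrix.diagonal] <;>
      assumption
  have hdet := congrArg Matrix.det hG
  have hsign : Equiv.Perm.sign σ = 1 := by decide
  rw [Matrix.det_mul, Matrix.det_transpose, Matrix.det_permute', hsign, Matrix.det_diagonal,
    Fin.prod_univ_four] at hdet
  simp at hdet
  have h4F : (4 : F) ≠ 0 := by
    rw [show (4 : F) = 2 * 2 by norm_num]; exact mul_ne_zero h2 h2
  refine ⟨M.det / 4, ?_⟩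
  field_simp
  linear_combination -hdet

end Fiber

section Fiber

variable {F V : Type*} [Field F] [AddCommGroup V] [Module F V] {Q : QuadraticForm F V}

/-- A vector of a hyperbolic 4-space is determined by its products with a spanning set. -/
theorem eq_of_polar_eq {a b c d w₁ w₂ w₃ w₄ v v' : V} (hq : IsHyperbolicQuadruple Q a b c d)
    (hW : Submodule.span F {w₁, w₂, w₃, w₄} = Submodule.span F {a, b, c, d})
    (hv : v ∈ Submodule.span F {a, b, c, d}) (hv' : v' ∈ Submodule.span F {a, b, c, d})
    (h1 : polar Q v w₁ = polar Q v' w₁) (h2 : polar Q v w₂ = polar Q v' w₂)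
    (h3 : polar Q v w₃ = polar Q v' w₃) (h4 : polar Q v w₄ = polar Q v' w₄) : v = v' := by
  rw [← sub_eq_zero]
  refine nonSing_span hq _ (sub_mem hv hv') fun y hy => ?_
  rw [← hW] at hy
  apply polar_eq_zero_of_mem_span hy <;> rw [QuadraticMap.polar_sub_left, sub_eq_zero] <;>
    assumption

/-- The composition of the orthogonal projections to two hyperbolic 4-spaces. -/
def compress (Q : QuadraticForm F V) (a b c d a' b' c' d' : V) : V →ₗ[F] V :=
  proj Q a' b' c' d' ∘ₗ proj Q a b c d

section

variable {a b c d a' b' c' d' : V} (hq : IsHyperbolicQuadruple Q a b c d)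
  (hq' : IsHyperbolicQuadruple Q a' b' c' d')

theorem compress_mem (a b c d a' b' c' d' v : V) :
    compress Q a b c d a' b' c' d' v ∈ Submodule.span F {a', b', c', d'} :=
  proj_mem_span _ _ _ _ _

include hq' in
theorem polar_compress {v w : V} (hw : w ∈ Submodule.span F {a', b', c', d'}) :
    polar Q (compress Q a b c d a' b' c' d' v) w = polar Q (proj Q a b c d v) w :=
  polar_proj_left hq' hw

include hq in
theorem polar_proj_comm (v w : V) :
    polar Q (proj Q a b c d v) w = polar Q (proj Q a b c d w) v := by
  rw [polar_comm, ← polar_proj_left hq (proj_mem_span a b c d v), polar_comm,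
    polar_proj_left hq (proj_mem_span a b c d w), polar_comm]

include hq hq' in
-- The compression is self-adjoint on W because both orthogonal projections are. Its eigenvectors
-- for distinct eigenvalues are therefore orthogonal.
theorem polar_compress_comm {v w : V} (hv : v ∈ Submodule.span F {a', b', c', d'})
    (hw : w ∈ Submodule.span F {a', b', c', d'}) :
    polar Q (compress Q a b c d a' b' c' d' v) w
      = polar Q v (compress Q a b c d a' b' c' d' w) := by
  rw [polar_compress hq' hw, polar_comm Q v, polar_compress hq' hv, polar_proj_comm hq]

end

theorem mem_span_of_frameSpace_eq {a' b' c' d' : V} {s p : F} {x₁ x₂ y₁ y₂ w₃ w₄ : V}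
    (hW : frameSpace s p x₁ x₂ y₁ y₂ w₃ w₄ = Submodule.span F {a', b', c', d'}) :
    frameFst x₁ y₁ ∈ Submodule.span F {a', b', c', d'} ∧
    frameSnd s p x₁ x₂ y₁ y₂ ∈ Submodule.span F {a', b', c', d'} ∧
    w₃ ∈ Submodule.span F {a', b', c', d'} ∧ w₄ ∈ Submodule.span F {a', b', c', d'} := by
  rw [← hW]
  exact mem_quadruple_span _ _ _ _

namespace IsFrame

variable {a b c d a' b' c' d' : V} {s p : F} {x₁ x₂ y₁ y₂ w₃ w₄ : V}
  (h : IsFrame Q a b c d s p x₁ x₂ y₁ y₂ w₃ w₄)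
include h

theorem proj_fst (hq : IsHyperbolicQuadruple Q a b c d) (h2 : (2 : F) ≠ 0) :
    proj Q a b c d (frameFst x₁ y₁) = x₁ := by
  rw [frameFst, map_add, proj_eq_self_of_mem hq h.mem_x₁, proj_quadPerp h2 h.mem_y₁, add_zero]

theorem proj_snd (hq : IsHyperbolicQuadruple Q a b c d) (h2 : (2 : F) ≠ 0) :
    proj Q a b c d (frameSnd s p x₁ x₂ y₁ y₂) = (1 + s + p) • x₁ + x₂ := by
  rw [frameSnd, map_add, map_add _ (_ • y₁), map_smul, proj_quadPerp h2 h.mem_y₁,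
    proj_quadPerp h2 h.mem_y₂,
    proj_eq_self_of_mem hq (add_mem (Submodule.smul_mem _ _ h.mem_x₁) h.mem_x₂)]
  module

section

variable (hq : IsHyperbolicQuadruple Q a b c d) (h2 : (2 : F) ≠ 0)
include hq h2

theorem polar_proj_fst (v : V) : polar Q (proj Q a b c d (frameFst x₁ y₁)) v = polar Q v x₁ := by
  rw [h.proj_fst hq h2, polar_comm]

theorem polar_proj_snd (v : V) : polar Q (proj Q a b c d (frameSnd s p x₁ x₂ y₁ y₂)) v
    = (1 + s + p) * polar Q v x₁ + polar Q v x₂ := by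
  rw [h.proj_snd hq h2, polar_comm, QuadraticMap.polar_add_right, QuadraticMap.polar_smul_right,
    smul_eq_mul]

theorem polar_basis : polar Q (frameFst x₁ y₁) x₁ = -2 ∧ polar Q (frameFst x₁ y₁) x₂ = 0 ∧
    polar Q (frameSnd s p x₁ x₂ y₁ y₂) x₁ = -2 * (1 + s + p) ∧
    polar Q (frameSnd s p x₁ x₂ y₁ y₂) x₂ = 2 * ((1 + s + p) * p) := by
  rw [← polar_proj_left hq h.mem_x₁ (v := frameFst x₁ y₁),
    ← polar_proj_left hq h.mem_x₂ (v := frameFst x₁ y₁),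
    ← polar_proj_left hq h.mem_x₁ (v := frameSnd s p x₁ x₂ y₁ y₂),
    ← polar_proj_left hq h.mem_x₂ (v := frameSnd s p x₁ x₂ y₁ y₂),
    h.proj_fst hq h2, h.proj_snd hq h2]
  refine ⟨?_, h.polar_x, ?_, ?_⟩ <;>
    simp only [QuadraticMap.polar_add_left, QuadraticMap.polar_smul_left, polar_self_eq, h.norm_x₁,
      h.norm_x₂, h.polar_x, polar_comm Q x₂ x₁, smul_eq_mul] <;>
    ring

variable (hq' : IsHyperbolicQuadruple Q a' b' c' d')
  (hW : frameSpace s p x₁ x₂ y₁ y₂ w₃ w₄ = Submodule.span F {a', b', c', d'})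
include hW hq'

/-- A vector of W is identified by its products with the frame basis, and those of a compression
reduce to products with the projections to U. With `compress_snd` this gives a matrix of trace s and
determinant p on the first two basis vectors. -/
theorem compress_fst : compress Q a b c d a' b' c' d' (frameFst x₁ y₁)
    = frameSnd s p x₁ x₂ y₁ y₂ - frameFst x₁ y₁ := by
  obtain ⟨m1, m2, m3, m4⟩ := mem_span_of_frameSpace_eq hW
  obtain ⟨p11, -, p21, -⟩ := h.polar_basis hq h2
  refine eq_of_polar_eq hq' hW (compress_mem _ _ _ _ _ _ _ _ _) (sub_mem m2 m1) ?_ ?_ ?_ ?_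
  · rw [polar_compress hq' m1, h.polar_proj_fst hq h2, p11, QuadraticMap.polar_sub_left,
      polar_self_eq, h.norm_fst h2, polar_comm, h.polar_fst_snd h2]
    ring
  · rw [polar_compress hq' m2, h.polar_proj_fst hq h2, p21, QuadraticMap.polar_sub_left,
      polar_self_eq, h.norm_snd h2, h.polar_fst_snd h2]
    ring
  · rw [polar_compress hq' m3, h.polar_proj_fst hq h2, h.polar_w₃x₁, QuadraticMap.polar_sub_left,
      polar_comm, h.polar_w₃_snd, polar_comm, h.polar_w₃_fst, sub_zero]
  · rw [polar_compress hq' m4, h.polar_proj_fst hq h2, h.polar_w₄x₁, QuadraticMap.polar_sub_left,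
      polar_comm, h.polar_w₄_snd, polar_comm, h.polar_w₄_fst, sub_zero]

theorem compress_snd : compress Q a b c d a' b' c' d' (frameSnd s p x₁ x₂ y₁ y₂)
    = (1 + s) • frameSnd s p x₁ x₂ y₁ y₂ - (1 + s + p) • frameFst x₁ y₁ := by
  obtain ⟨m1, m2, m3, m4⟩ := mem_span_of_frameSpace_eq hW
  obtain ⟨p11, p12, p21, p22⟩ := h.polar_basis hq h2
  refine eq_of_polar_eq hq' hW (compress_mem _ _ _ _ _ _ _ _ _)
    (sub_mem (Submodule.smul_mem _ _ m2) (Submodule.smul_mem _ _ m1)) ?_ ?_ ?_ ?_ <;>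
    rw [QuadraticMap.polar_sub_left, QuadraticMap.polar_smul_left, QuadraticMap.polar_smul_left]
  · rw [polar_compress hq' m1, h.polar_proj_snd hq h2, p11, p12,
      polar_self_eq, h.norm_fst h2, polar_comm, h.polar_fst_snd h2, smul_eq_mul, smul_eq_mul]
    ring
  · rw [polar_compress hq' m2, h.polar_proj_snd hq h2, p21, p22,
      polar_self_eq, h.norm_snd h2, h.polar_fst_snd h2, smul_eq_mul, smul_eq_mul]
    ring
  · rw [polar_compress hq' m3, h.polar_proj_snd hq h2, h.polar_w₃x₁, h.polar_w₃x₂,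
      polar_comm Q _ w₃, h.polar_w₃_snd, polar_comm Q _ w₃, h.polar_w₃_fst]
    simp
  · rw [polar_compress hq' m4, h.polar_proj_snd hq h2, h.polar_w₄x₁, h.polar_w₄x₂,
      polar_comm Q _ w₄, h.polar_w₄_snd, polar_comm Q _ w₄, h.polar_w₄_fst]
    simp

theorem compress_compress_fst :
    compress Q a b c d a' b' c' d' (compress Q a b c d a' b' c' d' (frameFst x₁ y₁))
      = s • compress Q a b c d a' b' c' d' (frameFst x₁ y₁) - p • frameFst x₁ y₁ := by
  rw [h.compress_fst hq h2 hq' hW, map_sub, h.compress_fst hq h2 hq' hW,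
    h.compress_snd hq h2 hq' hW]
  module

theorem compress_third : compress Q a b c d a' b' c' d' w₃ = (-Q (proj Q a b c d w₃)) • w₃ := by
  obtain ⟨m1, m2, m3, m4⟩ := mem_span_of_frameSpace_eq hW
  refine eq_of_polar_eq hq' hW (compress_mem _ _ _ _ _ _ _ _ _) (Submodule.smul_mem _ _ m3)
    ?_ ?_ ?_ ?_ <;> rw [QuadraticMap.polar_smul_left]
  · rw [polar_compress hq' m1, polar_proj_comm hq, h.polar_proj_fst hq h2, h.polar_w₃x₁,
      h.polar_w₃_fst, smul_zero]
  · rw [polar_compress hq' m2, polar_proj_comm hq, h.polar_proj_snd hq h2, h.polar_w₃x₁,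
      h.polar_w₃x₂, h.polar_w₃_snd, smul_zero, mul_zero, add_zero]
  · rw [polar_compress hq' m3, polar_comm, ← polar_proj_left hq (proj_mem_span _ _ _ _ _),
      polar_self_eq, polar_self_eq, h.norm_w₃, smul_eq_mul]
    ring
  · rw [polar_compress hq' m4, h.polar_proj, h.polar_w₃w₄, smul_zero]

theorem compress_fourth (hf : 1 + s + p ≠ 0) : compress Q a b c d a' b' c' d' w₄
    = (Q (proj Q a b c d w₄) / (1 + s + p)) • w₄ := by
  obtain ⟨m1, m2, m3, m4⟩ := mem_span_of_frameSpace_eq hW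
  refine eq_of_polar_eq hq' hW (compress_mem _ _ _ _ _ _ _ _ _) (Submodule.smul_mem _ _ m4)
    ?_ ?_ ?_ ?_ <;> rw [QuadraticMap.polar_smul_left]
  · rw [polar_compress hq' m1, polar_proj_comm hq, h.polar_proj_fst hq h2, h.polar_w₄x₁,
      h.polar_w₄_fst, smul_zero]
  · rw [polar_compress hq' m2, polar_proj_comm hq, h.polar_proj_snd hq h2, h.polar_w₄x₁,
      h.polar_w₄x₂, h.polar_w₄_snd, smul_zero, mul_zero, add_zero]
  · rw [polar_compress hq' m3, polar_proj_comm hq, h.polar_proj, polar_comm, h.polar_w₃w₄, smul_zero]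
  · rw [polar_compress hq' m4, polar_comm, ← polar_proj_left hq (proj_mem_span _ _ _ _ _),
      polar_self_eq, polar_self_eq, h.norm_w₄, smul_eq_mul]
    field_simp

end

/-- The eigenvalues of the compression on `w₃` and `w₄` differ. -/
theorem eigenvalue_ne [Finite F] (hq : IsHyperbolicQuadruple Q a b c d) {k : ℕ}
    (hk : Nat.card F = 2 * k + 1) (h2 : (2 : F) ≠ 0) (ht : IsTriple k s p) :
    -Q (proj Q a b c d w₃) ≠ Q (proj Q a b c d w₄) / (1 + s + p) := by
  intro he
  have hf := ht.f_ne_zero hk h2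
  rw [eq_div_iff hf] at he
  have hz : Q (proj Q a b c d w₃) ≠ 0 := by
    intro h0
    rcases h.norm_proj with hw | hw
    · exact hw h0
    · exact hw (by rw [← he, h0]; ring)
  have m3 := proj_mem_span (Q := Q) a b c d w₃
  have m4 := proj_mem_span (Q := Q) a b c d w₄
  have hx : ∀ {w x : V}, x ∈ Submodule.span F {a, b, c, d} → polar Q w x = 0 →
      polar Q x (proj Q a b c d w) = 0 := by
    intro w x hx hw
    rw [polar_comm, polar_proj_left hq hx, hw]
  -- With equal eigenvalues the vectors x₁, x₂ and the projections of w₃, w₄ would have norm product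
  -- (1 + s + p)²Q(proj w₃)² p. As four orthogonal vectors of U force a square, p would be a square.
  obtain ⟨y, hy⟩ := exists_norm_prod_eq_sq h2 hq h.mem_x₁ h.mem_x₂ m3 m4 h.polar_x
    (hx h.mem_x₁ h.polar_w₃x₁) (hx h.mem_x₁ h.polar_w₄x₁) (hx h.mem_x₂ h.polar_w₃x₂)
    (hx h.mem_x₂ h.polar_w₄x₂)
    (by rw [polar_comm, polar_proj_left hq m3, polar_comm]; exact h.polar_proj)
  rw [h.norm_x₁, h.norm_x₂, ← he] at hy
  refine ne_sq_of_pow hk h2 ht.const (y := y / ((1 + s + p) * Q (proj Q a b c d w₃))) ?_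
  field_simp
  linear_combination hy

end IsFrame

end Fiber

section Fiber

variable {F V : Type*} [Field F] [AddCommGroup V] [Module F V] {Q : QuadraticForm F V}

namespace IsFrame

section

variable {a b c d a' b' c' d' : V} {s p : F} {x₁ x₂ y₁ y₂ w₃ w₄ : V}
  (h : IsFrame Q a b c d s p x₁ x₂ y₁ y₂ w₃ w₄)
  (hq : IsHyperbolicQuadruple Q a b c d) (hq' : IsHyperbolicQuadruple Q a' b' c' d')
  (hW : frameSpace s p x₁ x₂ y₁ y₂ w₃ w₄ = Submodule.span F {a', b', c', d'})
  (h2 : (2 : F) ≠ 0)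
include h hq' hq hW h2

/-- Eigenvectors of the compression in the base field are orthogonal to the first two vectors. -/
theorem polar_eigenvector [Finite F] {k : ℕ} (hk : Nat.card F = 2 * k + 1) (ht : IsTriple k s p)
    {v : V} (hv : v ∈ Submodule.span F {a', b', c', d'}) {t : F}
    (hvt : compress Q a b c d a' b' c' d' v = t • v) :
    polar Q (frameFst x₁ y₁) v = 0 ∧ polar Q (frameSnd s p x₁ x₂ y₁ y₂) v = 0 := by
  obtain ⟨m1, m2, -, -⟩ := mem_span_of_frameSpace_eq hW
  have e1 : ∀ {w : V}, w ∈ Submodule.span F {a', b', c', d'} →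
      polar Q (compress Q a b c d a' b' c' d' w) v = t * polar Q w v := by
    intro w hw
    rw [polar_compress_comm hq hq' hw hv, hvt, QuadraticMap.polar_smul_right, smul_eq_mul]
  have e2 := e1 (compress_mem (Q := Q) a b c d a' b' c' d' (frameFst x₁ y₁))
  rw [h.compress_compress_fst hq h2 hq' hW, QuadraticMap.polar_sub_left,
    QuadraticMap.polar_smul_left, QuadraticMap.polar_smul_left, e1 m1, smul_eq_mul,
    smul_eq_mul] at e2
  -- Pairing the quadratic relation for the first vector with `v` yields the factor t² - st + p,
  -- which has no zero in F.
  have e3 : polar Q (frameFst x₁ y₁) v = 0 := by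
    refine (mul_eq_zero.mp ?_).resolve_left (ht.eval_ne_zero hk h2 t)
    linear_combination -e2
  have e4 := e1 m1
  rw [h.compress_fst hq h2 hq' hW, QuadraticMap.polar_sub_left, e3] at e4
  exact ⟨e3, by linear_combination e4⟩

/-- An eigenvector of the compression is a multiple of `w₃` or of `w₄`. -/
theorem eq_smul_of_eigenvector [Finite F] {k : ℕ} (hk : Nat.card F = 2 * k + 1)
    (ht : IsTriple k s p) {v : V} (hv : v ∈ Submodule.span F {a', b', c', d'}) {t : F}
    (hvt : compress Q a b c d a' b' c' d' v = t • v) : ∃ r : F, v = r • w₃ ∨ v = r • w₄ := by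
  obtain ⟨m1, m2, m3, m4⟩ := mem_span_of_frameSpace_eq hW
  have hf := ht.f_ne_zero hk h2
  obtain ⟨v1, v2⟩ := h.polar_eigenvector hq hq' hW h2 hk ht hv hvt
  have e3 := polar_compress_comm hq hq' hv m3
  have e4 := polar_compress_comm hq hq' hv m4
  rw [hvt, h.compress_third hq h2 hq' hW, QuadraticMap.polar_smul_left,
    QuadraticMap.polar_smul_right, smul_eq_mul, smul_eq_mul] at e3
  rw [hvt, h.compress_fourth hq h2 hq' hW hf, QuadraticMap.polar_smul_left,
    QuadraticMap.polar_smul_right, smul_eq_mul, smul_eq_mul] at e4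
  have hne := h.eigenvalue_ne hq hk h2 ht
  -- Otherwise t would equal both eigenvalues, which differ.
  have hor : polar Q v w₃ = 0 ∨ polar Q v w₄ = 0 := by
    by_contra! hc
    exact hne ((mul_right_cancel₀ hc.1 e3).symm.trans (mul_right_cancel₀ hc.2 e4))
  rcases hor with h0 | h0
  · refine ⟨polar Q v w₄ / (2 * (1 + s + p)), Or.inr ?_⟩
    refine eq_of_polar_eq hq' hW hv (Submodule.smul_mem _ _ m4) ?_ ?_ ?_ ?_ <;>
      rw [QuadraticMap.polar_smul_left]
    · rw [polar_comm, v1, h.polar_w₄_fst, smul_zero]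
    · rw [polar_comm, v2, h.polar_w₄_snd, smul_zero]
    · rw [h0, polar_comm Q w₄ w₃, h.polar_w₃w₄, smul_zero]
    · rw [polar_self_eq, h.norm_w₄, smul_eq_mul]; field_simp
  · refine ⟨polar Q v w₃ / (-2), Or.inl ?_⟩
    refine eq_of_polar_eq hq' hW hv (Submodule.smul_mem _ _ m3) ?_ ?_ ?_ ?_ <;>
      rw [QuadraticMap.polar_smul_left]
    · rw [polar_comm, v1, h.polar_w₃_fst, smul_zero]
    · rw [polar_comm, v2, h.polar_w₃_snd, smul_zero]
    · rw [polar_self_eq, h.norm_w₃, smul_eq_mul]; field_simp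
    · rw [h0, h.polar_w₃w₄, smul_zero]

end

section

variable {a b c d a' b' c' d' : V} {s p s' p' : F} {x₁ x₂ y₁ y₂ w₃ w₄ x₁' x₂' y₁' y₂' w₃' w₄' : V}
  (h : IsFrame Q a b c d s p x₁ x₂ y₁ y₂ w₃ w₄)
  (h' : IsFrame Q a b c d s' p' x₁' x₂' y₁' y₂' w₃' w₄')
  (hq : IsHyperbolicQuadruple Q a b c d) (hq' : IsHyperbolicQuadruple Q a' b' c' d')
  (hW : frameSpace s p x₁ x₂ y₁ y₂ w₃ w₄ = Submodule.span F {a', b', c', d'})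
  (hW' : frameSpace s' p' x₁' x₂' y₁' y₂' w₃' w₄' = Submodule.span F {a', b', c', d'})
  (h2 : (2 : F) ≠ 0)
include h h' hq' hW' hq hW h2

/-- The first vector of a frame is determined up to sign by the spaces of the frame. -/
theorem fst_eq_or_eq_neg [Finite F] {k : ℕ} (hk : Nat.card F = 2 * k + 1) (ht : IsTriple k s p)
    (ht' : IsTriple k s' p') :
    frameFst x₁' y₁' = frameFst x₁ y₁ ∨ frameFst x₁' y₁' = -frameFst x₁ y₁ := by
  obtain ⟨m1, m2, m3, m4⟩ := mem_span_of_frameSpace_eq hW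
  obtain ⟨m1', -, -, -⟩ := mem_span_of_frameSpace_eq hW'
  have hf := ht.f_ne_zero hk h2
  have v3 := (h'.polar_eigenvector hq hq' hW' h2 hk ht' m3 (h.compress_third hq h2 hq' hW)).1
  have v4 := (h'.polar_eigenvector hq hq' hW' h2 hk ht' m4 (h.compress_fourth hq h2 hq' hW hf)).1
  obtain ⟨c₁, c₂, hv⟩ : ∃ c₁ c₂ : F,
      frameFst x₁' y₁' = c₁ • frameFst x₁ y₁ + c₂ • frameSnd s p x₁ x₂ y₁ y₂ := by
    refine ⟨polar Q (frameFst x₁' y₁') (frameFst x₁ y₁) / 2,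
      polar Q (frameFst x₁' y₁') (frameSnd s p x₁ x₂ y₁ y₂) / (-2 * (1 + s + p)), ?_⟩
    refine eq_of_polar_eq hq' hW m1' (add_mem (Submodule.smul_mem _ _ m1)
      (Submodule.smul_mem _ _ m2)) ?_ ?_ ?_ ?_ <;>
      rw [QuadraticMap.polar_add_left, QuadraticMap.polar_smul_left, QuadraticMap.polar_smul_left]
    · rw [polar_self_eq, h.norm_fst h2, polar_comm Q (frameSnd s p x₁ x₂ y₁ y₂),
        h.polar_fst_snd h2, smul_eq_mul, smul_eq_mul]
      field_simp
      ring
    · rw [polar_self_eq, h.norm_snd h2, h.polar_fst_snd h2, smul_eq_mul, smul_eq_mul]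
      field_simp
      ring
    · rw [v3, polar_comm Q _ w₃, h.polar_w₃_fst, polar_comm Q _ w₃, h.polar_w₃_snd]; simp
    · rw [v4, polar_comm Q _ w₄, h.polar_w₄_fst, polar_comm Q _ w₄, h.polar_w₄_snd]; simp
  have hn := h'.norm_fst h2
  rw [hv, map_add_eq, map_smul_eq, map_smul_eq, QuadraticMap.polar_smul_left,
    QuadraticMap.polar_smul_right, h.polar_fst_snd h2, h.norm_fst h2, h.norm_snd h2] at hn
  have hb := (h'.polar_proj_fst hq h2 (frameFst x₁' y₁')).trans (h'.polar_basis hq h2).1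
  obtain ⟨p11, p12, p21, p22⟩ := h.polar_basis hq h2
  rw [hv, map_add, map_smul, map_smul] at hb
  simp only [QuadraticMap.polar_add_left, QuadraticMap.polar_add_right,
    QuadraticMap.polar_smul_left, QuadraticMap.polar_smul_right, h.polar_proj_fst hq h2,
    h.polar_proj_snd hq h2, p11, p12, p21, p22, smul_eq_mul] at hb hn
  -- The first vector of a frame has norm 1 while its projection to U has norm -1; adding the two
  -- conditions gives this equation. If c₂ ≠ 0, eliminating c₁ turns s² - 4p into (2/c₂)², against
  -- the choice of a non-square discriminant.
  have hz : (1 + s + p) * c₂ * (2 * c₁ + (2 + s) * c₂) = 0 := by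
    have : 2 * ((1 + s + p) * c₂ * (2 * c₁ + (2 + s) * c₂)) = 0 := by
      linear_combination -hb - 2 * hn
    exact (mul_eq_zero.mp this).resolve_left h2
  have hc₂ : c₂ = 0 := by
    by_contra hc
    have h0 := (mul_eq_zero.mp hz).resolve_left (mul_ne_zero hf hc)
    refine ne_sq_of_pow hk h2 ht.disc (y := 2 / c₂) ?_
    field_simp
    linear_combination 4 * hn - (2 * c₁ - (2 + s) * c₂) * h0
  rw [hc₂] at hn
  have hc₁ : c₁ ^ 2 = 1 := by linear_combination hn
  rw [hv, hc₂]
  rcases sq_eq_one_iff.mp hc₁ with rfl | rfl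
  · left; module
  · right; module

/-- The parameters of a frame are determined by the spaces of the frame. -/
theorem trace_norm_eq [Finite F] {k : ℕ} (hk : Nat.card F = 2 * k + 1) (ht : IsTriple k s p)
    (ht' : IsTriple k s' p') : s = s' ∧ p = p' := by
  have hf := ht.f_ne_zero hk h2
  have e := h.compress_compress_fst hq h2 hq' hW
  have e' : compress Q a b c d a' b' c' d' (compress Q a b c d a' b' c' d' (frameFst x₁ y₁))
      = s' • compress Q a b c d a' b' c' d' (frameFst x₁ y₁) - p' • frameFst x₁ y₁ := by
    have e1 := h'.compress_compress_fst hq h2 hq' hW'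
    rcases h.fst_eq_or_eq_neg h' hq hq' hW hW' h2 hk ht ht' with h0 | h0
    · rwa [h0] at e1
    · rw [h0] at e1
      simp only [map_neg] at e1
      linear_combination (norm := module) -e1
  have e3 : (s - s') • compress Q a b c d a' b' c' d' (frameFst x₁ y₁)
      = (p - p') • frameFst x₁ y₁ := by
    linear_combination (norm := module) e' - e
  have e4 := congrArg (fun v => polar Q v (frameSnd s p x₁ x₂ y₁ y₂)) e3
  simp only [QuadraticMap.polar_smul_left, h.compress_fst hq h2 hq' hW, h.polar_fst_snd h2,
    QuadraticMap.polar_sub_left, polar_self_eq, h.norm_snd h2, smul_eq_mul] at e4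
  have hs : s - s' = 0 := by
    refine (mul_eq_zero.mp ?_).resolve_right (mul_ne_zero h2 hf)
    linear_combination -e4
  rw [hs, zero_smul] at e3
  have e5 := congrArg (fun v => polar Q v (frameFst x₁ y₁)) e3
  simp only [QuadraticMap.polar_smul_left, polar_self_eq, h.norm_fst h2, smul_eq_mul,
    QuadraticMap.polar_zero_left] at e5
  refine ⟨sub_eq_zero.mp hs, sub_eq_zero.mp ((mul_eq_zero.mp ?_).resolve_right h2)⟩
  linear_combination -e5

end

/-- The vectors `x₁, x₂, y₁, y₂` are determined by the first vector of a frame and its spaces. -/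
theorem eq_of_fst_eq {a b c d a' b' c' d' : V} {s p : F}
    {x₁ x₂ y₁ y₂ w₃ w₄ x₁' x₂' y₁' y₂' w₃' w₄' : V}
    (h : IsFrame Q a b c d s p x₁ x₂ y₁ y₂ w₃ w₄)
    (h' : IsFrame Q a b c d s p x₁' x₂' y₁' y₂' w₃' w₄')
    (hq : IsHyperbolicQuadruple Q a b c d) (hq' : IsHyperbolicQuadruple Q a' b' c' d')
    (hW : frameSpace s p x₁ x₂ y₁ y₂ w₃ w₄ = Submodule.span F {a', b', c', d'})
    (hW' : frameSpace s p x₁' x₂' y₁' y₂' w₃' w₄' = Submodule.span F {a', b', c', d'})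
    (h2 : (2 : F) ≠ 0) (he : frameFst x₁ y₁ = frameFst x₁' y₁') :
    x₁ = x₁' ∧ x₂ = x₂' ∧ y₁ = y₁' ∧ y₂ = y₂' := by
  have hx : x₁ = x₁' := by
    rw [← h.proj_fst hq h2, he, h'.proj_fst hq h2]
  have hsnd : frameSnd s p x₁ x₂ y₁ y₂ = frameSnd s p x₁' x₂' y₁' y₂' := by
    have e := h.compress_fst hq h2 hq' hW
    rw [he, h'.compress_fst hq h2 hq' hW'] at e
    exact (sub_left_inj.mp e).symm
  have hy : y₁ = y₁' := by
    rw [hx] at he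
    exact add_left_cancel he
  have hx₂ : x₂ = x₂' := by
    have e := h.proj_snd hq h2
    rw [hsnd, h'.proj_snd hq h2, hx] at e
    exact (add_left_cancel e).symm
  refine ⟨hx, hx₂, hy, ?_⟩
  rw [frameSnd, frameSnd, hx, hy, hx₂] at hsnd
  exact add_left_cancel (add_left_cancel hsnd)

end IsFrame

/-- The tuples consisting of a parameter pair and a frame with these parameters. -/
def frames (Q : QuadraticForm F V) (a b c d : V) (k : ℕ) (ε : F) :
    Set ((F × F) × (V × V) × (V × V) × (V × V)) :=
  {θ | θ.1 ∈ params k ε ∧ IsFrame Q a b c d (paramTrace ε θ.1) (paramNorm ε θ.1) θ.2.1.1 θ.2.1.2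
    θ.2.2.1.1 θ.2.2.1.2 θ.2.2.2.1 θ.2.2.2.2}

/-- The second 4-space of the frame in a tuple. -/
def tupleSpace (ε : F) (θ : (F × F) × (V × V) × (V × V) × (V × V)) : Submodule F V :=
  frameSpace (paramTrace ε θ.1) (paramNorm ε θ.1) θ.2.1.1 θ.2.1.2 θ.2.2.1.1 θ.2.2.1.2 θ.2.2.2.1
    θ.2.2.2.2

theorem ncard_multiples_le [Finite F] [Finite V] {u v : V} (hu : Q u ≠ 0)
    (hv : Q v ≠ 0) (t : F) :
    {w | (∃ r : F, w = r • u ∨ w = r • v) ∧ Q w = t}.ncard ≤ 4 := by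
  have key : ∀ {u : V}, Q u ≠ 0 → ((fun r : F => r • u) '' {r | r ^ 2 = t / Q u}).ncard ≤ 2 :=
    fun hu => (Set.ncard_image_le).trans (ncard_sq_eq_le _)
  refine (Set.ncard_le_ncard (t := (fun r : F => r • u) '' {r | r ^ 2 = t / Q u} ∪
    (fun r : F => r • v) '' {r | r ^ 2 = t / Q v}) ?_).trans ((Set.ncard_union_le _ _).trans
      (Nat.add_le_add (key hu) (key hv)))
  rintro w ⟨⟨r, rfl | rfl⟩, hw⟩
  · refine Or.inl ⟨r, ?_, rfl⟩
    rw [map_smul_eq] at hw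
    exact (eq_div_iff hu).mpr hw
  · refine Or.inr ⟨r, ?_, rfl⟩
    rw [map_smul_eq] at hw
    exact (eq_div_iff hv).mpr hw

/-- At most 64 frames have the same second 4-space. -/
theorem ncard_frames_fiber_le [Finite F] [Finite V] {k : ℕ} (hk : Nat.card F = 2 * k + 1)
    (h2 : (2 : F) ≠ 0) {ε : F} (hε : ε ^ k = -1) {a b c d : V}
    (hq : IsHyperbolicQuadruple Q a b c d) (W : Submodule F V) :
    {θ | θ ∈ frames Q a b c d k ε ∧ tupleSpace ε θ = W}.ncard ≤ 64 := by
  rcases Set.eq_empty_or_nonempty {θ | θ ∈ frames Q a b c d k ε ∧ tupleSpace ε θ = W} with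
    h0 | ⟨θ₀, ⟨hp₀, h₀⟩, hW₀⟩
  · rw [h0, Set.ncard_empty]; exact Nat.zero_le _
  have hε0 : ε ≠ 0 := by
    rintro rfl
    exact ne_sq_of_pow hk h2 hε (y := 0) (by ring)
  have ht₀ := isTriple_of_mem_params hk h2 hε hp₀
  obtain ⟨a', b', c', d', hq', hs⟩ := h₀.exists_quadruple h2 (ht₀.f_ne_zero hk h2)
  have hW : W = Submodule.span F {a', b', c', d'} := hW₀.symm.trans hs
  obtain ⟨r₀, ⟨x₁, x₂⟩, ⟨y₁, y₂⟩, ⟨w₃, w₄⟩⟩ := θ₀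
  simp only at hp₀ h₀ ht₀ hs
  have n3 : Q w₃ ≠ 0 := by rw [h₀.norm_w₃]; exact neg_ne_zero.mpr one_ne_zero
  have n4 : Q w₄ ≠ 0 := by rw [h₀.norm_w₄]; exact ht₀.f_ne_zero hk h2
  set T : F → Set V := fun t => {w | (∃ r : F, w = r • w₃ ∨ w = r • w₄) ∧ Q w = t} with hT
  -- Two parameter pairs, two signs of the first vector, and at most four choices each for w₃ and w₄
  -- among the multiples of the two eigenvectors: 2 · 2 · 4 · 4 = 64. These data determine the frame
  -- by `eq_of_fst_eq`.
  set P : Set ((F × F) × V × V × V) := {r₀, -r₀} ×ˢ ({frameFst x₁ y₁, -frameFst x₁ y₁} ×ˢ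
    (T (-1) ×ˢ T (1 + paramTrace ε r₀ + paramNorm ε r₀))) with hP
  have hPc : P.ncard ≤ 64 := by
    have pair : ∀ {α : Type _} (x y : α), ({x, y} : Set α).ncard ≤ 2 := fun x y =>
      (Set.ncard_insert_le x {y}).trans (by rw [Set.ncard_singleton])
    rw [hP, Set.ncard_prod, Set.ncard_prod, Set.ncard_prod]
    calc _ ≤ 2 * (({frameFst x₁ y₁, -frameFst x₁ y₁} : Set V).ncard * (4 * 4)) :=
          Nat.mul_le_mul (pair _ _) (Nat.mul_le_mul le_rfl (Nat.mul_le_mul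
            (ncard_multiples_le n3 n4 _) (ncard_multiples_le n3 n4 _)))
      _ ≤ 2 * (2 * (4 * 4)) := Nat.mul_le_mul le_rfl (Nat.mul_le_mul ((Set.ncard_insert_le _ _).trans
        (by rw [Set.ncard_singleton])) le_rfl)
      _ = 64 := by norm_num
  refine (Set.ncard_le_ncard_of_injOn
    (fun θ => (θ.1, frameFst θ.2.1.1 θ.2.2.1.1, θ.2.2.2.1, θ.2.2.2.2)) (t := P) ?_ ?_).trans hPc
  · rintro ⟨r, ⟨x₁', x₂'⟩, ⟨y₁', y₂'⟩, ⟨w₃', w₄'⟩⟩ ⟨⟨hp, h⟩, hW'⟩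
    have ht := isTriple_of_mem_params hk h2 hε hp
    simp only at hp h ht
    have hs' := hW'.trans hW
    simp only [tupleSpace] at hs'
    obtain ⟨-, -, m3, m4⟩ := mem_span_of_frameSpace_eq hs'
    obtain ⟨es, ep⟩ := h₀.trace_norm_eq h hq hq' hs hs' h2 hk ht₀ ht
    have hf := ht.f_ne_zero hk h2
    refine ⟨params_eq_or_eq_neg h2 hε0 hp hp₀ es.symm ep.symm,
      h₀.fst_eq_or_eq_neg h hq hq' hs hs' h2 hk ht₀ ht, ⟨?_, h.norm_w₃⟩, ⟨?_, ?_⟩⟩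
    · exact h₀.eq_smul_of_eigenvector hq hq' hs h2 hk ht₀ m3 (h.compress_third hq h2 hq' hs')
    · exact h₀.eq_smul_of_eigenvector hq hq' hs h2 hk ht₀ m4 (h.compress_fourth hq h2 hq' hs' hf)
    · rw [es, ep]; exact h.norm_w₄
  · rintro ⟨r, ⟨x₁', x₂'⟩, ⟨y₁', y₂'⟩, ⟨w₃', w₄'⟩⟩ ⟨⟨hp, h⟩, hW'⟩
      ⟨r', ⟨x₁'', x₂''⟩, ⟨y₁'', y₂''⟩, ⟨w₃'', w₄''⟩⟩ ⟨⟨hp'', h''⟩, hW''⟩ he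
    simp only [Prod.mk.injEq] at he
    obtain ⟨rfl, hfst, rfl, rfl⟩ := he
    obtain ⟨rfl, rfl, rfl, rfl⟩ := h.eq_of_fst_eq h'' hq hq' (hW'.trans hW) (hW''.trans hW) h2 hfst
    rfl

end Fiber

/-! ### Lower bounds for frames and for the quadruples they span -/

section Count

variable {F V : Type*} [Field F] [AddCommGroup V] [Module F V] {Q : QuadraticForm F V}

/-- The vectors of `S` orthogonal to all vectors of a list. -/
def perps (Q : QuadraticForm F V) (S : Submodule F V) : List V → Submodule F V
  | [] => S
  | e :: l => perps Q (perp Q S e) l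

theorem mem_perps {l : List V} {S : Submodule F V} {v : V} :
    v ∈ perps Q S l ↔ v ∈ S ∧ ∀ e ∈ l, polar Q v e = 0 := by
  induction l generalizing S with
  | nil => simp [perps]
  | cons e l ih => rw [perps, ih, mem_perp, List.forall_mem_cons, and_assoc]

theorem nonSing_perps [Finite F] [Finite V] (h2 : (2 : F) ≠ 0) {l : List V} {S : Submodule F V}
    (hS : NonSing Q S) (hl : ∀ e ∈ l, e ∈ S ∧ Q e ≠ 0) (hp : l.Pairwise fun e e' => polar Q e e' = 0)
    {d : ℕ} (hd : (S : Set V).ncard = Nat.card F ^ (d + l.length)) :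
    NonSing Q (perps Q S l) ∧ (perps Q S l : Set V).ncard = Nat.card F ^ d := by
  induction l generalizing S with
  | nil => exact ⟨hS, hd⟩
  | cons e l ih =>
    obtain ⟨⟨heS, he0⟩, hl'⟩ := List.forall_mem_cons.mp hl
    obtain ⟨hpe, hp'⟩ := List.pairwise_cons.mp hp
    refine ih (hS.perp h2 heS he0) (fun e' he' => ⟨mem_perp.mpr ⟨(hl' e' he').1, ?_⟩,
      (hl' e' he').2⟩) hp' (ncard_perp h2 heS he0 (by rw [hd, List.length_cons]; rfl))
    rw [polar_comm]
    exact hpe e' he'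

theorem le_ncard_perps_quadric [Finite F] [Finite V] (hodd : Odd (Nat.card F)) (h2 : (2 : F) ≠ 0)
    {l : List V} {S : Submodule F V} (hS : NonSing Q S) (hl : ∀ e ∈ l, e ∈ S ∧ Q e ≠ 0)
    (hp : l.Pairwise fun e e' => polar Q e e' = 0) {d : ℕ}
    (hd : (S : Set V).ncard = Nat.card F ^ (d + 2 + l.length)) {t : F} (ht : t ≠ 0) :
    (Nat.card F - 1) * Nat.card F ^ d ≤ {v | v ∈ perps Q S l ∧ Q v = t}.ncard :=
  le_ncard_quadric hodd h2 (nonSing_perps h2 hS hl hp hd).1 (nonSing_perps h2 hS hl hp hd).2 ht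

/-- The admissible pairs `(x₁, x₂)` of a frame. -/
def frameX (Q : QuadraticForm F V) (a b c d : V) (s p : F) : Set (V × V) :=
  {x | x.1 ∈ {v | v ∈ Submodule.span F {a, b, c, d} ∧ Q v = -1} ∧
    x.2 ∈ {v | v ∈ perps Q (Submodule.span F {a, b, c, d}) [x.1] ∧ Q v = (1 + s + p) * p}}

/-- The admissible pairs `(y₁, y₂)` of a frame. -/
def frameY (Q : QuadraticForm F V) (a b c d : V) (s p : F) : Set (V × V) :=
  {y | y.1 ∈ {v | v ∈ quadPerp Q a b c d ∧ Q v = 2} ∧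
    y.2 ∈ {v | v ∈ perps Q (quadPerp Q a b c d) [y.1] ∧
      Q v = -((1 + s + p) / 2) * (1 - s + p)}}

variable [Finite F] [Finite V]

/-- Each of the q - 2 admissible norms is taken by at least q - 1 vectors of the plane. Excluding 0
makes the projection of w₃ non-singular; excluding -1 leaves a non-zero norm for its other
component. -/
theorem le_ncard_norm_ne (hodd : Odd (Nat.card F)) (h2 : (2 : F) ≠ 0) {S : Submodule F V}
    (hS : NonSing Q S) (hd : (S : Set V).ncard = Nat.card F ^ 2) :
    (Nat.card F - 2) * (Nat.card F - 1) ≤ {v | v ∈ S ∧ Q v ≠ 0 ∧ Q v ≠ -1}.ncard := by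
  have h1 := mul_le_ncard_fibration ({0, -1}ᶜ : Set F) (fun t => {v | v ∈ S ∧ Q v = t})
    (k := Nat.card F - 1) fun t ht => by
      have h0 : t ≠ 0 := fun h => ht (Or.inl h)
      have := le_ncard_quadric (d := 0) hodd h2 hS hd h0
      rwa [pow_zero, mul_one] at this
  have h3 : Nat.card F - 2 ≤ ({0, -1}ᶜ : Set F).ncard := by
    rw [Set.ncard_compl]
    refine Nat.sub_le_sub_left ((Set.ncard_insert_le _ _).trans (by rw [Set.ncard_singleton])) _
  refine (Nat.mul_le_mul_right _ h3).trans (h1.trans ?_)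
  refine Set.ncard_le_ncard_of_injOn Prod.snd ?_ ?_
  · rintro ⟨t, v⟩ ⟨ht, hv, hvt⟩
    have hvt : Q v = t := hvt
    subst hvt
    exact ⟨hv, fun h => ht (Or.inl h), fun h => ht (Or.inr h)⟩
  · rintro ⟨t, v⟩ ⟨-, -, ht⟩ ⟨t', v'⟩ ⟨-, -, ht'⟩ rfl
    exact Prod.ext (Eq.trans (Eq.symm ht) ht') rfl

section

variable {a b c d : V} (hq : IsHyperbolicQuadruple Q a b c d) (hQ : Q.polarBilin.Nondegenerate)
  (hodd : Odd (Nat.card F)) (h2 : (2 : F) ≠ 0) {n : ℕ} (hm : Nat.card V = Nat.card F ^ (n + 7))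
  {s p : F}
include hq hodd h2

theorem le_ncard_frameX (hf : 1 + s + p ≠ 0) (hp : p ≠ 0) :
    ((Nat.card F - 1) * Nat.card F ^ 2) * ((Nat.card F - 1) * Nat.card F) ≤
      (frameX Q a b c d s p).ncard := by
  have hS : NonSing Q (Submodule.span F {a, b, c, d}) := nonSing_span hq
  have hc := ncard_span hq h2
  have h1 := le_ncard_quadric (d := 2) hodd h2 hS hc (neg_ne_zero.mpr one_ne_zero)
  refine (Nat.mul_le_mul_right _ h1).trans (mul_le_ncard_fibration
    {v | v ∈ Submodule.span F {a, b, c, d} ∧ Q v = -1}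
    (fun x => {v | v ∈ perps Q (Submodule.span F {a, b, c, d}) [x] ∧ Q v = (1 + s + p) * p}) ?_)
  rintro x ⟨hx, hx1⟩
  have := le_ncard_perps_quadric (l := [x]) (d := 1) hodd h2 hS
    (by simpa [hx1] using hx) (List.pairwise_singleton _ _) hc (mul_ne_zero hf hp)
  rwa [pow_one] at this

include hQ hm

theorem le_ncard_frameY (hf : 1 + s + p ≠ 0) (h1 : 1 - s + p ≠ 0) :
    ((Nat.card F - 1) * Nat.card F ^ (n + 1)) * ((Nat.card F - 1) * Nat.card F ^ n) ≤
      (frameY Q a b c d s p).ncard := by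
  have hS : NonSing Q (quadPerp Q a b c d) := nonSing_quadPerp hq h2 hQ
  have hc : (quadPerp Q a b c d : Set V).ncard = Nat.card F ^ (n + 3) := ncard_quadPerp hq h2 hm
  have h3 := le_ncard_quadric (d := n + 1) hodd h2 hS hc h2
  refine (Nat.mul_le_mul_right _ h3).trans (mul_le_ncard_fibration
    {v | v ∈ quadPerp Q a b c d ∧ Q v = 2}
    (fun y => {v | v ∈ perps Q (quadPerp Q a b c d) [y] ∧
      Q v = -((1 + s + p) / 2) * (1 - s + p)}) ?_)
  rintro x ⟨hx, hx1⟩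
  exact le_ncard_perps_quadric (l := [x]) (d := n) hodd h2 hS
    (by simpa [hx1, h2] using hx) (List.pairwise_singleton _ _) hc
    (mul_ne_zero (neg_ne_zero.mpr (div_ne_zero hf h2)) h1)

/-- The number of admissible pairs `(w₃, w₄)` of a frame is bounded below by a constant. -/
theorem exists_le_ncard_frame_pairs : ∃ r : ℕ,
    (Nat.card F - 2) * (Nat.card F - 1) ^ 3 * Nat.card F ^ (2 * n) ≤ Nat.card F ^ 2 * r ∧
    ∀ {s p : F} {x y : V × V}, 1 + s + p ≠ 0 → p ≠ 0 → 1 - s + p ≠ 0 →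
      x ∈ frameX Q a b c d s p → y ∈ frameY Q a b c d s p →
      r ≤ {w : V × V | IsFrame Q a b c d s p x.1 x.2 y.1 y.2 w.1 w.2}.ncard := by
  have hU : NonSing Q (Submodule.span F {a, b, c, d}) := nonSing_span hq
  have hUc := ncard_span hq h2
  have hY : NonSing Q (quadPerp Q a b c d) := nonSing_quadPerp hq h2 hQ
  have hYc : (quadPerp Q a b c d : Set V).ncard = Nat.card F ^ (n + 3) := ncard_quadPerp hq h2 hm
  have hT : NonSing Q (⊤ : Submodule F V) := nonSing_top hQ
  have hTc : ((⊤ : Submodule F V) : Set V).ncard = Nat.card F ^ (n + 7) := by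
    rw [Submodule.top_coe, Set.ncard_univ, hm]
  have hor : ∀ {x y : V}, x ∈ Submodule.span F {a, b, c, d} → y ∈ quadPerp Q a b c d →
      polar Q x y = 0 := fun hx hy => polar_span_quadPerp h2 hx hy
  have hro : ∀ {x y : V}, x ∈ Submodule.span F {a, b, c, d} → y ∈ quadPerp Q a b c d →
      polar Q y x = 0 := fun hx hy => (polar_comm _ _ _).trans (hor hx hy)
  cases n with
  | zero =>
    -- In dimension 7 only a line is left orthogonal to U and y₁, y₂, too little to prescribe norms
    -- there. So w₄ is chosen first, inside U, where it equals its projection, and then w₃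
    -- orthogonal to everything chosen.
    refine ⟨(Nat.card F - 1) * (Nat.card F - 1), ?_, ?_⟩
    · have h1 : Nat.card F - 2 ≤ Nat.card F := Nat.sub_le _ _
      have h3 : Nat.card F - 1 ≤ Nat.card F := Nat.sub_le _ _
      calc (Nat.card F - 2) * (Nat.card F - 1) ^ 3 * Nat.card F ^ (2 * 0)
          = (Nat.card F - 2) * (Nat.card F - 1) * ((Nat.card F - 1) * (Nat.card F - 1)) := by ring
        _ ≤ Nat.card F * Nat.card F * ((Nat.card F - 1) * (Nat.card F - 1)) := by gcongr
        _ = _ := by ring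
    rintro s p ⟨x₁, x₂⟩ ⟨y₁, y₂⟩ hf hp h1 ⟨⟨mx1, nx1⟩, mx2, nx2⟩ ⟨⟨my1, ny1⟩, my2, ny2⟩
    simp only [mem_perps, List.mem_singleton, forall_eq] at mx1 nx1 mx2 nx2 my1 ny1 my2 ny2 ⊢
    obtain ⟨mx2, px⟩ := mx2
    obtain ⟨my2, py⟩ := my2
    have n1 : Q x₁ ≠ 0 := by rw [nx1]; exact neg_ne_zero.mpr one_ne_zero
    have n2 : Q x₂ ≠ 0 := by rw [nx2]; exact mul_ne_zero hf hp
    have n3 : Q y₁ ≠ 0 := by rw [ny1]; exact h2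
    have n4 : Q y₂ ≠ 0 := by
      rw [ny2]; exact mul_ne_zero (neg_ne_zero.mpr (div_ne_zero hf h2)) h1
    have e1 := le_ncard_perps_quadric (l := [x₁, x₂]) (d := 0) hodd h2 hU
      (by simpa using ⟨⟨mx1, n1⟩, mx2, n2⟩)
      (by simpa using (polar_comm _ _ _).trans px) hUc hf
    have e2 : ∀ w ∈ {v | v ∈ perps Q (Submodule.span F {a, b, c, d}) [x₁, x₂] ∧
        Q v = 1 + s + p}, Nat.card F - 1 ≤
        {v | v ∈ perps Q ⊤ [x₁, x₂, y₁, y₂, w] ∧ Q v = -1}.ncard := by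
      rintro w ⟨hw, nw⟩
      simp only [mem_perps, List.forall_mem_cons, List.not_mem_nil, false_implies, implies_true,
        and_true] at hw
      have hp' : [x₁, x₂, y₁, y₂, w].Pairwise fun e e' => polar Q e e' = 0 := by
        simp only [List.pairwise_cons, List.forall_mem_cons, List.not_mem_nil, false_implies,
          implies_true, and_true, List.Pairwise.nil]
        exact ⟨⟨(polar_comm _ _ _).trans px, hor mx1 my1, hor mx1 my2, (polar_comm _ _ _).trans hw.2.1⟩,
          ⟨hor mx2 my1, hor mx2 my2, (polar_comm _ _ _).trans hw.2.2⟩,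
          ⟨(polar_comm _ _ _).trans py, hro hw.1 my1⟩, hro hw.1 my2⟩
      have := le_ncard_perps_quadric (d := 0) hodd h2 hT
        (by simpa using ⟨n1, n2, n3, n4, nw ▸ hf⟩) hp' hTc
        (neg_ne_zero.mpr (one_ne_zero (α := F)))
      rwa [pow_zero, mul_one] at this
    rw [pow_zero, mul_one] at e1
    refine (Nat.mul_le_mul_right _ e1).trans ((mul_le_ncard_fibration _ _ e2).trans ?_)
    refine Set.ncard_le_ncard_of_injOn Prod.swap ?_ (Prod.swap_injective.injOn)
    rintro ⟨w₄, w₃⟩ ⟨⟨h4, n4'⟩, h3, n3'⟩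
    simp only [mem_perps, List.forall_mem_cons, List.not_mem_nil, false_implies, implies_true,
      and_true] at h3 h4 n4' n3'
    exact ⟨mx1, mx2, my1, my2, (polar_comm _ _ _).trans px, (polar_comm _ _ _).trans py, nx1, nx2,
      ny1, ny2, h3.2.1, h3.2.2.1, h3.2.2.2.1, h3.2.2.2.2.1, h4.2.1, h4.2.2, hor h4.1 my1,
      hor h4.1 my2, n3', n4', h3.2.2.2.2.2, (polar_proj_left hq h4.1).trans h3.2.2.2.2.2,
      Or.inr (by change Q (proj Q a b c d w₄) ≠ 0; rw [proj_eq_self_of_mem hq h4.1, n4']; exact hf)⟩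
  | succ n =>
    -- In dimension at least 8, w₃ = u + y with u in U and y orthogonal to U, and w₄ is orthogonal
    -- to both components. The factor q² on the other side absorbs the index shift and makes the
    -- bound uniform with dimension 7.
    refine ⟨(Nat.card F - 2) * (Nat.card F - 1) * ((Nat.card F - 1) * Nat.card F ^ n) *
      ((Nat.card F - 1) * Nat.card F ^ n), le_of_eq (by ring), ?_⟩
    rintro s p ⟨x₁, x₂⟩ ⟨y₁, y₂⟩ hf hp h1 ⟨⟨mx1, nx1⟩, mx2, nx2⟩ ⟨⟨my1, ny1⟩, my2, ny2⟩
    simp only [mem_perps, List.mem_singleton, forall_eq] at mx1 nx1 mx2 nx2 my1 ny1 my2 ny2 ⊢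
    obtain ⟨mx2, px⟩ := mx2
    obtain ⟨my2, py⟩ := my2
    have n1 : Q x₁ ≠ 0 := by rw [nx1]; exact neg_ne_zero.mpr one_ne_zero
    have n2 : Q x₂ ≠ 0 := by rw [nx2]; exact mul_ne_zero hf hp
    have n3 : Q y₁ ≠ 0 := by rw [ny1]; exact h2
    have n4 : Q y₂ ≠ 0 := by
      rw [ny2]; exact mul_ne_zero (neg_ne_zero.mpr (div_ne_zero hf h2)) h1
    obtain ⟨hU₂, hU₂c⟩ := nonSing_perps (l := [x₁, x₂]) (d := 2) h2 hU
      (by simpa using ⟨⟨mx1, n1⟩, mx2, n2⟩) (by simpa using (polar_comm _ _ _).trans px) hUc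
    have e1 := le_ncard_norm_ne hodd h2 hU₂ hU₂c
    have e2 : ∀ u ∈ {v | v ∈ perps Q (Submodule.span F {a, b, c, d}) [x₁, x₂] ∧
        Q v ≠ 0 ∧ Q v ≠ -1}, (Nat.card F - 1) * Nat.card F ^ n ≤
        {v | v ∈ perps Q (quadPerp Q a b c d) [y₁, y₂] ∧ Q v = -1 - Q u}.ncard := by
      rintro u ⟨-, -, hu⟩
      exact le_ncard_perps_quadric (l := [y₁, y₂]) (d := n) hodd h2 hY (by simpa using ⟨⟨my1, n3⟩, my2, n4⟩)
        (by simpa using (polar_comm _ _ _).trans py) hYc (fun h => hu (by linear_combination -h))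
    have e12 := (Nat.mul_le_mul_right _ e1).trans (mul_le_ncard_fibration _ _ e2)
    have e3 : ∀ w ∈ {w : V × V | w.1 ∈ {v | v ∈ perps Q (Submodule.span F {a, b, c, d}) [x₁, x₂] ∧
        Q v ≠ 0 ∧ Q v ≠ -1} ∧
        w.2 ∈ {v | v ∈ perps Q (quadPerp Q a b c d) [y₁, y₂] ∧ Q v = -1 - Q w.1}},
        (Nat.card F - 1) * Nat.card F ^ n ≤
        {v | v ∈ perps Q ⊤ [x₁, x₂, y₁, y₂, w.1, w.2] ∧ Q v = 1 + s + p}.ncard := by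
      rintro ⟨u, y⟩ ⟨⟨hu, nu, nu'⟩, hy, ny⟩
      simp only [mem_perps, List.forall_mem_cons, List.not_mem_nil, false_implies, implies_true,
        and_true] at hu hy nu nu' ny ⊢
      have ny' : Q y ≠ 0 := by
        rw [ny]
        exact fun h => nu' (by linear_combination -h)
      have hp' : [x₁, x₂, y₁, y₂, u, y].Pairwise fun e e' => polar Q e e' = 0 := by
        simp only [List.pairwise_cons, List.forall_mem_cons, List.not_mem_nil, false_implies,
          implies_true, and_true, List.Pairwise.nil]
        exact ⟨⟨(polar_comm _ _ _).trans px, hor mx1 my1, hor mx1 my2,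
          (polar_comm _ _ _).trans hu.2.1, hor mx1 hy.1⟩,
          ⟨hor mx2 my1, hor mx2 my2, (polar_comm _ _ _).trans hu.2.2, hor mx2 hy.1⟩,
          ⟨(polar_comm _ _ _).trans py, hro hu.1 my1, (polar_comm _ _ _).trans hy.2.1⟩,
          ⟨hro hu.1 my2, (polar_comm _ _ _).trans hy.2.2⟩, hor hu.1 hy.1⟩
      have := le_ncard_perps_quadric (d := n) hodd h2 hT
        (by simpa using ⟨n1, n2, n3, n4, nu, ny'⟩) hp' hTc hf
      simpa only [mem_perps, List.forall_mem_cons, List.not_mem_nil, false_implies, implies_true,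
        and_true] using this
    refine (Nat.mul_le_mul_right _ e12).trans ((mul_le_ncard_fibration _ _ e3).trans ?_)
    refine Set.ncard_le_ncard_of_injOn (fun w => (w.1.1 + w.1.2, w.2)) ?_ ?_
    · rintro ⟨⟨u, y⟩, w₄⟩ ⟨⟨⟨hu, nu, nu'⟩, hy, ny⟩, h4, n4'⟩
      simp only [mem_perps, List.forall_mem_cons, List.not_mem_nil, false_implies, implies_true,
        and_true] at hu hy nu nu' ny h4 n4'
      have hpr : proj Q a b c d (u + y) = u := by
        rw [map_add, proj_eq_self_of_mem hq hu.1, proj_quadPerp h2 hy.1, add_zero]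
      have hadd : ∀ {v : V}, polar Q u v = 0 → polar Q y v = 0 → polar Q (u + y) v = 0 := by
        intro v h3 h5
        rw [QuadraticMap.polar_add_left, h3, h5, add_zero]
      have hu4 := (polar_comm _ _ _).trans h4.2.2.2.2.2.1
      exact ⟨mx1, mx2, my1, my2, (polar_comm _ _ _).trans px, (polar_comm _ _ _).trans py, nx1, nx2,
        ny1, ny2, hadd hu.2.1 (hro mx1 hy.1), hadd hu.2.2 (hro mx2 hy.1), hadd (hor hu.1 my1) hy.2.1,
        hadd (hor hu.1 my2) hy.2.2, h4.2.1, h4.2.2.1, h4.2.2.2.1, h4.2.2.2.2.1,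
        by change Q (u + y) = -1; rw [map_add_eq, ny, hor hu.1 hy.1]; ring, n4',
        hadd hu4 ((polar_comm _ _ _).trans h4.2.2.2.2.2.2),
        by change polar Q (proj Q a b c d (u + y)) w₄ = 0; rw [hpr]; exact hu4,
        Or.inl (by change Q (proj Q a b c d (u + y)) ≠ 0; rw [hpr]; exact nu)⟩
    · rintro ⟨⟨u, y⟩, w₄⟩ ⟨⟨⟨hu, -⟩, hy, -⟩, -⟩ ⟨⟨u', y'⟩, w₄'⟩ ⟨⟨⟨hu', -⟩, hy', -⟩, -⟩ he
      simp only [mem_perps] at hu hy hu' hy'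
      simp only [Prod.mk.injEq] at he
      obtain ⟨he, rfl⟩ := he
      have h3 := congrArg (proj Q a b c d) he
      rw [map_add, map_add, proj_eq_self_of_mem hq hu.1, proj_quadPerp h2 hy.1,
        proj_eq_self_of_mem hq hu'.1, proj_quadPerp h2 hy'.1, add_zero, add_zero] at h3
      subst h3
      rw [add_left_cancel he]

theorem le_ncard_frames {k : ℕ} (hk : Nat.card F = 2 * k + 1) {ε : F} (hε : ε ^ k = -1) :
    k * k * (((Nat.card F - 1) * Nat.card F ^ 2) * ((Nat.card F - 1) * Nat.card F) *
      (((Nat.card F - 1) * Nat.card F ^ (n + 1)) * ((Nat.card F - 1) * Nat.card F ^ n) *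
      ((Nat.card F - 2) * (Nat.card F - 1) ^ 3 * Nat.card F ^ (2 * n)))) ≤
    Nat.card F ^ 2 * (frames Q a b c d k ε).ncard := by
  obtain ⟨r, hr, hr'⟩ := exists_le_ncard_frame_pairs hq hQ hodd h2 hm
  set X := ((Nat.card F - 1) * Nat.card F ^ 2) * ((Nat.card F - 1) * Nat.card F) with hX
  set Y := ((Nat.card F - 1) * Nat.card F ^ (n + 1)) * ((Nat.card F - 1) * Nat.card F ^ n) with hY
  have key : k * k * (X * (Y * r)) ≤ (frames Q a b c d k ε).ncard := by
    refine (Nat.mul_le_mul_right _ (le_ncard_params hk h2 hε)).trans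
      ((mul_le_ncard_fibration (params k ε) (fun t => {z : (V × V) × (V × V) × (V × V) |
        IsFrame Q a b c d (paramTrace ε t) (paramNorm ε t) z.1.1 z.1.2 z.2.1.1 z.2.1.2 z.2.2.1
          z.2.2.2}) ?_).trans le_rfl)
    intro t ht
    have htr := isTriple_of_mem_params hk h2 hε ht
    have hf := htr.f_ne_zero hk h2
    have hp := htr.p_ne_zero hk h2
    have h1 := htr.eval_one_ne_zero hk h2
    generalize paramTrace ε t = s at *
    generalize paramNorm ε t = p at *
    have inner : ∀ x ∈ frameX Q a b c d s p, Y * r ≤ {z : (V × V) × (V × V) |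
        z.1 ∈ frameY Q a b c d s p ∧
        z.2 ∈ {w : V × V | IsFrame Q a b c d s p x.1 x.2 z.1.1 z.1.2 w.1 w.2}}.ncard := fun x hx =>
      (Nat.mul_le_mul_right _ (le_ncard_frameY hq hQ hodd h2 hm hf h1)).trans
        (mul_le_ncard_fibration (frameY Q a b c d s p) (fun y : V × V =>
          {w : V × V | IsFrame Q a b c d s p x.1 x.2 y.1 y.2 w.1 w.2})
          fun y hy => hr' hf hp h1 hx hy)
    refine (Nat.mul_le_mul_right _ (le_ncard_frameX hq hodd h2 hf hp)).trans
      ((mul_le_ncard_fibration (frameX Q a b c d s p) (fun x : V × V => {z : (V × V) × (V × V) |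
        z.1 ∈ frameY Q a b c d s p ∧
        z.2 ∈ {w : V × V | IsFrame Q a b c d s p x.1 x.2 z.1.1 z.1.2 w.1 w.2}}) inner).trans
        (Set.ncard_le_ncard ?_))
    rintro z ⟨-, -, hz⟩
    exact hz
  calc _ ≤ k * k * (X * (Y * (Nat.card F ^ 2 * r))) := by gcongr
    _ = Nat.card F ^ 2 * (k * k * (X * (Y * r))) := by ring
    _ ≤ _ := Nat.mul_le_mul_left _ key

end

end Count

/-- The counts combine to a ratio of at least (1 - 1/q)¹¹(1 - 2/q)/512. As (3/2)¹¹ < 128, the first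
factor is at least 1/128 for q ≥ 3, and 512 · 128 = 2¹⁶. The summand -1/q¹¹ is simply dropped. -/
theorem ratio_bound {q fr gd tot : ℝ} {n : ℕ} (hq3 : 3 ≤ q) (h0 : 0 ≤ tot)
    (h1 : (q - 1) / 2 * ((q - 1) / 2) * ((q - 1) * q ^ 2 * ((q - 1) * q) *
      ((q - 1) * q ^ (n + 1) * ((q - 1) * q ^ n) * ((q - 2) * (q - 1) ^ 3 * q ^ (2 * n))))
      ≤ q ^ 2 * fr)
    (h3 : fr * (2 * (q - 1) ^ 2 * q ^ 4) ≤ gd * 64) (h4 : tot ≤ 4 * q ^ (4 * (n + 3) + 6)) :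
    (1 / 2 ^ 16 - 1 / q ^ 11) * (1 - 2 / q) * tot ≤ gd := by
  have hpos : 0 < q := by linarith
  have hq2 : 0 < q ^ 2 := pow_pos hpos 2
  have hgd : (q - 1) ^ 11 * (q - 2) * q ^ (4 * n + 6) ≤ 128 * gd := by
    have t : 0 ≤ 2 * (q - 1) ^ 2 * q ^ 4 :=
      mul_nonneg (mul_nonneg two_pos.le (sq_nonneg _)) (pow_nonneg hpos.le 4)
    have h5 := mul_le_mul_of_nonneg_right h1 t
    have h6 := mul_le_mul_of_nonneg_left h3 hq2.le
    have h7 : q ^ 2 * ((q - 1) ^ 11 * (q - 2) * q ^ (4 * n + 6)) ≤ q ^ 2 * (128 * gd) := by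
      refine le_trans (le_of_eq ?_) ((mul_le_mul_of_nonneg_left (h5.trans
        (le_trans (le_of_eq ?_) h6)) two_pos.le).trans (le_of_eq ?_)) <;> ring
    exact le_of_mul_le_mul_left h7 hq2
  have hpow : q ^ 11 ≤ 128 * (q - 1) ^ 11 := by
    have h5 : (2 * q) ^ 11 ≤ (3 * (q - 1)) ^ 11 := pow_le_pow_left₀ (by linarith) (by linarith) 11
    have h6 : 0 ≤ (q - 1) ^ 11 := pow_nonneg (by linarith) 11
    rw [mul_pow, mul_pow] at h5
    norm_num at h5
    linarith
  have hu : 0 ≤ 1 - 2 / q := by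
    rw [sub_nonneg, div_le_one hpos]; linarith
  have hA : (1 / 2 ^ 16 - 1 / q ^ 11) * (1 - 2 / q) ≤ 1 / 2 ^ 16 * (1 - 2 / q) :=
    mul_le_mul_of_nonneg_right (sub_le_self _ (by positivity)) hu
  have hn : 0 ≤ (q - 2) * q ^ (4 * n + 6) / 2 ^ 14 :=
    div_nonneg (mul_nonneg (by linarith) (pow_nonneg hpos.le _)) (by norm_num)
  calc (1 / 2 ^ 16 - 1 / q ^ 11) * (1 - 2 / q) * tot ≤ 1 / 2 ^ 16 * (1 - 2 / q) * tot :=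
        mul_le_mul_of_nonneg_right hA h0
    _ ≤ 1 / 2 ^ 16 * (1 - 2 / q) * (4 * q ^ (4 * (n + 3) + 6)) :=
      mul_le_mul_of_nonneg_left h4 (mul_nonneg (by norm_num) hu)
    _ = q ^ 11 * ((q - 2) * q ^ (4 * n + 6) / 2 ^ 14) := by field_simp; ring
    _ ≤ 128 * (q - 1) ^ 11 * ((q - 2) * q ^ (4 * n + 6) / 2 ^ 14) :=
      mul_le_mul_of_nonneg_right hpow hn
    _ = (q - 1) ^ 11 * (q - 2) * q ^ (4 * n + 6) / 128 := by ring
    _ ≤ gd := by linarith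

section Count

variable {F V : Type*} [Field F] [AddCommGroup V] [Module F V] {Q : QuadraticForm F V}

/-- The hyperbolic quadruples that span the second 4-space of a frame. -/
def frameQuads (Q : QuadraticForm F V) (a b c d : V) (k : ℕ) (ε : F) : Set ((V × V) × (V × V)) :=
  {z | z ∈ hypQuads Q ⊤ ∧ ∃ θ ∈ frames Q a b c d k ε,
    tupleSpace ε θ = Submodule.span F {z.1.1, z.2.1, z.1.2, z.2.2}}

variable [Finite F] [Finite V] {a b c d : V} (hq : IsHyperbolicQuadruple Q a b c d)
  (h2 : (2 : F) ≠ 0) {k : ℕ} (hk : Nat.card F = 2 * k + 1) {ε : F} (hε : ε ^ k = -1)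
include hq h2 hk hε

/-- Count pairs of a frame and a quadruple spanning its second 4-space. Each frame occurs with all
quadruples of a hyperbolic 4-space, each quadruple with at most 64 frames. -/
theorem ncard_frames_mul_le : (frames Q a b c d k ε).ncard *
    (2 * (Nat.card F - 1) ^ 2 * Nat.card F ^ 4) ≤ (frameQuads Q a b c d k ε).ncard * 64 := by
  have hex : ∀ θ ∈ frames Q a b c d k ε, ∃ a' b' c' d', IsHyperbolicQuadruple Q a' b' c' d' ∧
      tupleSpace ε θ = Submodule.span F {a', b', c', d'} := by
    rintro θ ⟨hp, h⟩
    exact h.exists_quadruple h2 ((isTriple_of_mem_params hk h2 hε hp).f_ne_zero hk h2)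
  have h1 := mul_le_ncard_fibration (frames Q a b c d k ε)
    (fun θ => hypQuads Q (tupleSpace ε θ)) (k := 2 * (Nat.card F - 1) ^ 2 * Nat.card F ^ 4) (by
      intro θ hθ
      obtain ⟨a', b', c', d', hq', hs⟩ := hex θ hθ
      rw [hs]
      exact le_ncard_hypQuads h2 hq')
  have h3 := ncard_fibration_le (frameQuads Q a b c d k ε)
    (fun z => {θ | θ ∈ frames Q a b c d k ε ∧
      tupleSpace ε θ = Submodule.span F {z.1.1, z.2.1, z.1.2, z.2.2}})
    fun z _ => ncard_frames_fiber_le hk h2 hε hq _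
  refine h1.trans (le_trans ?_ h3)
  refine Set.ncard_le_ncard_of_injOn Prod.swap ?_ Prod.swap_injective.injOn
  rintro ⟨θ, ⟨a₁, c₁⟩, ⟨b₁, d₁⟩⟩ ⟨hθ, hz⟩
  obtain ⟨a', b', c', d', hq', hs⟩ := hex θ hθ
  simp only [hs, mem_hypQuads h2] at hz
  obtain ⟨hq₁, m1, m2, m3, m4⟩ := hz
  have hspan : tupleSpace ε θ = Submodule.span F {a₁, b₁, c₁, d₁} :=
    hs.trans (span_eq_of_mem h2 hq' hq₁ m1 m2 m3 m4).symm
  exact ⟨⟨(mem_hypQuads h2).mpr ⟨hq₁, trivial, trivial, trivial, trivial⟩, θ, hθ, hspan⟩, hθ, hspan⟩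

theorem frameQuads_ratio (hk0 : 0 < k) (hQ : Q.polarBilin.Nondegenerate) {n : ℕ}
    (hm : Nat.card V = Nat.card F ^ (n + 7)) :
    (1 / 2 ^ 16 - 1 / (Nat.card F : ℝ) ^ 11) * (1 - 2 / (Nat.card F : ℝ)) *
      (hypQuads Q (⊤ : Submodule F V)).ncard ≤ (frameQuads Q a b c d k ε).ncard := by
  have hodd : Odd (Nat.card F) := hk ▸ odd_two_mul_add_one k
  have h1 := le_ncard_frames hq hQ hodd h2 hm hk hε
  have h3 := ncard_frames_mul_le hq h2 hk hε
  have h4 := ncard_hypQuads_top_le h2 hQ (m := n + 3) hm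
  have hq3 : 3 ≤ Nat.card F := by omega
  have h1' := (Nat.cast_le (α := ℝ)).mpr h1
  have h3' := (Nat.cast_le (α := ℝ)).mpr h3
  have h4' := (Nat.cast_le (α := ℝ)).mpr h4
  have hkr : (k : ℝ) = ((Nat.card F : ℝ) - 1) / 2 := by rw [hk]; push_cast; ring
  push_cast [Nat.cast_sub (show 1 ≤ Nat.card F by omega),
    Nat.cast_sub (show 2 ≤ Nat.card F by omega), hkr] at h1' h3' h4'
  exact ratio_bound (by exact_mod_cast hq3) (Nat.cast_nonneg _) h1' h3' h4'

end Count

/-! ### Involutions as powers, and normalizers -/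

section GroupTheory

variable {G : Type*} [Group G]

/-- If a power of `x` is an involution, then it is the involution in `⟨x⟩`. -/
theorem involutionOf_eq_pow {x : G} {N : ℕ} (h : orderOf (x ^ N) = 2) :
    Even (orderOf x) ∧ involutionOf x = x ^ N := by
  have hsq : x ^ (2 * N) = 1 := by
    rw [mul_comm, pow_mul, ← h, pow_orderOf_eq_one]
  have hne : x ^ N ≠ 1 := by
    intro h0
    rw [h0, orderOf_one] at h
    exact absurd h (by norm_num)
  have hd : orderOf x ∣ 2 * N := orderOf_dvd_of_pow_eq_one hsq
  have hnd : ¬ orderOf x ∣ N := fun h0 => hne (orderOf_dvd_iff_pow_eq_one.mp h0)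
  have he : Even (orderOf x) := by
    by_contra ho
    rw [Nat.not_even_iff_odd] at ho
    exact hnd (Nat.Coprime.dvd_of_dvd_mul_left (Nat.coprime_two_right.mpr ho) hd)
  refine ⟨he, ?_⟩
  obtain ⟨m, hm⟩ := even_iff_two_dvd.mp he
  have hm1 : x ^ m * x ^ m = 1 := by
    rw [← pow_add, ← two_mul, ← hm, pow_orderOf_eq_one]
  rw [involutionOf, hm, Nat.mul_div_cancel_left _ two_pos]
  rw [hm] at hd hnd
  obtain ⟨t, rfl⟩ := Nat.dvd_of_mul_dvd_mul_left two_pos hd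
  have ht : Odd t := by
    by_contra ho
    rw [Nat.not_odd_iff_even] at ho
    obtain ⟨r, rfl⟩ := even_iff_two_dvd.mp ho
    exact hnd ⟨r, by ring⟩
  obtain ⟨r, rfl⟩ := ht
  rw [pow_mul, pow_succ, pow_mul, sq, hm1, one_pow, one_mul]

theorem zeta0_eq_pow {i g : G} {N : ℕ} (h : orderOf ((i * (g⁻¹ * i * g)) ^ N) = 2) :
    zeta0 i g = (i * (g⁻¹ * i * g)) ^ N := by
  obtain ⟨he, hi⟩ := involutionOf_eq_pow h
  rw [zeta0, if_pos he, hi]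

theorem mem_normalizer_of_mul_self {H : Subgroup G} {t : G} (ht : t * t = 1)
    (h : ∀ g ∈ H, t * g * t⁻¹ ∈ H) : t ∈ Subgroup.normalizer (H : Set G) := by
  have hinv : t⁻¹ = t := inv_eq_of_mul_eq_one_left ht
  rw [Subgroup.mem_normalizer_iff]
  refine fun g => ⟨h g, fun hg => ?_⟩
  have := h _ hg
  rw [hinv] at this
  convert this using 1
  rw [show t * (t * g * t) * t = (t * t) * g * (t * t) by group, ht, one_mul, mul_one]

end GroupTheory

/-! ### From frames to classical involutions in the projective group -/

section Involutions

variable {F V : Type*} [Field F] [AddCommGroup V] [Module F V] {Q : QuadraticForm F V}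

theorem IsNeg.conj {a b c d : V} {i g : V ≃ₗ[F] V} (hi : IsNeg Q a b c d i)
    (hg : g ∈ orthogonalGroup Q) : IsNeg Q (g a) (g b) (g c) (g d) (g * i * g⁻¹) := by
  have hinv : ∀ v, g⁻¹ (g v) = v := fun v => g.symm_apply_apply v
  have hinv' : ∀ v, g (g⁻¹ v) = v := fun v => g.apply_symm_apply v
  have hp : ∀ v e, polar Q (g⁻¹ v) e = polar Q v (g e) := by
    intro v e
    rw [← polar_map hg, hinv']
  refine ⟨?_, ?_, ?_, ?_, fun v h1 h2 h3 h4 => ?_⟩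
  · rw [LinearEquiv.mul_apply, LinearEquiv.mul_apply, hinv, hi.map_a, map_neg]
  · rw [LinearEquiv.mul_apply, LinearEquiv.mul_apply, hinv, hi.map_b, map_neg]
  · rw [LinearEquiv.mul_apply, LinearEquiv.mul_apply, hinv, hi.map_c, map_neg]
  · rw [LinearEquiv.mul_apply, LinearEquiv.mul_apply, hinv, hi.map_d, map_neg]
  · rw [LinearEquiv.mul_apply, LinearEquiv.mul_apply, hi.map_perp (g⁻¹ v) (by rw [hp, h1])
      (by rw [hp, h2]) (by rw [hp, h3]) (by rw [hp, h4]), hinv']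

section

variable {a b c d : V} (hq : IsHyperbolicQuadruple Q a b c d)
include hq

theorem IsNeg.mul_self {g : V ≃ₗ[F] V} (hg : IsNeg Q a b c d g) : g * g = 1 := by
  ext v
  have hm := proj_eq_self_of_mem hq (proj_mem_span (Q := Q) a b c d v)
  rw [LinearEquiv.mul_apply, hg.apply hq v, map_sub, map_smul, hg.apply hq v, hg.apply hq, hm]
  change _ = v
  module

/-- Products of reflections in vectors of `⟨a, b, c, d⟩` and of its orthogonal space. -/
theorem refl_prod_conj_mem (h2 : (2 : F) ≠ 0) {x₁ x₂ y₁ y₂ : V}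
    (m1 : x₁ ∈ Submodule.span F {a, b, c, d}) (m2 : x₂ ∈ Submodule.span F {a, b, c, d})
    (n1 : Q x₁ ≠ 0) (n2 : Q x₂ ≠ 0) (p1 : y₁ ∈ quadPerp Q a b c d) (p2 : y₂ ∈ quadPerp Q a b c d)
    {g : V ≃ₗ[F] V} (hg : g ∈ rootSL2 Q a b c d) :
    (refl Q x₁ * refl Q x₂ * refl Q y₁ * refl Q y₂) * g *
      (refl Q x₁ * refl Q x₂ * refl Q y₁ * refl Q y₂)⁻¹ ∈ rootSL2 Q a b c d := by
  have hgo : g ∈ orthogonalGroup Q := Omega_le (rootSL2_le h2 hq hg)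
  -- The element `g` fixes `y` and hence commutes with its reflection.
  have hfix : ∀ y ∈ quadPerp Q a b c d, refl Q y * g * (refl Q y)⁻¹ = g := by
    intro y hy
    obtain ⟨h1, h3, h4, h5⟩ := (mem_quadPerp h2).mp hy
    obtain ⟨-, -, -, -, -, -, -, -, -, hf⟩ := rootSL2_action hq hg
    have := conj_refl hgo y
    rw [hf y h1 h3 h4 h5, mul_inv_eq_iff_eq_mul] at this
    rw [mul_inv_eq_iff_eq_mul, this]
  have e : (refl Q x₁ * refl Q x₂ * refl Q y₁ * refl Q y₂) * g *
      (refl Q x₁ * refl Q x₂ * refl Q y₁ * refl Q y₂)⁻¹ = refl Q x₁ * (refl Q x₂ *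
        (refl Q y₁ * (refl Q y₂ * g * (refl Q y₂)⁻¹) * (refl Q y₁)⁻¹) * (refl Q x₂)⁻¹) *
        (refl Q x₁)⁻¹ := by group
  rw [e, hfix _ p2, hfix _ p1]
  refine refl_conj_mem hq.twist n1 ?_
    (refl_conj_mem hq n2 (proj_eq_self_of_mem hq m2) hg)
  conv_rhs => rw [← proj_eq_self_of_mem hq m1, proj_apply]
  rw [proj_apply]
  module

/-- An element of order 2 of a long root `SL₂(q)` lifts to `-1` on a hyperbolic 4-space. -/
theorem exists_isNeg_lift (h2 : (2 : F) ≠ 0) {v : V} (hv : v ∈ quadPerp Q a b c d) (hv0 : v ≠ 0)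
    {i : POmega Q} (hi : orderOf i = 2)
    (hiK : i ∈ (longRootSubgroup Q a b ⊔ longRootSubgroup Q c d).map
      (QuotientGroup.mk' (scalars Q))) :
    ∃ t : Omega Q, QuotientGroup.mk' (scalars Q) t = i ∧ IsNeg Q a b c d t := by
  obtain ⟨t, ht, rfl⟩ := hiK
  refine ⟨t, rfl, ?_⟩
  have hR : (t : V ≃ₗ[F] V) ∈ rootSL2 Q a b c d := by
    rw [← map_longRootSubgroup h2 hq]
    exact ⟨t, ht, rfl⟩
  obtain ⟨-, -, -, -, -, -, -, -, -, hf⟩ := rootSL2_action hq hR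
  obtain ⟨h1, h3, h4, h5⟩ := (mem_quadPerp h2).mp hv
  have htv : (t : V ≃ₗ[F] V) v = v := hf v h1 h3 h4 h5
  have hsq : t * t ∈ scalars Q := by
    have := pow_orderOf_eq_one (QuotientGroup.mk' (scalars Q) t)
    rw [hi, sq, ← map_mul] at this
    exact (QuotientGroup.eq_one_iff _).mp this
  obtain ⟨r, hr⟩ := hsq
  -- The square of the lift could be any scalar of Ω(V), but the lift fixes a non-zero vector
  -- orthogonal to the 4-space.
  have hr1 : r = 1 := by
    have e : v = r • v := by
      rw [← hr v, Subgroup.coe_mul, LinearEquiv.mul_apply, htv, htv]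
    have e2 : (r - 1) • v = 0 := by linear_combination (norm := module) -e
    exact sub_eq_zero.mp ((smul_eq_zero.mp e2).resolve_right hv0)
  refine isNeg_of_sq_eq_one hq h2 hR ?_ ?_
  · ext x
    have := hr x
    rw [hr1, one_smul] at this
    exact this
  · intro h0
    have h1' : t = 1 := Subtype.ext h0
    rw [h1', map_one, orderOf_one] at hi
    exact absurd hi (by norm_num)

/-- The vector `v` is fixed while a is negated, so the isometry is not scalar and does not die in
the quotient. -/
theorem orderOf_mk_of_isNeg (h2 : (2 : F) ≠ 0) {v : V} (hv : v ∈ quadPerp Q a b c d) (hv0 : v ≠ 0)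
    {t : Omega Q} (ht : IsNeg Q a b c d t) : orderOf (QuotientGroup.mk' (scalars Q) t) = 2 := by
  refine orderOf_eq_prime ?_ ?_
  · rw [sq, ← map_mul, show t * t = 1 from Subtype.ext (ht.mul_self hq), map_one]
  · intro h0
    obtain ⟨r, hr⟩ : t ∈ scalars Q := (QuotientGroup.eq_one_iff _).mp h0
    obtain ⟨h1, h3, h4, h5⟩ := (mem_quadPerp h2).mp hv
    have e1 := (ht.map_perp v h1 h3 h4 h5).symm.trans (hr v)
    have e2 := ht.map_a.symm.trans (hr a)
    have ha : a ≠ 0 := by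
      rintro rfl
      have := hq.polar_ac
      rw [QuadraticMap.polar_zero_left] at this
      exact zero_ne_one this
    have f1 : (r - 1) • v = 0 := by linear_combination (norm := module) -e1
    have f2 : (r + 1) • a = 0 := by linear_combination (norm := module) -e2
    have g1 := (smul_eq_zero.mp f1).resolve_right hv0
    have g2 := (smul_eq_zero.mp f2).resolve_right ha
    exact h2 (by linear_combination g2 - g1)

theorem isClassicalInvolution_of_isNeg (h2 : (2 : F) ≠ 0) {v : V} (hv : v ∈ quadPerp Q a b c d)
    (hv0 : v ≠ 0) {t : Omega Q} (ht : IsNeg Q a b c d t) :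
    IsClassicalInvolution Q (QuotientGroup.mk' (scalars Q) t) := by
  refine ⟨orderOf_mk_of_isNeg hq h2 hv hv0 ht, _, ⟨a, b, c, d, hq, rfl⟩, ?_⟩
  obtain ⟨g, hg, hgn⟩ := exists_isNeg_mem_rootSL2 hq
  rw [← map_longRootSubgroup h2 hq] at hg
  obtain ⟨t', ht', rfl⟩ := hg
  rw [show t = t' from Subtype.ext (ht.unique hq hgn)]
  exact ⟨t', ht', rfl⟩

theorem mk_mem_normalizer (h2 : (2 : F) ≠ 0) {t : Omega Q} (hsq : t * t = 1)
    (ht : ∀ g ∈ rootSL2 Q a b c d, (t : V ≃ₗ[F] V) * g * (t : V ≃ₗ[F] V)⁻¹ ∈ rootSL2 Q a b c d) :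
    QuotientGroup.mk' (scalars Q) t ∈ Subgroup.normalizer
      (((longRootSubgroup Q a b ⊔ longRootSubgroup Q c d).map
        (QuotientGroup.mk' (scalars Q)) : Subgroup (POmega Q)) : Set (POmega Q)) := by
  refine mem_normalizer_of_mul_self (by rw [← map_mul, hsq, map_one]) ?_
  rintro _ ⟨g, hg, rfl⟩
  have hR : (g : V ≃ₗ[F] V) ∈ rootSL2 Q a b c d := by
    rw [← map_longRootSubgroup h2 hq]
    exact ⟨g, hg, rfl⟩
  have h1 := ht _ hR
  rw [← map_longRootSubgroup h2 hq] at h1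
  obtain ⟨g', hg', he⟩ := h1
  refine ⟨g', hg', ?_⟩
  rw [← map_inv, ← map_mul, ← map_mul]
  exact congrArg _ (Subtype.ext he)

/-- If the conjugate of `⟨a, b, c, d⟩` by `g⁻¹` is the second 4-space of a frame, then `ζ₀` maps `g`
to a classical involution that normalizes the long root `SL₂(q)`. -/
theorem zeta0_of_frame [Finite F] [Finite V] {k : ℕ} (hk0 : 0 < k)
    (hk : Nat.card F = 2 * k + 1) (h2 : (2 : F) ≠ 0) {n : ℕ}
    (hm : Nat.card V = Nat.card F ^ (n + 7)) {ε : F} (hε : ε ^ k = -1) {t g : Omega Q}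
    (ht : IsNeg Q a b c d t) {θ : (F × F) × (V × V) × (V × V) × (V × V)}
    (hθ : θ ∈ frames Q a b c d k ε)
    (hW : tupleSpace ε θ = Submodule.span F {(g⁻¹ : V ≃ₗ[F] V) a, (g⁻¹ : V ≃ₗ[F] V) b,
      (g⁻¹ : V ≃ₗ[F] V) c, (g⁻¹ : V ≃ₗ[F] V) d}) :
    IsClassicalInvolution Q
      (zeta0 (QuotientGroup.mk' (scalars Q) t) (QuotientGroup.mk' (scalars Q) g)) ∧
    zeta0 (QuotientGroup.mk' (scalars Q) t) (QuotientGroup.mk' (scalars Q) g) ∈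
      Subgroup.normalizer (((longRootSubgroup Q a b ⊔ longRootSubgroup Q c d).map
        (QuotientGroup.mk' (scalars Q)) : Subgroup (POmega Q)) : Set (POmega Q)) := by
  obtain ⟨hp, h⟩ := hθ
  have htr := isTriple_of_mem_params hk h2 hε hp
  have hgo : (g⁻¹ : V ≃ₗ[F] V) ∈ orthogonalGroup Q := inv_mem (Omega_le g.2)
  have hj := ht.conj hgo
  rw [inv_inv] at hj
  obtain ⟨a₀, b₀, c₀, d₀, hq₀, hz, hz'⟩ := h.mul_pow_eq hq hk0 hk h2 htr ht (hq.map hgo) hW hj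
  set N := (2 * k + 1) * (2 * k * (k + 1)) with hN
  set z : Omega Q := (t * (g⁻¹ * t * g)) ^ N with hzd
  have hzc : (z : V ≃ₗ[F] V) = ((t : V ≃ₗ[F] V) * ((g : V ≃ₗ[F] V)⁻¹ * t * g)) ^ N := rfl
  rw [← hzc] at hz hz'
  obtain ⟨v, hv, hv0⟩ : ∃ v ∈ quadPerp Q a₀ b₀ c₀ d₀, v ≠ 0 :=
    exists_ne_zero_of_ncard (d := n + 2) (ncard_quadPerp hq₀ h2 hm)
  have hord := orderOf_mk_of_isNeg hq₀ h2 hv hv0 hz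
  have hmk : QuotientGroup.mk' (scalars Q) z = (QuotientGroup.mk' (scalars Q) t *
      ((QuotientGroup.mk' (scalars Q) g)⁻¹ * QuotientGroup.mk' (scalars Q) t *
        QuotientGroup.mk' (scalars Q) g)) ^ N := rfl
  have hzeta : zeta0 (QuotientGroup.mk' (scalars Q) t) (QuotientGroup.mk' (scalars Q) g)
      = QuotientGroup.mk' (scalars Q) z := by
    rw [hmk] at hord ⊢
    exact zeta0_eq_pow hord
  rw [hzeta]
  refine ⟨isClassicalInvolution_of_isNeg hq₀ h2 hv hv0 hz,
    mk_mem_normalizer hq h2 (Subtype.ext (hz.mul_self hq₀)) ?_⟩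
  have n1 : Q θ.2.1.1 ≠ 0 := by rw [h.norm_x₁]; exact neg_ne_zero.mpr one_ne_zero
  have n2 : Q θ.2.1.2 ≠ 0 := by
    rw [h.norm_x₂]; exact mul_ne_zero (htr.f_ne_zero hk h2) (htr.p_ne_zero hk h2)
  intro x hx
  rw [hz']
  exact refl_prod_conj_mem hq h2 h.mem_x₁ h.mem_x₂ n1 n2 h.mem_y₁ h.mem_y₂ hx

end

end Involutions

theorem ncard_preimage_of_ncard_fiber {α β : Type*} [Finite α] [Finite β] (φ : α → β) (T : Set β)
    {r : ℕ} (h : ∀ z ∈ T, {g | φ g = z}.ncard = r) : {g | φ g ∈ T}.ncard = T.ncard * r := by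
  have e : {g | φ g ∈ T}.ncard = {p : β × α | p.1 ∈ T ∧ p.2 ∈ {g | φ g = p.1}}.ncard := by
    refine Set.ncard_congr (fun g _ => (φ g, g)) (fun g hg => ⟨hg, rfl⟩)
      (fun g g' _ _ he => (Prod.ext_iff.mp he).2) ?_
    rintro ⟨z, g⟩ ⟨hz, hg⟩
    have hg : φ g = z := hg
    subst hg
    exact ⟨g, hz, rfl⟩
  rw [e]
  exact le_antisymm (ncard_fibration_le T (fun z => {g | φ g = z}) fun z hz => (h z hz).le)
    (mul_le_ncard_fibration T (fun z => {g | φ g = z}) fun z hz => (h z hz).ge)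

theorem natCard_mul_of_quotient {G : Type*} [Group G] (N : Subgroup G) (P : G ⧸ N → Prop) :
    {g : G | P (QuotientGroup.mk g)}.ncard = Nat.card N * Nat.card {x : G ⧸ N // P x} := by
  rw [← Nat.card_coe_set_eq, ← Nat.card_prod]
  exact Nat.card_congr (QuotientGroup.preimageMkEquivSubgroupProdSet N {x | P x})

theorem two_ne_zero_of_odd_natCard {F : Type*} [Field F] [Finite F] (hodd : Odd (Nat.card F)) : (2 : F) ≠ 0 := by
  intro h0
  obtain ⟨k, hk⟩ := hodd
  have h1 : ((Nat.card F : ℕ) : F) = 0 := by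
    have := Fintype.ofFinite F
    rw [Nat.card_eq_fintype_card]
    exact Nat.cast_card_eq_zero F
  rw [hk] at h1
  push_cast at h1
  rw [h0, zero_mul, zero_add] at h1
  exact one_ne_zero h1

/-! ### Uniform distribution of the conjugate quadruple and the final estimate -/

section Probability

variable {F V : Type*} [Field F] [AddCommGroup V] [Module F V] {Q : QuadraticForm F V}

/-- The image of a hyperbolic quadruple under the inverse of an isometry. -/
def quadMap (a b c d : V) (g : Omega Q) : (V × V) × (V × V) :=
  (((g⁻¹ : V ≃ₗ[F] V) a, (g⁻¹ : V ≃ₗ[F] V) c), ((g⁻¹ : V ≃ₗ[F] V) b, (g⁻¹ : V ≃ₗ[F] V) d))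

theorem quadMap_mem_hypQuads (h2 : (2 : F) ≠ 0) {a b c d : V}
    (hq : IsHyperbolicQuadruple Q a b c d) (g : Omega Q) :
    quadMap a b c d g ∈ hypQuads Q (⊤ : Submodule F V) :=
  (mem_hypQuads h2).mpr ⟨hq.map (inv_mem (Omega_le g.2)), trivial, trivial, trivial, trivial⟩

variable [Finite F] [Finite V]

/-- All fibres are translates of the stabilizer of the quadruple, by transitivity of Ω(V). Hence
proportions of quadruples are proportions of group elements. -/
theorem exists_ncard_quadMap_fiber (hodd : Odd (Nat.card F)) (h2 : (2 : F) ≠ 0)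
    (hQ : Q.polarBilin.Nondegenerate) {m : ℕ} (hm : Nat.card V = Nat.card F ^ (m + 6))
    {a b c d : V} (hq : IsHyperbolicQuadruple Q a b c d) :
    ∃ r : ℕ, 0 < r ∧ ∀ z ∈ hypQuads Q (⊤ : Submodule F V),
      {g : Omega Q | quadMap a b c d g = z}.ncard = r := by
  have hfin : Finite (V ≃ₗ[F] V) := DFunLike.finite _
  refine ⟨{g : Omega Q | quadMap a b c d g = ((a, c), (b, d))}.ncard, ?_, ?_⟩
  · rw [Set.ncard_pos]
    exact ⟨1, rfl⟩
  · rintro ⟨⟨a', c'⟩, ⟨b', d'⟩⟩ hz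
    obtain ⟨hq', -⟩ := (mem_hypQuads h2).mp hz
    obtain ⟨g₀, hg₀, rfl, rfl, rfl, rfl⟩ := exists_Omega_quadruple hq hodd h2 hQ hm hq'
    refine Set.ncard_congr (fun g _ => g * ⟨g₀, hg₀⟩) ?_ ?_ ?_
    · intro g hg
      simp only [quadMap, Set.mem_ofPred_eq, Prod.mk.injEq] at hg ⊢
      obtain ⟨⟨h1, h3⟩, h4, h5⟩ := hg
      simp only [Subgroup.coe_mul, mul_inv_rev, LinearEquiv.mul_apply, h1, h3, h4, h5]
      exact ⟨⟨g₀.symm_apply_apply a, g₀.symm_apply_apply c⟩, g₀.symm_apply_apply b,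
        g₀.symm_apply_apply d⟩
    · intro g g' _ _ he
      exact mul_right_cancel he
    · intro g hg
      refine ⟨g * ⟨g₀, hg₀⟩⁻¹, ?_, inv_mul_cancel_right _ _⟩
      simp only [quadMap, Set.mem_ofPred_eq, Prod.mk.injEq] at hg ⊢
      obtain ⟨⟨h1, h3⟩, h4, h5⟩ := hg
      simp only [Subgroup.coe_mul, Subgroup.coe_inv, mul_inv_rev, inv_inv, LinearEquiv.mul_apply,
        h1, h3, h4, h5, and_self]

end Probability

end OrthogonalBlackBox

open OrthogonalBlackBox in
theorem mainTheorem4 {F V : Type*} [Field F] [Finite F] [AddCommGroup V] [Module F V]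
    [FiniteDimensional F V] (hodd : Odd (Nat.card F))
    (Q : QuadraticForm F V) (hQ : Q.polarBilin.Nondegenerate) (hn : 7 ≤ Module.finrank F V)
    (K : Subgroup (POmega Q)) (hK : IsLongRootSL2 Q K)
    (i : POmega Q) (hiK : i ∈ K) (hi : orderOf i = 2) :
    (1 / 2 ^ 16 - 1 / (Nat.card F : ℝ) ^ 11) * (1 - 2 / (Nat.card F : ℝ)) ≤
      (Nat.card {g : POmega Q // IsClassicalInvolution Q (zeta0 i g) ∧
        zeta0 i g ∈ Subgroup.normalizer (K : Set (POmega Q))} : ℝ) / Nat.card (POmega Q) := by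
  have hfinV : Finite V := Module.finite_of_finite F
  have hfin : Finite (V ≃ₗ[F] V) := DFunLike.finite _
  have h2 : (2 : F) ≠ 0 := two_ne_zero_of_odd_natCard hodd
  obtain ⟨k, hk⟩ := hodd
  have hk0 : 0 < k := by
    have := Finite.one_lt_card (α := F)
    omega
  have hodd : Odd (Nat.card F) := ⟨k, hk⟩
  obtain ⟨n, hn'⟩ := Nat.exists_eq_add_of_le' hn
  have hm : Nat.card V = Nat.card F ^ (n + 7) := by
    rw [Module.natCard_eq_pow_finrank (K := F), hn']
  obtain ⟨ε, hε⟩ := exists_pow_eq_neg_one hk h2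
  obtain ⟨a, b, c, d, hq, rfl⟩ := hK
  obtain ⟨v, hv, hv0⟩ : ∃ v ∈ quadPerp Q a b c d, v ≠ 0 :=
    exists_ne_zero_of_ncard (d := n + 2) (ncard_quadPerp hq h2 hm)
  obtain ⟨t, rfl, ht⟩ := exists_isNeg_lift hq h2 hv hv0 hi hiK
  set K := (longRootSubgroup Q a b ⊔ longRootSubgroup Q c d).map (QuotientGroup.mk' (scalars Q))
  set P : POmega Q → Prop := fun g =>
    IsClassicalInvolution Q (zeta0 (QuotientGroup.mk' (scalars Q) t) g) ∧
      zeta0 (QuotientGroup.mk' (scalars Q) t) g ∈ Subgroup.normalizer (K : Set (POmega Q)) with hP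
  obtain ⟨r, hr0, hr⟩ := exists_ncard_quadMap_fiber (m := n + 1) hodd h2 hQ hm hq
  have hratio := frameQuads_ratio hq h2 hk hε hk0 hQ hm
  -- An inclusion in Ω(V) is enough for the lower bound; the good elements form a union of cosets of
  -- the scalars, so dividing by the scalars keeps the proportion.
  have hgood : (frameQuads Q a b c d k ε).ncard * r ≤
      Nat.card (scalars Q) * Nat.card {x : POmega Q // P x} := by
    rw [← natCard_mul_of_quotient (scalars Q) P, ← ncard_preimage_of_ncard_fiber
      (quadMap a b c d) (frameQuads Q a b c d k ε) fun z hz => hr z hz.1]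
    refine Set.ncard_le_ncard ?_
    rintro g ⟨-, θ, hθ, hW⟩
    exact zeta0_of_frame hq hk0 hk h2 hm hε ht hθ hW
  have htot : (hypQuads Q (⊤ : Submodule F V)).ncard * r
      = Nat.card (scalars Q) * Nat.card (POmega Q) := by
    rw [← ncard_preimage_of_ncard_fiber (quadMap a b c d) _ hr,
      Set.eq_univ_of_forall (s := {g : Omega Q | quadMap a b c d g ∈ hypQuads Q ⊤})
        (quadMap_mem_hypQuads h2 hq), Set.ncard_univ, mul_comm]
    exact (scalars Q).card_eq_card_quotient_mul_card_subgroup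
  have hs0 : (0 : ℝ) < Nat.card (scalars Q) := Nat.cast_pos.mpr Nat.card_pos
  have hp0 : (0 : ℝ) < Nat.card (POmega Q) := Nat.cast_pos.mpr Nat.card_pos
  have hgood' := (Nat.cast_le (α := ℝ)).mpr hgood
  have htot' := congrArg (Nat.cast (R := ℝ)) htot
  push_cast at hgood' htot'
  rw [le_div_iff₀ hp0]
  refine le_of_mul_le_mul_left ?_ hs0
  refine le_trans ?_ hgood'
  refine le_trans (le_of_eq ?_) (mul_le_mul_of_nonneg_right hratio (Nat.cast_nonneg r))
  linear_combination (-((1 / 2 ^ 16 - 1 / (Nat.card F : ℝ) ^ 11) * (1 - 2 / (Nat.card F : ℝ)))) * htot'
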